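/- **Conventions.** A space is locally compact if each point has a compact Hausdorff neighbourhood; it need not be Hausdorff. $C_c(X)$ is the linear span of the functions which are continuous with compact support on some open Hausdorff $U\subseteq X$ and are extended by $0$ (on a Hausdorff space: the usual $C_c(X)$). Measures are positive, Radon and $\sigma$-finite. A continuous family of measures along a continuous map $\pi\colon X\to B$ is a family $\{\lambda_b\}_{b\in B}$ with $\lambda_b$ a measure on $\pi^{-1}(b)$ such that $b\mapsto\int f\,d\lambda_b$ lies in $C_c(B)$ for each $f\in C_c(X)$. A locally compact groupoid is a topological groupoid $G$ that is locally compact and whose unit space $G^{(0)}$ is Hausdorff; a Haar system on it is a left invariant continuous family of measures along $r_G$ with $\operatorname{supp}\chi^u=r_G^{-1}(u)$ for all $u$. A topological correspondence from $(G,\chi)$ to $(H,\kappa)$ is a locally compact $G$-$H$-bispace $X$, with momentum maps $r_X\colon X\to G^{(0)}$, $s_X\colon X\to H^{(0)}$, whose $H$-action is proper, together with an $H$-invariant continuous family of nonzero measures $\lambda=\{\lambda_u\}$ along $s_X$ that has an adjoining function: a continuous $\Delta\colon G\times_{G^{(0)}}X\to(0,\infty)$ with $$\int_X\int_G F(\gamma^{-1},x)\,d\chi^{r_X(x)}(\gamma)\,d\lambda_u(x)=\int_X\int_G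 F(\gamma,\gamma^{-1}x)\,\Delta(\gamma,\gamma^{-1}x)\,d\chi^{r_X(x)}(\gamma)\,d\lambda_u(x)$$ for all $u\in H^{(0)}$, $F\in C_c(G\times_{G^{(0)}}X)$. **Proposition.** Let $(X,\alpha)$ and $(Y,\beta)$ be topological correspondences from $(G_1,\chi_1)$ to $(G_2,\chi_2)$ and from $(G_2,\chi_2)$ to $(G_3,\chi_3)$, where $(G_i,\chi_i)$ are locally compact groupoids with Haar systems and $X,Y$ are Hausdorff and second countable. Let $Z=X\times_{s_X,G_2^{(0)},r_Y}Y$ with the diagonal action $(x,y)\gamma=(x\gamma,\gamma^{-1}y)$ of $G_2$, let $\Omega=Z/G_2$, $s_\Omega[x,y]=s_Y(y)$, $[x,y]\gamma_3=[x,y\gamma_3]$ for $\gamma_3\in G_3$, and assume that the transformation groupoid $Z\rtimes G_2$ is Hausdorff (for instance, that $G_2$ is Hausdorff). For $f\in C_c(Z)$ put $$\int_Z f\,dm_u=\int_Y\int_X f(x,y)\,d\alpha_{r_Y(y)}(x)\,d\beta_u(y),\qquad \int f\,d\lambda^{[x,y]}=\int_{G_2}f(x\gamma,\gamma^{-1}y)\,d\chi_2^{r_Y(y)}(\gamma).$$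 Let $\Delta_2$ be an adjoining function of $(Y,\beta)$, and let $\mathcal B$ be the set of all $G_3$-invariant continuous functions $b\colon Z\to(0,\infty)$ with $b(x\gamma,\gamma^{-1}y)\,b(x,y)^{-1}=\Delta_2(\gamma^{-1},y)$ for all $((x,y),\gamma)\in Z\rtimes G_2$. 1. If $\Delta_2$ is a $G_3$-invariant $1$-cocycle on $G_2\ltimes Y$, then $\mathcal B\neq\emptyset$. 2. Let $b\in\mathcal B$. For each $u\in G_3^{(0)}$ there is a unique measure $\mu_u$ on $\Omega$ with $b\,m_u=\mu_u\circ\lambda$, that is, $\int_Z b f\,dm_u=\int_\Omega\int f\,d\lambda^{\omega}\,d\mu_u(\omega)$ for all $f\in C_c(Z)$; and $\{\mu_u\}_{u\in G_3^{(0)}}$ is a $G_3$-invariant continuous family of measures along $s_\Omega\colon\Omega\to G_3^{(0)}$, where $G_3$-invariance means $\int_\Omega f(\omega\gamma)\,d\mu_{r(\gamma)}(\omega)=\int_\Omega f\,d\mu_{s(\gamma)}$ for all $\gamma\in G_3$ and $f\in C_c(\Omega)$. -/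

import Mathlib

open MeasureTheory Topology

/-- Every point has a neighbourhood that is compact and Hausdorff. The space itself need not be
Hausdorff. -/
def IsLocCompact (X : Type*) [TopologicalSpace X] : Prop :=
  ∀ x : X, ∃ K ∈ 𝓝 x, IsCompact K ∧ T2Space K

/-- The space `C_c(X)` of a locally compact, possibly non-Hausdorff space: the linear span of the
functions that are continuous with compact support on some open Hausdorff subset `U` and are
extended by zero outside `U`. -/
def Cc (X : Type*) [TopologicalSpace X] : Submodule ℂ (X → ℂ) :=
  Submodule.span ℂ {f | ∃ U K : Set X, IsOpen U ∧ T2Space U ∧ K ⊆ U ∧ IsCompact K ∧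
    ContinuousOn f U ∧ ∀ x, x ∉ K → f x = 0}

/-- On a Hausdorff space `Cc X` consists of the continuous functions with compact support. -/
theorem mem_Cc_iff {X : Type*} [TopologicalSpace X] [T2Space X] (f : X → ℂ) :
    f ∈ Cc X ↔ Continuous f ∧ HasCompactSupport f := by
  constructor
  · intro hf
    refine Submodule.span_induction ?_ ?_ ?_ ?_ hf
    · rintro g ⟨U, K, hU, -, hKU, hK, hg, h0⟩
      refine ⟨?_, HasCompactSupport.intro hK h0⟩
      rw [continuous_iff_continuousAt]
      intro x
      by_cases hx : x ∈ U
      · exact hg.continuousAt (hU.mem_nhds hx)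
      · have hxK : x ∈ Kᶜ := fun h => hx (hKU h)
        have h1 : g =ᶠ[𝓝 x] fun _ => (0 : ℂ) := by
          filter_upwards [hK.isClosed.isOpen_compl.mem_nhds hxK] with y hy using h0 y hy
        exact continuousAt_const.congr h1.symm
    · exact ⟨continuous_const, HasCompactSupport.zero⟩
    · rintro g h - - ⟨hg, hg2⟩ ⟨hh, hh2⟩
      exact ⟨hg.add hh, hg2.add hh2⟩
    · rintro c g - ⟨hg, hg2⟩
      exact ⟨hg.const_smul c, hg2.smul_left⟩
  · rintro ⟨hf, hf2⟩
    refine Submodule.subset_span ⟨Set.univ, tsupport f, isOpen_univ, inferInstance,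
      Set.subset_univ _, hf2, hf.continuousOn, fun x hx => image_eq_zero_of_notMem_tsupport hx⟩

/-- A locally compact groupoid with space of arrows `G` and Hausdorff space of units `B`. The
operation `mul` is total for convenience; only its values on composable pairs matter. -/
structure LCGroupoid (B G : Type*) [TopologicalSpace B] [TopologicalSpace G] where
  r : G → B
  s : G → B
  unit : B → G
  inv : G → G
  mul : G → G → G
  r_unit : ∀ u, r (unit u) = u
  s_unit : ∀ u, s (unit u) = u
  r_inv : ∀ γ, r (inv γ) = s γ
  s_inv : ∀ γ, s (inv γ) = r γ
  r_mul : ∀ γ η, s γ = r η → r (mul γ η) = r γ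
  s_mul : ∀ γ η, s γ = r η → s (mul γ η) = s η
  mul_assoc : ∀ γ η ζ, s γ = r η → s η = r ζ → mul (mul γ η) ζ = mul γ (mul η ζ)
  unit_mul : ∀ γ, mul (unit (r γ)) γ = γ
  mul_unit : ∀ γ, mul γ (unit (s γ)) = γ
  mul_inv : ∀ γ, mul γ (inv γ) = unit (r γ)
  inv_mul : ∀ γ, mul (inv γ) γ = unit (s γ)
  continuous_r : Continuous r
  continuous_s : Continuous s
  continuous_unit : Continuous unit
  continuous_inv : Continuous inv
  continuousOn_mul : ContinuousOn (fun p : G × G => mul p.1 p.2) {p | s p.1 = r p.2}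
  isLocCompact : IsLocCompact G
  t2_units : T2Space B

/-- Positive, Radon and `σ`-finite measures. -/
structure IsRadon {X : Type*} [TopologicalSpace X] [MeasurableSpace X] (ν : Measure X) : Prop where
  regular : ν.Regular
  sigmaFinite : SigmaFinite ν

/-- A continuous family of measures along `π : X → B`: the measure `lam b` lives on the fibre
`π⁻¹(b)`, and integration maps `C_c(X)` to `C_c(B)`. A measure on the closed subspace `π⁻¹(b)` is
regarded as a measure on `X` that vanishes on the complement. -/
structure IsContinuousFamily {X B : Type*} [TopologicalSpace X] [MeasurableSpace X]
    [TopologicalSpace B] (π : X → B) (lam : B → Measure X) : Prop where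
  continuous_map : Continuous π
  isRadon : ∀ b, IsRadon (lam b)
  fibre : ∀ b, lam b (π ⁻¹' {b})ᶜ = 0
  integral_mem : ∀ f ∈ Cc X, (fun b => ∫ x, f x ∂(lam b)) ∈ Cc B

/-- A (left invariant, fully supported) Haar system on a locally compact groupoid. -/
structure HaarSystem {B G : Type*} [TopologicalSpace B] [TopologicalSpace G] [MeasurableSpace G]
    (𝒢 : LCGroupoid B G) where
  meas : B → Measure G
  continuousFamily : IsContinuousFamily 𝒢.r meas
  full_support : ∀ (u : B) (V : Set G), IsOpen V → (V ∩ 𝒢.r ⁻¹' {u}).Nonempty → 0 < meas u V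
  left_invariant : ∀ γ, ∀ f ∈ Cc G,
    ∫ η, f (𝒢.mul γ η) ∂(meas (𝒢.s γ)) = ∫ η, f η ∂(meas (𝒢.r γ))

/-- A `G`-`H`-bispace: `lact γ x` is the left action of `G` with momentum map `rm`, and `ract x η`
is the right action of `H` with momentum map `sm`. Only values at composable arguments matter. -/
structure Bispace {B G C H : Type*} [TopologicalSpace B] [TopologicalSpace G]
    [TopologicalSpace C] [TopologicalSpace H] (𝒢 : LCGroupoid B G) (ℋ : LCGroupoid C H)
    (X : Type*) [TopologicalSpace X] where
  rm : X → B
  lact : G → X → X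
  sm : X → C
  ract : X → H → X
  continuous_rm : Continuous rm
  continuous_sm : Continuous sm
  rm_lact : ∀ γ x, 𝒢.s γ = rm x → rm (lact γ x) = 𝒢.r γ
  unit_lact : ∀ x, lact (𝒢.unit (rm x)) x = x
  mul_lact : ∀ γ η x, 𝒢.s γ = 𝒢.r η → 𝒢.s η = rm x →
    lact (𝒢.mul γ η) x = lact γ (lact η x)
  continuousOn_lact : ContinuousOn (fun p : G × X => lact p.1 p.2) {p | 𝒢.s p.1 = rm p.2}
  sm_ract : ∀ x η, sm x = ℋ.r η → sm (ract x η) = ℋ.s η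
  ract_unit : ∀ x, ract x (ℋ.unit (sm x)) = x
  ract_mul : ∀ x γ η, sm x = ℋ.r γ → ℋ.s γ = ℋ.r η →
    ract x (ℋ.mul γ η) = ract (ract x γ) η
  continuousOn_ract : ContinuousOn (fun p : X × H => ract p.1 p.2) {p | sm p.1 = ℋ.r p.2}
  sm_lact : ∀ γ x, 𝒢.s γ = rm x → sm (lact γ x) = sm x
  rm_ract : ∀ x η, sm x = ℋ.r η → rm (ract x η) = rm x
  lact_ract : ∀ γ x η, 𝒢.s γ = rm x → sm x = ℋ.r η →
    ract (lact γ x) η = lact γ (ract x η)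

/-- Invariance of a family of measures on a right `H`-space with momentum map `sm` and action
`ract`. -/
def IsRightInvariant {C H X : Type*} [TopologicalSpace C] [TopologicalSpace H]
    [TopologicalSpace X] [MeasurableSpace X] (ℋ : LCGroupoid C H) (ract : X → H → X)
    (lam : C → Measure X) : Prop :=
  ∀ η, ∀ f ∈ Cc X, ∫ x, f (ract x η) ∂(lam (ℋ.r η)) = ∫ x, f x ∂(lam (ℋ.s η))

section Correspondence

variable {B G C H : Type*} [TopologicalSpace B] [TopologicalSpace G] [MeasurableSpace G]
  [TopologicalSpace C] [TopologicalSpace H] [MeasurableSpace H]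

/-- `Δ` is an adjoining function: a positive continuous function on the fibre product
`G ×_B X = {(γ, x) | s(γ) = r_X(x)}` with
`∫∫ F(γ⁻¹, x) dχ(γ) dλ_u(x) = ∫∫ F(γ, γ⁻¹x) Δ(γ, γ⁻¹x) dχ(γ) dλ_u(x)` for all `u` and all
`F ∈ C_c(G ×_B X)`. -/
structure IsAdjoiningFunction {X : Type*} [TopologicalSpace X] [MeasurableSpace X]
    {𝒢 : LCGroupoid B G} (χ : HaarSystem 𝒢) {ℋ : LCGroupoid C H} (S : Bispace 𝒢 ℋ X)
    (lam : C → Measure X) (Δ : G → X → ℝ) : Prop where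
  continuousOn : ContinuousOn (fun p : G × X => Δ p.1 p.2) {p | 𝒢.s p.1 = S.rm p.2}
  pos : ∀ γ x, 𝒢.s γ = S.rm x → 0 < Δ γ x
  integral_eq : ∀ u, ∀ F ∈ Cc {p : G × X // 𝒢.s p.1 = S.rm p.2},
    ∫ x, ∫ γ, Function.extend Subtype.val F 0 (𝒢.inv γ, x) ∂(χ.meas (S.rm x)) ∂(lam u) =
      ∫ x, ∫ γ, Function.extend Subtype.val F 0 (γ, S.lact (𝒢.inv γ) x) *
        (Δ γ (S.lact (𝒢.inv γ) x) : ℂ) ∂(χ.meas (S.rm x)) ∂(lam u)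

/-- A topological correspondence from `(𝒢, χ)` to `(ℋ, κ)` with underlying space `X`. -/
structure TopCorrespondence (𝒢 : LCGroupoid B G) (χ : HaarSystem 𝒢) (ℋ : LCGroupoid C H)
    (_κ : HaarSystem ℋ) (X : Type*) [TopologicalSpace X] [MeasurableSpace X]
    extends Bispace 𝒢 ℋ X where
  isLocCompact : IsLocCompact X
  /-- the right action is proper -/
  proper_action : IsProperMap
    (fun p : {p : X × H // sm p.1 = ℋ.r p.2} => (p.1.1, ract p.1.1 p.1.2))
  meas : C → Measure X
  continuousFamily : IsContinuousFamily sm meas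
  /-- the family of measures is proper -/
  meas_ne_zero : ∀ u, meas u ≠ 0
  invariant : IsRightInvariant ℋ ract meas
  exists_adjoining : ∃ Δ, IsAdjoiningFunction χ toBispace meas Δ

end Correspondence

section Composition

variable {B₁ G₁ B₂ G₂ B₃ G₃ X Y : Type*}
  [TopologicalSpace B₁] [TopologicalSpace G₁] [TopologicalSpace B₂] [TopologicalSpace G₂]
  [TopologicalSpace B₃] [TopologicalSpace G₃] [TopologicalSpace X] [TopologicalSpace Y]
  {𝒢₁ : LCGroupoid B₁ G₁} {𝒢₂ : LCGroupoid B₂ G₂} {𝒢₃ : LCGroupoid B₃ G₃}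

/-- The fibre product `Z = X ×_{B₂} Y`. -/
abbrev FibreProd (S : Bispace 𝒢₁ 𝒢₂ X) (T : Bispace 𝒢₂ 𝒢₃ Y) : Type _ :=
  {p : X × Y // S.sm p.1 = T.rm p.2}

/-- The space of arrows of the transformation groupoid `Z ⋊ G₂`. -/
abbrev TransArrows (S : Bispace 𝒢₁ 𝒢₂ X) (T : Bispace 𝒢₂ 𝒢₃ Y) : Type _ :=
  {q : FibreProd S T × G₂ // S.sm q.1.1.1 = 𝒢₂.r q.2}

/-- The orbit relation of the diagonal action `(x, y)γ = (xγ, γ⁻¹y)` of `G₂` on `Z`. -/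
def orbitSetoid (S : Bispace 𝒢₁ 𝒢₂ X) (T : Bispace 𝒢₂ 𝒢₃ Y) : Setoid (FibreProd S T) where
  r z w := ∃ γ, S.sm z.1.1 = 𝒢₂.r γ ∧ w.1 = (S.ract z.1.1 γ, T.lact (𝒢₂.inv γ) z.1.2)
  iseqv := by
    constructor
    · rintro ⟨⟨x, y⟩, h⟩
      dsimp only at h
      have hi : 𝒢₂.inv (𝒢₂.unit (T.rm y)) = 𝒢₂.unit (T.rm y) := by
        have h1 := 𝒢₂.inv_mul (𝒢₂.unit (T.rm y))
        have h2 := 𝒢₂.mul_unit (𝒢₂.inv (𝒢₂.unit (T.rm y)))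
        rw [𝒢₂.s_inv, 𝒢₂.r_unit] at h2
        rw [𝒢₂.s_unit] at h1
        rw [← h2, h1]
      refine ⟨𝒢₂.unit (S.sm x), (𝒢₂.r_unit _).symm, ?_⟩
      dsimp only
      rw [S.ract_unit, h, hi, T.unit_lact]
    · rintro ⟨⟨x, y⟩, h⟩ ⟨⟨x', y'⟩, h'⟩ ⟨γ, hγ, e⟩
      dsimp only at h h' hγ e
      obtain ⟨rfl, rfl⟩ := Prod.mk.inj e
      have hinv : 𝒢₂.inv (𝒢₂.inv γ) = γ := by
        have h1 := 𝒢₂.mul_assoc (𝒢₂.inv (𝒢₂.inv γ)) (𝒢₂.inv γ) γ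
          (by rw [𝒢₂.s_inv]) (by rw [𝒢₂.s_inv])
        rw [𝒢₂.inv_mul, 𝒢₂.inv_mul, 𝒢₂.s_inv, 𝒢₂.unit_mul] at h1
        have h2 := 𝒢₂.mul_unit (𝒢₂.inv (𝒢₂.inv γ))
        rw [𝒢₂.s_inv, 𝒢₂.r_inv] at h2
        rw [← h2, ← h1]
      refine ⟨𝒢₂.inv γ, ?_, ?_⟩
      · dsimp only
        rw [S.sm_ract _ _ hγ, 𝒢₂.r_inv]
      · dsimp only
        rw [hinv, ← S.ract_mul x γ _ hγ (by rw [𝒢₂.r_inv]), 𝒢₂.mul_inv, ← hγ, S.ract_unit,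
          ← T.mul_lact γ _ y (by rw [𝒢₂.r_inv]) (by rw [𝒢₂.s_inv, ← hγ, h]), 𝒢₂.mul_inv, ← hγ, h,
          T.unit_lact]
    · rintro ⟨⟨x, y⟩, h⟩ ⟨⟨x', y'⟩, h'⟩ ⟨⟨x'', y''⟩, h''⟩ ⟨γ, hγ, e⟩ ⟨η, hη, e'⟩
      dsimp only at h h' h'' hγ hη e e'
      obtain ⟨rfl, rfl⟩ := Prod.mk.inj e
      obtain ⟨rfl, rfl⟩ := Prod.mk.inj e'
      have hc : 𝒢₂.s γ = 𝒢₂.r η := by rw [← hη, S.sm_ract _ _ hγ]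
      have hinv : 𝒢₂.inv (𝒢₂.mul γ η) = 𝒢₂.mul (𝒢₂.inv η) (𝒢₂.inv γ) := by
        have c1 : 𝒢₂.s (𝒢₂.inv η) = 𝒢₂.r (𝒢₂.inv γ) := by rw [𝒢₂.s_inv, 𝒢₂.r_inv, hc]
        have k : 𝒢₂.mul (𝒢₂.mul (𝒢₂.inv η) (𝒢₂.inv γ)) (𝒢₂.mul γ η) = 𝒢₂.unit (𝒢₂.s η) := by
          rw [𝒢₂.mul_assoc _ _ _ c1 (by rw [𝒢₂.s_inv, 𝒢₂.r_mul _ _ hc]),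
            ← 𝒢₂.mul_assoc (𝒢₂.inv γ) γ η (by rw [𝒢₂.s_inv]) hc, 𝒢₂.inv_mul, hc, 𝒢₂.unit_mul,
            𝒢₂.inv_mul]
        have k2 := 𝒢₂.mul_assoc (𝒢₂.mul (𝒢₂.inv η) (𝒢₂.inv γ)) (𝒢₂.mul γ η)
          (𝒢₂.inv (𝒢₂.mul γ η)) (by rw [𝒢₂.s_mul _ _ c1, 𝒢₂.s_inv, 𝒢₂.r_mul _ _ hc])
          (by rw [𝒢₂.r_inv])
        have k3 := 𝒢₂.unit_mul (𝒢₂.inv (𝒢₂.mul γ η))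
        rw [𝒢₂.r_inv, 𝒢₂.s_mul _ _ hc] at k3
        have k4 := 𝒢₂.mul_unit (𝒢₂.mul (𝒢₂.inv η) (𝒢₂.inv γ))
        rw [𝒢₂.s_mul _ _ c1, 𝒢₂.s_inv] at k4
        rw [k, k3, 𝒢₂.mul_inv, 𝒢₂.r_mul _ _ hc, k4] at k2
        exact k2
      refine ⟨𝒢₂.mul γ η, ?_, ?_⟩
      · dsimp only
        rw [𝒢₂.r_mul _ _ hc, hγ]
      · dsimp only
        rw [hinv, S.ract_mul _ _ _ hγ hc, T.mul_lact _ _ _ (by rw [𝒢₂.s_inv, 𝒢₂.r_inv, hc])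
          (by rw [𝒢₂.s_inv, ← hγ, h])]

/-- The quotient `Ω = Z / G₂`, with the quotient topology and its Borel `σ`-algebra. -/
def Omega (S : Bispace 𝒢₁ 𝒢₂ X) (T : Bispace 𝒢₂ 𝒢₃ Y) : Type _ :=
  Quotient (orbitSetoid S T)

instance (S : Bispace 𝒢₁ 𝒢₂ X) (T : Bispace 𝒢₂ 𝒢₃ Y) : TopologicalSpace (Omega S T) :=
  inferInstanceAs (TopologicalSpace (Quotient (orbitSetoid S T)))

instance (S : Bispace 𝒢₁ 𝒢₂ X) (T : Bispace 𝒢₂ 𝒢₃ Y) : MeasurableSpace (Omega S T) :=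
  borel _

instance (S : Bispace 𝒢₁ 𝒢₂ X) (T : Bispace 𝒢₂ 𝒢₃ Y) : BorelSpace (Omega S T) :=
  ⟨rfl⟩

/-- The quotient map `π : Z → Ω`, `(x, y) ↦ [x, y]`. -/
def omegaMk (S : Bispace 𝒢₁ 𝒢₂ X) (T : Bispace 𝒢₂ 𝒢₃ Y) (z : FibreProd S T) : Omega S T :=
  Quotient.mk (orbitSetoid S T) z

theorem sm_eq_of_orbit {S : Bispace 𝒢₁ 𝒢₂ X} {T : Bispace 𝒢₂ 𝒢₃ Y} {z w : FibreProd S T}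
    (h : (orbitSetoid S T).r z w) : T.sm w.1.2 = T.sm z.1.2 := by
  obtain ⟨γ, hγ, e⟩ := h
  rw [e]
  exact T.sm_lact _ _ (by rw [𝒢₂.s_inv, ← hγ, z.2])

/-- The momentum map `s_Ω[x, y] = s_Y(y)`. -/
def omegaMomentum (S : Bispace 𝒢₁ 𝒢₂ X) (T : Bispace 𝒢₂ 𝒢₃ Y) : Omega S T → B₃ :=
  Quotient.lift (fun z => T.sm z.1.2) fun _ _ h => (sm_eq_of_orbit h).symm

open Classical in
/-- The right action `[x, y]γ = [x, yγ]` of `G₃` on `Ω`; it is the identity (a value without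
meaning) where `s_Y(y) ≠ r(γ)`. -/
noncomputable def omegaAct (S : Bispace 𝒢₁ 𝒢₂ X) (T : Bispace 𝒢₂ 𝒢₃ Y) (ω : Omega S T) (η : G₃) :
    Omega S T :=
  Quotient.lift
    (fun z : FibreProd S T =>
      if h : T.sm z.1.2 = 𝒢₃.r η then
        omegaMk S T ⟨(z.1.1, T.ract z.1.2 η), by rw [T.rm_ract _ _ h]; exact z.2⟩
      else omegaMk S T z)
    (by
      intro z w hzw
      have hs := sm_eq_of_orbit hzw
      by_cases h : T.sm z.1.2 = 𝒢₃.r η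
      · have h2 : T.sm w.1.2 = 𝒢₃.r η := hs.trans h
        simp only [dif_pos h, dif_pos h2]
        obtain ⟨γ, hγ, e⟩ := hzw
        refine Quotient.sound ⟨γ, hγ, ?_⟩
        dsimp only
        rw [e, ← T.lact_ract _ _ _ (by rw [𝒢₂.s_inv, ← hγ, z.2]) h]
      · have h2 : ¬ T.sm w.1.2 = 𝒢₃.r η := fun h3 => h (hs.symm.trans h3)
        simp only [dif_neg h, dif_neg h2]
        exact Quotient.sound hzw)
    ω

/-- `∫_Z f dm_u = ∫_Y ∫_X f(x, y) dα_{r_Y(y)}(x) dβ_u(y)`. -/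
noncomputable def productIntegral [MeasurableSpace X] [MeasurableSpace Y] (S : Bispace 𝒢₁ 𝒢₂ X)
    (T : Bispace 𝒢₂ 𝒢₃ Y) (α : B₂ → Measure X) (β : B₃ → Measure Y) (u : B₃)
    (f : FibreProd S T → ℂ) : ℂ :=
  ∫ y, ∫ x, Function.extend Subtype.val f 0 (x, y) ∂(α (T.rm y)) ∂(β u)

/-- `∫ f dλ^ω = ∫ f(xγ, γ⁻¹y) dχ₂^{r_Y(y)}(γ)` for `ω = [x, y]`. By left invariance of `χ₂` the
representative of `ω` does not matter. -/
noncomputable def orbitIntegral [MeasurableSpace G₂] (χ₂ : HaarSystem 𝒢₂) (S : Bispace 𝒢₁ 𝒢₂ X)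
    (T : Bispace 𝒢₂ 𝒢₃ Y) (f : FibreProd S T → ℂ) (ω : Omega S T) : ℂ :=
  let z : FibreProd S T := Quotient.out ω
  ∫ γ, Function.extend Subtype.val f 0 (S.ract z.1.1 γ, T.lact (𝒢₂.inv γ) z.1.2)
    ∂(χ₂.meas (T.rm z.1.2))

/-- The identity `b m_u = ν ∘ λ` of measures on `Z`, tested on `C_c(Z)`. -/
def Disintegrates [MeasurableSpace G₂] [MeasurableSpace X] [MeasurableSpace Y]
    (χ₂ : HaarSystem 𝒢₂) (S : Bispace 𝒢₁ 𝒢₂ X) (T : Bispace 𝒢₂ 𝒢₃ Y) (α : B₂ → Measure X)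
    (β : B₃ → Measure Y) (b : FibreProd S T → ℝ) (u : B₃) (ν : Measure (Omega S T)) : Prop :=
  ∀ f ∈ Cc (FibreProd S T),
    productIntegral S T α β u (fun z => (b z : ℂ) * f z) = ∫ ω, orbitIntegral χ₂ S T f ω ∂ν

/-- `b` is a positive continuous `G₃`-invariant function on `Z` with
`b(xγ, γ⁻¹y) b(x, y)⁻¹ = Δ₂(γ⁻¹, y)`. -/
structure IsDecomposition (S : Bispace 𝒢₁ 𝒢₂ X) (T : Bispace 𝒢₂ 𝒢₃ Y) (Δ₂ : G₂ → Y → ℝ)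
    (b : FibreProd S T → ℝ) : Prop where
  continuous : Continuous b
  pos : ∀ z, 0 < b z
  invariant : ∀ (z w : FibreProd S T) (η : G₃), T.sm z.1.2 = 𝒢₃.r η →
    w.1 = (z.1.1, T.ract z.1.2 η) → b w = b z
  decomposes : ∀ (z w : FibreProd S T) (γ : G₂), S.sm z.1.1 = 𝒢₂.r γ →
    w.1 = (S.ract z.1.1 γ, T.lact (𝒢₂.inv γ) z.1.2) →
    b w * (b z)⁻¹ = Δ₂ (𝒢₂.inv γ) z.1.2

/-- `Δ₂` is a `G₃`-invariant multiplicative `1`-cocycle on `G₂ ⋉ Y`. -/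
structure IsInvariantCocycle (T : Bispace 𝒢₂ 𝒢₃ Y) (Δ₂ : G₂ → Y → ℝ) : Prop where
  mul : ∀ γ η y, 𝒢₂.s γ = 𝒢₂.r η → 𝒢₂.s η = T.rm y →
    Δ₂ (𝒢₂.mul γ η) y = Δ₂ γ (T.lact η y) * Δ₂ η y
  invariant : ∀ γ y ζ, 𝒢₂.s γ = T.rm y → T.sm y = 𝒢₃.r ζ → Δ₂ γ (T.ract y ζ) = Δ₂ γ y

end Composition

/-!
Write `π : Z → Ω` for the quotient map, `λ f` for the orbit integral of `f` and `m_u` for the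
product integral. The argument rests on continuity of fibre integrals, on the symmetry of `b m_u`,
and on averaging of cocycles over orbits.

*Fibre integrals.* `G₂` need not be Hausdorff, so continuous functions with compact support on
`Z ⋊ G₂` are split by a partition of unity into pieces whose `G₂`-coordinates stay in an open
Hausdorff set (`CcAlong.exists_sum_isPiece`); this is where the Hausdorff assumption on `Z ⋊ G₂`
enters. For one piece, the integrand near a parameter is uniformly close to a fixed function of
`C_c(G₂)`, which gives continuity (`IsContinuousFamily.continuous_integral_of_isCompact`). Since
the action on `X` is proper, the orbit integral of `f ∈ C_c(Z)` is a function in `C_c(Ω)`, and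
every function in `C_c(Ω)` arises in this way (`orbitIntegral_mem_Cc`, `exists_orbitIntegral_eq`).

*Disintegration.* Fubini's theorem, invariance of `α` and the defining property of `Δ₂` show that
inversion of `Z ⋊ G₂` transforms `m_u ∘ χ₂` by the factor `Δ₂(γ, γ⁻¹y)` (`productIntegral_twist`).
As `b(xγ, γ⁻¹y) Δ₂(γ, γ⁻¹y) = b(x, y)`, this means `m_u(b f · λ g ∘ π) = m_u(b g · λ f ∘ π)`
(`productIntegral_symm`). Choosing `g` with `λ g = 1` on the support of `f` shows that `λ f = 0`
implies `m_u(b f) = 0`. Hence `λ f ↦ m_u(b f)` is a well defined positive functional on `C_c(Ω)`,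
and the Riesz–Markov–Kakutani theorem gives `μ_u` and its uniqueness. Continuity in `u`, the
support condition and invariance under `G₃` follow from the same properties of `β` by lifting
functions from `Ω` to `Z`.

*Existence of `b`.* Choose a weight `e ≥ 0` on `X` whose integrals over the orbits are positive
and finite. With `c(γ, y) = log Δ₂(γ⁻¹, y)`, the function `h(x, y) = -∫ e(xγ) c(γ, y) dχ₂(γ) /
∫ e(xγ) dχ₂(γ)` satisfies `h(xγ, γ⁻¹y) - h(x, y) = c(γ, y)` by the cocycle identity, and `b = exp h`
is as required (`exists_isDecomposition`). The weight depends on `x` only, so `b` inherits the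
`G₃`-invariance of `Δ₂`. The weight is a series of bump functions with rapidly decreasing
coefficients, and its integrals are only formed over points of `Z`, because `X ⋊ G₂` need not be
Hausdorff.
-/

/-! ### Functions with compact support in an open Hausdorff subset -/

/-- The generators of `Cc E` that live on the open set `U`: continuous on `U`, and zero outside
a compact subset of `U`. -/
def CcOn {E : Type*} [TopologicalSpace E] (U : Set E) (f : E → ℂ) : Prop :=
  ContinuousOn f U ∧ ∃ K ⊆ U, IsCompact K ∧ ∀ x, x ∉ K → f x = 0

theorem CcOn.mem_Cc {E : Type*} [TopologicalSpace E] {U : Set E} {f : E → ℂ} (hf : CcOn U f)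
    (hU : IsOpen U) [hT : T2Space U] : f ∈ Cc E := by
  obtain ⟨hf, K, hKU, hK, h0⟩ := hf
  exact Submodule.subset_span ⟨U, K, hU, hT, hKU, hK, hf, h0⟩

theorem continuousOn_extend {E F : Type*} [TopologicalSpace E] [TopologicalSpace F] {U : Set E}
    {g : U → F} {h : E → F} (hg : Continuous g) :
    ContinuousOn (Function.extend Subtype.val g h) U := by
  rw [continuousOn_iff_continuous_domRestrict]
  convert hg
  ext x
  exact Subtype.val_injective.extend_apply g h x

theorem ccOn_extend {E : Type*} [TopologicalSpace E] {U : Set E} {g : U → ℂ}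
    (hg : Continuous g) (hg' : HasCompactSupport g) : CcOn U (Function.extend Subtype.val g 0) := by
  refine ⟨continuousOn_extend hg, Subtype.val '' tsupport g, ?_, ?_, ?_⟩
  · rintro _ ⟨x, -, rfl⟩
    exact x.2
  · exact hg'.isCompact.image continuous_subtype_val
  · intro x hx
    by_cases hxU : x ∈ U
    · rw [show x = ((⟨x, hxU⟩ : U) : E) from rfl, Subtype.val_injective.extend_apply]
      exact image_eq_zero_of_notMem_tsupport fun h => hx ⟨_, h, rfl⟩
    · exact Function.extend_apply' _ _ _ (by rintro ⟨y, rfl⟩; exact hxU y.2)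

/-- Tietze extension with compact support in a locally compact Hausdorff space. -/
theorem exists_extension_hasCompactSupport {V : Type*} [TopologicalSpace V] [T2Space V]
    [LocallyCompactSpace V] {C K : Set V} (hC : IsClosed C) (hK : IsCompact K) {k : V → ℂ}
    (hk : ContinuousOn k C) (h0 : ∀ x ∈ C, x ∉ K → k x = 0) :
    ∃ g : V → ℂ, Continuous g ∧ HasCompactSupport g ∧ ∀ x ∈ C, g x = k x := by
  -- extend `k` over the compact neighbourhood `M` and cut off by `φ`, which is supported in `L`
  obtain ⟨L, hL, hKL⟩ := exists_compact_superset hK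
  obtain ⟨M, hM, hLM⟩ := exists_compact_superset hL
  obtain ⟨φ, hφ1, hφ0, -, -⟩ := exists_continuous_one_zero_of_isCompact hK
    isOpen_interior.isClosed_compl (Set.disjoint_compl_right_iff_subset.2 hKL)
  have : CompactSpace M := isCompact_iff_compactSpace.1 hM
  obtain ⟨g₁, hg₁⟩ := ContinuousMap.exists_restrict_eq (hC.preimage (continuous_subtype_val
    (p := (· ∈ M)))) ⟨fun x => k x.1.1, hk.comp_continuous (by fun_prop) fun x => x.2⟩
  have hg₁' : ∀ x : M, x.1 ∈ C → g₁ x = k x := fun x hx =>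
    DFunLike.congr_fun hg₁ (⟨x, hx⟩ : (Subtype.val ⁻¹' C : Set M))
  have hext : ∀ x (hx : x ∈ M), Function.extend Subtype.val g₁ 0 x = g₁ ⟨x, hx⟩ := fun x hx =>
    Subtype.val_injective.extend_apply (f := (Subtype.val : M → V)) g₁ 0 ⟨x, hx⟩
  have hsupp : ∀ x, x ∉ L → (φ x : ℂ) * Function.extend Subtype.val g₁ 0 x = 0 := fun x hx => by
    rw [hφ0 fun h => hx (interior_subset h)]
    simp
  refine ⟨fun x => (φ x : ℂ) * Function.extend Subtype.val g₁ 0 x, ?_,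
    HasCompactSupport.intro hL hsupp, ?_⟩
  · rw [continuous_iff_continuousAt]
    intro x
    by_cases hx : x ∈ L
    · have h1 : ContinuousOn (Function.extend Subtype.val (g₁ : M → ℂ) 0) M :=
        continuousOn_extend g₁.continuous
      exact (Complex.continuous_ofReal.comp φ.continuous).continuousAt.mul
        (h1.continuousAt (mem_interior_iff_mem_nhds.1 (hLM hx)))
    · refine (continuousAt_const (y := (0 : ℂ))).congr ?_
      filter_upwards [hL.isClosed.isOpen_compl.mem_nhds hx] with y hy using (hsupp y hy).symm
  · intro x hx
    by_cases hxK : x ∈ K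
    · have hxM : x ∈ M := interior_subset (hLM (interior_subset (hKL hxK)))
      simp only [hφ1 hxK, hext x hxM, hg₁' ⟨x, hxM⟩ hx]
      simp
    · rw [h0 x hx hxK]
      by_cases hxM : x ∈ M
      · simp only [hext x hxM, hg₁' ⟨x, hxM⟩ hx, h0 x hx hxK, mul_zero]
      · exact hsupp x fun h => hxM (interior_subset (hLM h))

theorem isCompact_preimage_val {E : Type*} [TopologicalSpace E] {U K : Set E}
    (hK : IsCompact K) (hKU : K ⊆ U) :
    IsCompact (Subtype.val ⁻¹' K : Set U) :=
  IsInducing.subtypeVal.isCompact_preimage' hK (by simpa using hKU)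

section Extension

variable {E : Type*} [TopologicalSpace E] [LocallyCompactSpace E] {U K : Set E}

/-- Tietze extension from a closed set into the open Hausdorff set `U` of a possibly
non-Hausdorff space. -/
theorem exists_ccOn_extension (hU : IsOpen U) [T2Space U] {C : Set E} (hC : IsClosed C)
    (hK : IsCompact K) (hKU : K ⊆ U) {k : E → ℂ} (hk : ContinuousOn k (C ∩ U))
    (h0 : ∀ x ∈ C, x ∉ K → k x = 0) : ∃ g : E → ℂ, CcOn U g ∧ ∀ x ∈ C, g x = k x := by
  have : LocallyCompactSpace U := hU.locallyCompactSpace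
  obtain ⟨g, hg, hg', hgk⟩ := exists_extension_hasCompactSupport
    (hC.preimage (continuous_subtype_val (p := (· ∈ U)))) (isCompact_preimage_val hK hKU)
    (k := fun x => k x) (hk.comp (by fun_prop) fun x hx => ⟨hx, x.2⟩)
    (fun x hx hxK => h0 x hx hxK)
  refine ⟨_, ccOn_extend hg hg', fun x hx => ?_⟩
  by_cases hxU : x ∈ U
  · exact (Subtype.val_injective.extend_apply g 0 ⟨x, hxU⟩).trans (hgk ⟨x, hxU⟩ hx)
  · rw [h0 x hx fun h => hxU (hKU h)]
    exact Function.extend_apply' _ _ _ (by rintro ⟨y, rfl⟩; exact hxU y.2)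

theorem exists_ccOn_bump (hU : IsOpen U) [T2Space U] (hK : IsCompact K) (hKU : K ⊆ U) :
    ∃ h : E → ℝ, CcOn U (fun x => (h x : ℂ)) ∧ (∀ x ∈ K, h x = 1) ∧ ∀ x, 0 ≤ h x := by
  have : LocallyCompactSpace U := hU.locallyCompactSpace
  obtain ⟨φ, hφ1, -, hφ, hφI⟩ := exists_continuous_one_zero_of_isCompact
    (isCompact_preimage_val hK hKU) isClosed_empty (Set.disjoint_empty _)
  have key : ∀ x, Function.extend (Subtype.val : U → E) (fun x => (φ x : ℂ)) 0 x =
      (Function.extend (Subtype.val : U → E) φ 0 x : ℝ) := by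
    intro x
    by_cases hxU : x ∈ U
    · rw [show x = ((⟨x, hxU⟩ : U) : E) from rfl, Subtype.val_injective.extend_apply,
        Subtype.val_injective.extend_apply]
    · have : ¬ ∃ y : U, (y : E) = x := by rintro ⟨y, rfl⟩; exact hxU y.2
      rw [Function.extend_apply' _ _ _ this, Function.extend_apply' _ _ _ this]
      simp
  refine ⟨Function.extend Subtype.val φ 0, ?_, ?_, ?_⟩
  · simp_rw [← key]
    refine ccOn_extend (by fun_prop) ?_
    exact hφ.comp_left (g := fun r : ℝ => (r : ℂ)) Complex.ofReal_zero
  · intro x hx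
    exact (Subtype.val_injective.extend_apply φ 0 ⟨x, hKU hx⟩).trans (hφ1 hx)
  · intro x
    by_cases hxU : x ∈ U
    · rw [show x = ((⟨x, hxU⟩ : U) : E) from rfl, Subtype.val_injective.extend_apply]
      exact (hφI _).1
    · rw [Function.extend_apply' _ _ _ (by rintro ⟨y, rfl⟩; exact hxU y.2)]
      simp

end Extension

section Integrable

variable {E : Type*} [TopologicalSpace E] [MeasurableSpace E] [BorelSpace E] {U K : Set E}

theorem measurableSet_of_isCompact_subset (hU : IsOpen U) [T2Space U] (hK : IsCompact K)
    (hKU : K ⊆ U) : MeasurableSet K := by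
  have h := hU.measurableSet.subtype_image (isCompact_preimage_val hK hKU).isClosed.measurableSet
  rwa [Subtype.image_preimage_val, Set.inter_eq_right.2 hKU] at h

theorem CcOn.integrable (hU : IsOpen U) [T2Space U] {f : E → ℂ} (hf : CcOn U f) (ν : Measure E)
    [IsFiniteMeasureOnCompacts ν] : Integrable f ν := by
  obtain ⟨hf, K, hKU, hK, h0⟩ := hf
  refine (integrableOn_iff_integrable_of_support_subset (s := K) ?_).1 ?_
  · intro x hx
    by_contra h
    exact hx (h0 x h)
  · exact (hf.mono hKU).integrableOn_compact' hK (measurableSet_of_isCompact_subset hU hK hKU)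

theorem integrable_of_mem_Cc {f : E → ℂ} (hf : f ∈ Cc E) (ν : Measure E)
    [IsFiniteMeasureOnCompacts ν] : Integrable f ν := by
  refine Submodule.span_induction ?_ ?_ ?_ ?_ hf
  · rintro g ⟨U, K, hU, hT, hKU, hK, hg, h0⟩
    exact CcOn.integrable hU ⟨hg, K, hKU, hK, h0⟩ ν
  · exact integrable_zero _ _ _
  · intro g h _ _ hg hh
    exact hg.add hh
  · intro c g _ hg
    exact hg.smul c

end Integrable

theorem IsLocCompact.locallyCompactSpace {E : Type*} [TopologicalSpace E] (h : IsLocCompact E) :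
    LocallyCompactSpace E := by
  refine ⟨fun x n hn => ?_⟩
  obtain ⟨K, hK, hKc, hT⟩ := h x
  have : CompactSpace K := isCompact_iff_compactSpace.1 hKc
  have hx : x ∈ K := mem_of_mem_nhds hK
  obtain ⟨s, hs, hsn, hsc⟩ := local_compact_nhds
    ((continuous_subtype_val (p := (· ∈ K))).continuousAt (x := ⟨x, hx⟩) hn)
  refine ⟨Subtype.val '' s, ?_, by simpa using hsn, hsc.image continuous_subtype_val⟩
  rw [nhds_subtype_eq_comap] at hs
  obtain ⟨t, ht, hts⟩ := hs
  filter_upwards [hK, ht] with y hy hyt using ⟨⟨y, hy⟩, hts hyt, rfl⟩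

theorem IsLocCompact.exists_isOpen_t2Space {E : Type*} [TopologicalSpace E] (h : IsLocCompact E)
    (x : E) : ∃ U : Set E, IsOpen U ∧ x ∈ U ∧ T2Space U := by
  obtain ⟨K, hK, -, hT⟩ := h x
  refine ⟨interior K, isOpen_interior, mem_interior_iff_mem_nhds.2 hK, ?_⟩
  exact T2Space.of_injective_continuous (Set.inclusion_injective interior_subset)
    (continuous_inclusion interior_subset)

theorem ofReal_mem_Cc {E : Type*} [TopologicalSpace E] [T2Space E]
    (φ : CompactlySupportedContinuousMap E ℝ) : (fun e => (φ e : ℂ)) ∈ Cc E :=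
  (mem_Cc_iff _).2 ⟨by fun_prop,
    φ.hasCompactSupport.comp_left (g := fun r : ℝ => (r : ℂ)) Complex.ofReal_zero⟩

theorem exists_re_im_of_mem_Cc {E : Type*} [TopologicalSpace E] [T2Space E] {f : E → ℂ}
    (hf : f ∈ Cc E) : ∃ p q : E → ℝ, (fun e => (p e : ℂ)) ∈ Cc E ∧ (fun e => (q e : ℂ)) ∈ Cc E ∧
      f = (fun e => (p e : ℂ)) + Complex.I • fun e => (q e : ℂ) := by
  obtain ⟨hfc, hfs⟩ := (mem_Cc_iff f).1 hf
  refine ⟨fun e => (f e).re, fun e => (f e).im, (mem_Cc_iff _).2 ⟨by fun_prop, ?_⟩,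
    (mem_Cc_iff _).2 ⟨by fun_prop, ?_⟩, ?_⟩
  · exact hfs.comp_left (g := fun c : ℂ => (c.re : ℂ)) (by simp)
  · exact hfs.comp_left (g := fun c : ℂ => (c.im : ℂ)) (by simp)
  · ext e
    simp [mul_comm Complex.I, Complex.re_add_im]

theorem mul_mem_Cc {E : Type*} [TopologicalSpace E] [T2Space E] {b : E → ℝ} (hb : Continuous b)
    {f : E → ℂ} (hf : f ∈ Cc E) : (fun e => (b e : ℂ) * f e) ∈ Cc E := by
  obtain ⟨hfc, hfs⟩ := (mem_Cc_iff f).1 hf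
  exact (mem_Cc_iff _).2 ⟨by fun_prop, hfs.mul_left⟩

/-! ### Integration along the fibres of a continuous family of measures -/

namespace IsContinuousFamily

variable {E B : Type*} [TopologicalSpace E] [MeasurableSpace E] [TopologicalSpace B]
  {π : E → B} {lam : B → Measure E}

theorem ae_mem_fibre (h : IsContinuousFamily π lam) (u : B) : ∀ᵐ e ∂lam u, π e = u :=
  h.fibre u

theorem isFiniteMeasureOnCompacts (h : IsContinuousFamily π lam) (u : B) :
    IsFiniteMeasureOnCompacts (lam u) :=
  (h.isRadon u).regular.toIsFiniteMeasureOnCompacts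

theorem continuous_integral [T2Space B] (h : IsContinuousFamily π lam) {f : E → ℂ}
    (hf : f ∈ Cc E) : Continuous fun b => ∫ x, f x ∂lam b :=
  ((mem_Cc_iff _).1 (h.integral_mem f hf)).1

variable [T2Space B] [BorelSpace E] [LocallyCompactSpace E] {U K : Set E}

theorem integrable (h : IsContinuousFamily π lam) (hU : IsOpen U) [T2Space U] (hK : IsCompact K)
    (hKU : K ⊆ U) {u : B} {k : E → ℂ} (hk : ContinuousOn k (π ⁻¹' {u} ∩ U))
    (h0 : ∀ x, π x = u → x ∉ K → k x = 0) : Integrable k (lam u) := by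
  obtain ⟨g, hg, hgk⟩ := exists_ccOn_extension hU (isClosed_singleton.preimage h.continuous_map)
    hK hKU hk h0
  have := h.isFiniteMeasureOnCompacts u
  refine (hg.integrable hU (lam u)).congr ?_
  filter_upwards [h.ae_mem_fibre u] with x hx using hgk x hx

/-- Fibre integrals depend continuously on parameters, if the integrand is supported in a fixed
compact subset of an open Hausdorff set. Near a parameter `p₀` the integrand is uniformly close to
a single function of `Cc E`, namely an extension of its restriction to the fibre of `p₀`. -/
theorem continuous_integral_of_isCompact (h : IsContinuousFamily π lam) {P : Type*}
    [TopologicalSpace P] {ρ : P → B} (hρ : Continuous ρ) (hU : IsOpen U) [T2Space U]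
    (hK : IsCompact K) (hKU : K ⊆ U) {F : P → E → ℂ}
    (hF : ContinuousOn (fun q : P × E => F q.1 q.2) {q | ρ q.1 = π q.2 ∧ q.2 ∈ U})
    (h0 : ∀ p e, ρ p = π e → e ∉ K → F p e = 0) :
    Continuous fun p => ∫ e, F p e ∂lam (ρ p) := by
  have hslice : ∀ p, ContinuousOn (F p) (π ⁻¹' {ρ p} ∩ U) := fun p =>
    hF.comp (f := fun e => (p, e)) (by fun_prop) fun e he => ⟨he.1.symm, he.2⟩
  have hint : ∀ p, Integrable (F p) (lam (ρ p)) := fun p =>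
    h.integrable hU hK hKU (hslice p) fun x hx => h0 p x hx.symm
  rw [continuous_iff_continuousAt]
  intro p₀
  obtain ⟨g, hg, hgk⟩ := exists_ccOn_extension hU
    (isClosed_singleton.preimage h.continuous_map) hK hKU (hslice p₀)
    fun x hx => h0 p₀ x (Eq.symm hx)
  obtain ⟨hgc, K₁, hK₁U, hK₁, hg0⟩ := id hg
  obtain ⟨φ, hφ, hφ1, hφ0⟩ := exists_ccOn_bump hU (hK.union hK₁) (Set.union_subset hKU hK₁U)
  have hA := (h.continuous_integral (hg.mem_Cc hU)).comp hρ
  have hM := Complex.continuous_re.comp ((h.continuous_integral (hφ.mem_Cc hU)).comp hρ)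
  set A : P → ℂ := fun p => ∫ x, g x ∂lam (ρ p) with hAdef
  set M : P → ℝ := fun p => ∫ x, φ x ∂lam (ρ p) with hMdef
  replace hA : Continuous A := hA
  replace hM : Continuous M := by
    refine hM.congr fun p => ?_
    simp [hMdef, integral_complex_ofReal]
  have hA0 : A p₀ = ∫ e, F p₀ e ∂lam (ρ p₀) :=
    integral_congr_ae (by filter_upwards [h.ae_mem_fibre (ρ p₀)] with x hx using hgk x hx)
  have hM0 : ∀ p, 0 ≤ M p := fun p => integral_nonneg fun x => hφ0 x
  -- uniform closeness of the integrand to `g`, by compactness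
  have hclose : ∀ δ > 0, ∀ᶠ p in 𝓝 p₀, ∀ e ∈ K ∪ K₁, ρ p = π e → ‖F p e - g e‖ ≤ δ := by
    intro δ hδ
    refine (hK.union hK₁).eventually_forall_of_forall_eventually
      (P := fun p e => ρ p = π e → ‖F p e - g e‖ ≤ δ) fun e he => ?_
    have heU : e ∈ U := Set.union_subset hKU hK₁U he
    by_cases hpe : ρ p₀ = π e
    · have h1 : ContinuousOn (fun q : P × E => ‖F q.1 q.2 - g q.2‖)
          {q | ρ q.1 = π q.2 ∧ q.2 ∈ U} :=
        (hF.sub (hgc.comp continuousOn_snd fun q hq => hq.2)).norm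
      have h2 := (h1 (p₀, e) ⟨hpe, heU⟩).eventually (p := fun r => r ≤ δ) (by
        simpa [hgk e hpe.symm] using eventually_le_nhds hδ)
      rw [eventually_nhdsWithin_iff] at h2
      filter_upwards [h2, continuousAt_snd.preimage_mem_nhds (hU.mem_nhds heU)] with q hq hqU hπ
        using hq ⟨hπ, hqU⟩
    · have h1 : IsOpen {q : P × E | ρ q.1 ≠ π q.2} :=
        isOpen_ne_fun (hρ.comp continuous_fst) (h.continuous_map.comp continuous_snd)
      filter_upwards [h1.mem_nhds hpe] with q hq hq' using absurd hq' hq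
  have hbound : ∀ δ > 0, ∀ᶠ p in 𝓝 p₀, ‖(∫ e, F p e ∂lam (ρ p)) - A p‖ ≤ δ * M p := by
    intro δ hδ
    filter_upwards [hclose δ hδ] with p hp
    have := h.isFiniteMeasureOnCompacts (ρ p)
    rw [hAdef, ← integral_sub (hint p) (hg.integrable hU _), hMdef, ← integral_const_mul]
    refine norm_integral_le_of_norm_le ((hφ.integrable hU _).re.const_mul δ) ?_
    filter_upwards [h.ae_mem_fibre (ρ p)] with e he
    by_cases heK : e ∈ K ∪ K₁
    · simpa [hφ1 e heK] using hp e heK he.symm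
    · rw [h0 p e he.symm fun h => heK (Or.inl h), hg0 e fun h => heK (Or.inr h)]
      simpa using mul_nonneg hδ.le (hφ0 e)
  rw [Metric.continuousAt_iff']
  intro ε hε
  have hδ : 0 < ε / (2 * (M p₀ + 1)) := by have := hM0 p₀; positivity
  filter_upwards [hbound _ hδ, hM.continuousAt.eventually_lt_const (lt_add_one (M p₀)),
    Metric.continuousAt_iff'.1 hA.continuousAt (ε / 2) (half_pos hε)] with p h1 h2 h3
  rw [← hA0, dist_eq_norm]
  rw [dist_eq_norm] at h3
  have h4 : ε / (2 * (M p₀ + 1)) * M p ≤ ε / (2 * (M p₀ + 1)) * (M p₀ + 1) :=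
    mul_le_mul_of_nonneg_left h2.le hδ.le
  have h5 : ε / (2 * (M p₀ + 1)) * (M p₀ + 1) = ε / 2 := by
    have := hM0 p₀
    field_simp
  calc ‖(∫ e, F p e ∂lam (ρ p)) - A p₀‖
      ≤ ‖(∫ e, F p e ∂lam (ρ p)) - A p‖ + ‖A p - A p₀‖ := norm_sub_le_norm_sub_add_norm_sub _ _ _
    _ < ε := by linarith

end IsContinuousFamily

/-! ### Functions with compact support on a Hausdorff fibre product -/

/-- A function on `Q` that is continuous with compact support on the subset `W`. Its values outside
`W` carry no information. -/
def CcAlong {Q : Type*} [TopologicalSpace Q] (W : Set Q) (F : Q → ℂ) : Prop :=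
  ContinuousOn F W ∧ ∃ K ⊆ W, IsCompact K ∧ ∀ q ∈ W, q ∉ K → F q = 0

/-- A function on `P × E`, continuous with compact support on `W`, for which the `E`-coordinates of
the support stay in the open Hausdorff set `U`. -/
structure IsPiece {P E : Type*} [TopologicalSpace P] [TopologicalSpace E] (W : Set (P × E))
    (U : Set E) (F : P × E → ℂ) : Prop where
  isOpen : IsOpen U
  t2Space : T2Space U
  continuousOn : ContinuousOn F W
  exists_isCompact : ∃ K ⊆ W, IsCompact K ∧ (∀ q ∈ K, q.2 ∈ U) ∧ ∀ q ∈ W, q ∉ K → F q = 0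

theorem IsPiece.ccAlong {P E : Type*} [TopologicalSpace P] [TopologicalSpace E] {W : Set (P × E)}
    {U : Set E} {F : P × E → ℂ} (hF : IsPiece W U F) : CcAlong W F := by
  obtain ⟨K, hKW, hK, -, h0⟩ := hF.exists_isCompact
  exact ⟨hF.continuousOn, K, hKW, hK, h0⟩

theorem IsPiece.mul_left {P E : Type*} [TopologicalSpace P] [TopologicalSpace E] {W : Set (P × E)}
    {U : Set E} {F k : P × E → ℂ} (hF : IsPiece W U F) (hk : ContinuousOn k W) :
    IsPiece W U fun q => k q * F q := by
  obtain ⟨K, hKW, hK, hKU, h0⟩ := hF.exists_isCompact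
  exact ⟨hF.isOpen, hF.t2Space, hk.mul hF.continuousOn, K, hKW, hK, hKU, fun q hq hqK => by
    simp [h0 q hq hqK]⟩

/-- A partition of unity on the Hausdorff space `W` splits a compactly supported function into
pieces supported over open Hausdorff subsets of `E`. -/
theorem CcAlong.exists_sum_isPiece {P E : Type*} [TopologicalSpace P] [TopologicalSpace E]
    [LocallyCompactSpace P] (hE : IsLocCompact E) {W : Set (P × E)} (hW : IsClosed W)
    [T2Space W] {F : P × E → ℂ} (hF : CcAlong W F) :
    ∃ (n : ℕ) (U : Fin n → Set E) (G : Fin n → P × E → ℂ), (∀ i, IsPiece W (U i) (G i)) ∧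
      ∀ q ∈ W, F q = ∑ i, G i q := by
  have := hE.locallyCompactSpace
  have : LocallyCompactSpace W := hW.isClosedEmbedding_subtypeVal.locallyCompactSpace
  obtain ⟨hFc, K, hKW, hK, h0⟩ := hF
  choose V hVo hmem hVT using hE.exists_isOpen_t2Space
  obtain ⟨t, -, ht⟩ := hK.elim_nhds_subcover (fun q => Prod.snd ⁻¹' V q.2) fun q _ =>
    ((hVo q.2).preimage continuous_snd).mem_nhds (hmem q.2)
  let U : Fin t.card → Set E := fun i => V (t.equivFin.symm i).1.2
  obtain ⟨f, hf1, hf2, -, hf3⟩ := exists_continuous_sum_one_of_isOpen_isCompact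
    (s := fun i => {w : W | w.1.2 ∈ U i}) (t := Subtype.val ⁻¹' K)
    (fun i => (hVo _).preimage (by fun_prop)) (isCompact_preimage_val hK hKW) (by
      intro w hw
      obtain ⟨q, hq, hwq⟩ := Set.mem_iUnion₂.1 (ht hw)
      refine Set.mem_iUnion.2 ⟨t.equivFin ⟨q, hq⟩, ?_⟩
      simpa [U] using hwq)
  have hext : ∀ i (w : W), Function.extend Subtype.val (fun w => (f i w : ℂ)) 0 w.1 = f i w :=
    fun i w => Subtype.val_injective.extend_apply _ _ _
  refine ⟨t.card, U, fun i q => Function.extend Subtype.val (fun w => (f i w : ℂ)) 0 q * F q,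
    fun i => ⟨hVo _, hVT _, (continuousOn_extend (by fun_prop)).mul hFc,
      Subtype.val '' tsupport (f i), ?_, (hf3 i).isCompact.image continuous_subtype_val, ?_, ?_⟩,
    ?_⟩
  · rintro _ ⟨w, -, rfl⟩
    exact w.2
  · rintro _ ⟨w, hw, rfl⟩
    exact hf1 i hw
  · intro q hqW hq
    have h1 := hext i ⟨q, hqW⟩
    dsimp only at h1 ⊢
    rw [h1, image_eq_zero_of_notMem_tsupport fun h => hq ⟨_, h, rfl⟩]
    simp
  · intro q hq
    by_cases hqK : q ∈ K
    · have h1 : ∑ i, f i ⟨q, hq⟩ = 1 := by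
        simpa using hf2 (x := ⟨q, hq⟩) hqK
      rw [← Finset.sum_mul]
      have h2 : ∑ i, Function.extend Subtype.val (fun w => (f i w : ℂ)) 0 q = 1 := by
        rw [Finset.sum_congr rfl fun i _ => hext i ⟨q, hq⟩]
        exact_mod_cast h1
      rw [h2, one_mul]
    · simp [h0 q hq hqK]

/-- A function that is continuous on `W` and has compact support over each compact subset of the
base `P`. -/
def ProperlySupportedAlong {P E : Type*} [TopologicalSpace P] [TopologicalSpace E]
    (W : Set (P × E)) (F : P × E → ℂ) : Prop :=
  ContinuousOn F W ∧ ∀ L : Set P, IsCompact L →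
    ∃ K ⊆ W, IsCompact K ∧ ∀ q ∈ W, q.1 ∈ L → q ∉ K → F q = 0

theorem ProperlySupportedAlong.ccAlong_mul {P E : Type*} [TopologicalSpace P]
    [TopologicalSpace E] {W : Set (P × E)} {F : P × E → ℂ}
    (hF : ProperlySupportedAlong W F) {φ : P → ℂ} (hφ : Continuous φ) (hφ' : HasCompactSupport φ) :
    CcAlong W fun q => φ q.1 * F q := by
  obtain ⟨K, hKW, hK, h0⟩ := hF.2 _ hφ'
  refine ⟨(hφ.comp continuous_fst).continuousOn.mul hF.1, K, hKW, hK, fun q hq hqK => ?_⟩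
  dsimp only
  by_cases hL : q.1 ∈ tsupport φ
  · rw [h0 q hq hL hqK, mul_zero]
  · rw [image_eq_zero_of_notMem_tsupport hL, zero_mul]

namespace IsContinuousFamily

variable {P E B : Type*} [TopologicalSpace E] [MeasurableSpace E] [TopologicalSpace B]
  [TopologicalSpace P] {π : E → B} {lam : B → Measure E} {ρ : P → B}

theorem isClosed_fibreProduct [T2Space B] (h : IsContinuousFamily π lam) (hρ : Continuous ρ) :
    IsClosed {q : P × E | ρ q.1 = π q.2} :=
  isClosed_eq (hρ.comp continuous_fst) (h.continuous_map.comp continuous_snd)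

theorem hasCompactSupport_integral [T2Space P] (h : IsContinuousFamily π lam) {F : P × E → ℂ}
    (hF : CcAlong {q : P × E | ρ q.1 = π q.2} F) :
    HasCompactSupport fun p => ∫ e, F (p, e) ∂lam (ρ p) := by
  obtain ⟨-, K, -, hK, h0⟩ := hF
  refine HasCompactSupport.intro (hK.image continuous_fst) fun p hp => ?_
  refine integral_eq_zero_of_ae ?_
  filter_upwards [h.ae_mem_fibre (ρ p)] with e he using
    h0 (p, e) he.symm fun hq => hp ⟨_, hq, rfl⟩

/-- Every continuous function with compact support on a Hausdorff fibre is the restriction of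
an element of `Cc E`. -/
theorem exists_Cc_extension [T2Space B] [BorelSpace E]
    (h : IsContinuousFamily π lam) (hE : IsLocCompact E) {u : B}
    (hT : T2Space (π ⁻¹' {u})) {k : E → ℂ} (hk : CcAlong (π ⁻¹' {u}) k) :
    ∃ g ∈ Cc E, ∀ e, π e = u → g e = k e := by
  have := hE.locallyCompactSpace
  let W : Set (Unit × E) := {q | (fun _ => u) q.1 = π q.2}
  have hW : IsClosed W := h.isClosed_fibreProduct continuous_const
  have : T2Space W := T2Space.of_injective_continuous
    (f := fun q : W => (⟨q.1.2, q.2.symm⟩ : π ⁻¹' {u}))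
    (fun a b hab => Subtype.ext (Prod.ext rfl (congrArg Subtype.val hab))) (by fun_prop)
  obtain ⟨hkc, K, hKu, hK, h0⟩ := hk
  have hF : CcAlong W fun q => k q.2 := by
    refine ⟨hkc.comp continuousOn_snd fun q hq => Eq.symm hq, Prod.mk () '' K, ?_,
      hK.image (by fun_prop), fun q hq hqK => h0 _ (Eq.symm hq) fun h => hqK ⟨_, h, rfl⟩⟩
    rintro _ ⟨e, he, rfl⟩
    exact (hKu he).symm
  obtain ⟨n, U, G, hG, hkG⟩ := hF.exists_sum_isPiece hE hW
  have hg : ∀ i, ∃ g ∈ Cc E, ∀ e, π e = u → g e = G i ((), e) := by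
    intro i
    have := (hG i).t2Space
    obtain ⟨K', hK'W, hK', hK'U, hG0⟩ := (hG i).exists_isCompact
    obtain ⟨g, hg, hgk⟩ := exists_ccOn_extension (hG i).isOpen
      (isClosed_singleton.preimage h.continuous_map) (hK'.image continuous_snd)
      (by rintro _ ⟨q, hq, rfl⟩; exact hK'U q hq) (k := fun e => G i ((), e))
      ((hG i).continuousOn.comp (by fun_prop) fun e (he : e ∈ π ⁻¹' {u} ∩ U i) => he.1.symm)
      fun e he' he => hG0 _ (Eq.symm he') fun hq => he ⟨_, hq, rfl⟩
    exact ⟨g, hg.mem_Cc (hG i).isOpen, hgk⟩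
  choose g hg hgG using hg
  refine ⟨∑ i, g i, Submodule.sum_mem _ fun i _ => hg i, fun e he => ?_⟩
  rw [Finset.sum_apply, Finset.sum_congr rfl fun i _ => hgG i e he]
  exact (hkG ((), e) he.symm).symm

variable [T2Space B] [BorelSpace E]

theorem integrable_isPiece (h : IsContinuousFamily π lam) (hE : IsLocCompact E) {U : Set E}
    {F : P × E → ℂ} (hF : IsPiece {q : P × E | ρ q.1 = π q.2} U F) (p : P) :
    Integrable (fun e => F (p, e)) (lam (ρ p)) := by
  have := hE.locallyCompactSpace
  have := hF.t2Space
  obtain ⟨K, hKW, hK, hKU, h0⟩ := hF.exists_isCompact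
  refine h.integrable hF.isOpen (hK.image continuous_snd) (by rintro _ ⟨q, hq, rfl⟩; exact hKU q hq)
    (hF.continuousOn.comp (by fun_prop) fun e he => he.1.symm)
    fun e he' he => h0 _ (Eq.symm he') fun hq => ?_
  exact he ⟨_, hq, rfl⟩

theorem continuous_integral_isPiece (h : IsContinuousFamily π lam) (hE : IsLocCompact E)
    (hρ : Continuous ρ) {U : Set E} {F : P × E → ℂ}
    (hF : IsPiece {q : P × E | ρ q.1 = π q.2} U F) :
    Continuous fun p => ∫ e, F (p, e) ∂lam (ρ p) := by
  have := hE.locallyCompactSpace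
  have := hF.t2Space
  obtain ⟨K, hKW, hK, hKU, h0⟩ := hF.exists_isCompact
  refine h.continuous_integral_of_isCompact hρ hF.isOpen (hK.image continuous_snd)
    (by rintro _ ⟨q, hq, rfl⟩; exact hKU q hq) (F := fun p e => F (p, e))
    (hF.continuousOn.mono fun e he => he.1) fun p e he' he => h0 _ he' fun hq => ?_
  exact he ⟨_, hq, rfl⟩

variable [LocallyCompactSpace P] [T2Space {q : P × E | ρ q.1 = π q.2}]

theorem integrable_ccAlong (h : IsContinuousFamily π lam) (hE : IsLocCompact E)
    (hρ : Continuous ρ) {F : P × E → ℂ} (hF : CcAlong {q : P × E | ρ q.1 = π q.2} F) (p : P) :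
    Integrable (fun e => F (p, e)) (lam (ρ p)) := by
  obtain ⟨n, U, G, hG, hFG⟩ := hF.exists_sum_isPiece hE (h.isClosed_fibreProduct hρ)
  refine (integrable_finsetSum Finset.univ fun i _ => h.integrable_isPiece hE (hG i) p).congr ?_
  filter_upwards [h.ae_mem_fibre (ρ p)] with e he using (hFG (p, e) he.symm).symm

theorem continuous_integral_ccAlong (h : IsContinuousFamily π lam) (hE : IsLocCompact E)
    (hρ : Continuous ρ) {F : P × E → ℂ} (hF : CcAlong {q : P × E | ρ q.1 = π q.2} F) :
    Continuous fun p => ∫ e, F (p, e) ∂lam (ρ p) := by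
  obtain ⟨n, U, G, hG, hFG⟩ := hF.exists_sum_isPiece hE (h.isClosed_fibreProduct hρ)
  refine (continuous_finsetSum Finset.univ fun i _ =>
    h.continuous_integral_isPiece hE hρ (hG i)).congr fun p => ?_
  rw [← integral_finsetSum _ fun i _ => h.integrable_isPiece hE (hG i) p]
  refine integral_congr_ae ?_
  filter_upwards [h.ae_mem_fibre (ρ p)] with e he using (hFG (p, e) he.symm).symm

theorem integrable_properlySupported [T2Space P] (h : IsContinuousFamily π lam)
    (hE : IsLocCompact E) (hρ : Continuous ρ) {F : P × E → ℂ}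
    (hF : ProperlySupportedAlong {q : P × E | ρ q.1 = π q.2} F) (p : P) :
    Integrable (fun e => F (p, e)) (lam (ρ p)) := by
  obtain ⟨φ, hφ1, -, hφ, -⟩ := exists_continuous_one_zero_of_isCompact
    (isCompact_singleton (x := p)) isClosed_empty (Set.disjoint_empty _)
  have := h.integrable_ccAlong hE hρ (hF.ccAlong_mul (φ := fun p => (φ p : ℂ))
    (by fun_prop) (hφ.comp_left (g := fun r : ℝ => (r : ℂ)) Complex.ofReal_zero)) p
  simpa [hφ1 (Set.mem_singleton p)] using this

theorem continuous_integral_properlySupported [T2Space P] (h : IsContinuousFamily π lam)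
    (hE : IsLocCompact E) (hρ : Continuous ρ) {F : P × E → ℂ}
    (hF : ProperlySupportedAlong {q : P × E | ρ q.1 = π q.2} F) :
    Continuous fun p => ∫ e, F (p, e) ∂lam (ρ p) := by
  rw [continuous_iff_continuousAt]
  intro p₀
  obtain ⟨L, hL, hpL⟩ := exists_compact_mem_nhds p₀
  obtain ⟨φ, hφ1, -, hφ, -⟩ := exists_continuous_one_zero_of_isCompact hL isClosed_empty
    (Set.disjoint_empty _)
  have := h.continuous_integral_ccAlong hE hρ (hF.ccAlong_mul (φ := fun p => (φ p : ℂ))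
    (by fun_prop) (hφ.comp_left (g := fun r : ℝ => (r : ℂ)) Complex.ofReal_zero))
  refine this.continuousAt.congr ?_
  filter_upwards [hpL] with p hp
  simp [hφ1 hp]

end IsContinuousFamily

/-- Fubini's theorem for continuous functions with compact support on a product of two fibres. No
countability is needed: the measures only have to be finite on compact sets. -/
theorem integral_integral_swap_of_ccAlong {X G : Type*} [TopologicalSpace X] [MeasurableSpace X]
    [BorelSpace X] [T2Space X] [TopologicalSpace G] [MeasurableSpace G] [BorelSpace G]
    {A : Set X} {C U : Set G} (hA : IsClosed A) (hC : IsClosed C) (hU : IsOpen U) [T2Space U]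
    {α : Measure X} {χ : Measure G} [IsFiniteMeasureOnCompacts α] [IsFiniteMeasureOnCompacts χ]
    (hα : ∀ᵐ x ∂α, x ∈ A) (hχ : ∀ᵐ γ ∂χ, γ ∈ C) {J : X × G → ℂ} (hJ : ContinuousOn J (A ×ˢ C))
    {K : Set (X × G)} (hK : IsCompact K) (hKAC : K ⊆ A ×ˢ C) (hKU : ∀ q ∈ K, q.2 ∈ U)
    (h0 : ∀ q ∈ A ×ˢ C, q ∉ K → J q = 0) :
    ∫ x, ∫ γ, J (x, γ) ∂χ ∂α = ∫ γ, ∫ x, J (x, γ) ∂α ∂χ := by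
  -- both integrals live on the Hausdorff subspaces `A` and `D`, where Mathlib's theorem for
  -- compactly supported continuous functions applies
  let D : Set G := C ∩ U
  have hD : MeasurableSet D := hC.measurableSet.inter hU.measurableSet
  have : T2Space D := T2Space.of_injective_continuous
    (Set.inclusion_injective (Set.inter_subset_right (s := C) (t := U)))
    (continuous_inclusion Set.inter_subset_right)
  have hαf : IsFiniteMeasureOnCompacts (Measure.comap (Subtype.val : A → X) α) := by
    refine ⟨fun L hL => ?_⟩
    rw [comap_subtype_coe_apply hA.measurableSet]
    exact (hL.image continuous_subtype_val).measure_lt_top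
  have hχf : IsFiniteMeasureOnCompacts (Measure.comap (Subtype.val : D → G) χ) := by
    refine ⟨fun L hL => ?_⟩
    rw [comap_subtype_coe_apply hD]
    exact (hL.image continuous_subtype_val).measure_lt_top
  have hAr : α.restrict A = α := Measure.restrict_eq_self_of_ae_mem hα
  have hl : ∀ k : X → ℂ, ∫ x, k x ∂α = ∫ x : A, k x ∂(Measure.comap (Subtype.val : A → X) α) := by
    intro k
    rw [integral_subtype_comap hA.measurableSet, hAr]
  have hr : ∀ k : G → ℂ, (∀ γ ∈ C, γ ∉ U → k γ = 0) →
      ∫ γ, k γ ∂χ = ∫ γ : D, k γ ∂(Measure.comap (Subtype.val : D → G) χ) := by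
    intro k hk
    rw [integral_subtype_comap hD, setIntegral_eq_integral_of_ae_compl_eq_zero]
    filter_upwards [hχ] with γ hγ hγD
    exact hk γ hγ fun h => hγD ⟨hγ, h⟩
  have h1 : ∀ x ∈ A, ∀ γ ∈ C, γ ∉ U → J (x, γ) = 0 := fun x hx γ hγ hγU =>
    h0 _ ⟨hx, hγ⟩ fun h => hγU (hKU _ h)
  have h2 : ∀ γ ∈ C, γ ∉ U → ∫ x, J (x, γ) ∂α = 0 := fun γ hγ hγU => by
    refine integral_eq_zero_of_ae ?_
    filter_upwards [hα] with x hx using h1 x hx γ hγ hγU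
  rw [hl, hr _ h2]
  simp_rw [hl fun x => J (x, _)]
  rw [integral_congr_ae (Filter.Eventually.of_forall fun x : A => hr _ (h1 x x.2))]
  let e : A × D → X × G := Prod.map Subtype.val Subtype.val
  have he : IsEmbedding e := IsEmbedding.subtypeVal.prodMap IsEmbedding.subtypeVal
  refine integral_integral_swap_of_hasCompactSupport (f := fun (x : A) (γ : D) => J (x, γ)) ?_ ?_
  · exact hJ.comp_continuous (f := e) he.continuous fun p => ⟨p.1.2, p.2.2.1⟩
  · refine HasCompactSupport.intro (K := e ⁻¹' K) (he.isInducing.isCompact_preimage' hK ?_) ?_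
    · intro q hq
      exact ⟨(⟨q.1, (hKAC hq).1⟩, ⟨q.2, (hKAC hq).2, hKU q hq⟩), rfl⟩
    · intro p hp
      exact h0 (e p) ⟨p.1.2, p.2.2.1⟩ hp

/-! ### The diagonal action and its orbit space -/

namespace LCGroupoid

variable {B G : Type*} [TopologicalSpace B] [TopologicalSpace G] (𝒢 : LCGroupoid B G)

theorem inv_inv (γ : G) : 𝒢.inv (𝒢.inv γ) = γ := by
  have h1 := 𝒢.mul_assoc (𝒢.inv (𝒢.inv γ)) (𝒢.inv γ) γ (by rw [𝒢.s_inv]) (by rw [𝒢.s_inv])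
  rw [𝒢.inv_mul, 𝒢.inv_mul, 𝒢.s_inv, 𝒢.unit_mul] at h1
  have h2 := 𝒢.mul_unit (𝒢.inv (𝒢.inv γ))
  rw [𝒢.s_inv, 𝒢.r_inv] at h2
  rw [← h2, ← h1]

theorem inv_unit (u : B) : 𝒢.inv (𝒢.unit u) = 𝒢.unit u := by
  have h1 := 𝒢.inv_mul (𝒢.unit u)
  have h2 := 𝒢.mul_unit (𝒢.inv (𝒢.unit u))
  rw [𝒢.s_inv, 𝒢.r_unit] at h2
  rw [𝒢.s_unit] at h1
  rw [← h2, h1]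

theorem inv_mul_cancel_left {γ η : G} (h : 𝒢.s γ = 𝒢.r η) :
    𝒢.mul (𝒢.inv γ) (𝒢.mul γ η) = η := by
  rw [← 𝒢.mul_assoc _ _ _ (𝒢.s_inv γ) h, 𝒢.inv_mul, h, 𝒢.unit_mul]

theorem inv_mul_rev {γ η : G} (hc : 𝒢.s γ = 𝒢.r η) :
    𝒢.inv (𝒢.mul γ η) = 𝒢.mul (𝒢.inv η) (𝒢.inv γ) := by
  have c1 : 𝒢.s (𝒢.inv η) = 𝒢.r (𝒢.inv γ) := by rw [𝒢.s_inv, 𝒢.r_inv, hc]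
  have k : 𝒢.mul (𝒢.mul (𝒢.inv η) (𝒢.inv γ)) (𝒢.mul γ η) = 𝒢.unit (𝒢.s η) := by
    rw [𝒢.mul_assoc _ _ _ c1 (by rw [𝒢.s_inv, 𝒢.r_mul _ _ hc]), 𝒢.inv_mul_cancel_left hc,
      𝒢.inv_mul]
  have k2 := 𝒢.mul_assoc (𝒢.mul (𝒢.inv η) (𝒢.inv γ)) (𝒢.mul γ η)
    (𝒢.inv (𝒢.mul γ η)) (by rw [𝒢.s_mul _ _ c1, 𝒢.s_inv, 𝒢.r_mul _ _ hc]) (by rw [𝒢.r_inv])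
  have k3 := 𝒢.unit_mul (𝒢.inv (𝒢.mul γ η))
  rw [𝒢.r_inv, 𝒢.s_mul _ _ hc] at k3
  have k4 := 𝒢.mul_unit (𝒢.mul (𝒢.inv η) (𝒢.inv γ))
  rw [𝒢.s_mul _ _ c1, 𝒢.s_inv] at k4
  rwa [k, k3, 𝒢.mul_inv, 𝒢.r_mul _ _ hc, k4] at k2

end LCGroupoid

namespace HaarSystem

variable {B G : Type*} [TopologicalSpace B] [TopologicalSpace G] [MeasurableSpace G]
  {𝒢 : LCGroupoid B G}

/-- Full support of a Haar system, for integrands that are continuous on one fibre only. -/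
theorem integral_pos (χ : HaarSystem 𝒢) {u : B} {k : G → ℝ} (hk : ContinuousOn k (𝒢.r ⁻¹' {u}))
    (hi : Integrable k (χ.meas u)) (h0 : ∀ γ, 𝒢.r γ = u → 0 ≤ k γ) {γ : G} (hγ : 𝒢.r γ = u)
    (hpos : k γ ≠ 0) : 0 < ∫ γ, k γ ∂χ.meas u := by
  have hae := χ.continuousFamily.ae_mem_fibre u
  rw [integral_pos_iff_support_of_nonneg_ae (by filter_upwards [hae] with γ hγ using h0 γ hγ) hi]
  obtain ⟨V, hV, hVk⟩ := continuousOn_iff'.1 hk {0}ᶜ isOpen_compl_singleton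
  have hmem : γ ∈ V ∩ 𝒢.r ⁻¹' {u} := hVk ▸ ⟨hpos, hγ⟩
  refine (χ.full_support u V hV ⟨γ, hmem⟩).trans_le (measure_mono_ae ?_)
  filter_upwards [hae] with η hη hηV
  have : η ∈ k ⁻¹' {0}ᶜ ∩ 𝒢.r ⁻¹' {u} := hVk ▸ ⟨hηV, hη⟩
  exact this.1

/-- A Haar system forces the range map to be open: a positive function with small support and a
nonzero integral over one fibre has a nonzero integral over the nearby fibres. -/
theorem isOpenMap_r [BorelSpace G] (χ : HaarSystem 𝒢) : IsOpenMap 𝒢.r := by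
  have := 𝒢.t2_units
  have := 𝒢.isLocCompact.locallyCompactSpace
  refine isOpenMap_iff_nhds_le.2 fun γ N (hN : 𝒢.r ⁻¹' N ∈ 𝓝 γ) => ?_
  obtain ⟨V, hVo, hγV, hVT⟩ := 𝒢.isLocCompact.exists_isOpen_t2Space γ
  let O := interior (𝒢.r ⁻¹' N) ∩ V
  have hO : IsOpen O := isOpen_interior.inter hVo
  have hOT : T2Space O := T2Space.of_injective_continuous
    (Set.inclusion_injective (Set.inter_subset_right (s := interior (𝒢.r ⁻¹' N)) (t := V)))
    (continuous_inclusion Set.inter_subset_right)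
  have hγO : γ ∈ O := ⟨mem_interior_iff_mem_nhds.2 hN, hγV⟩
  obtain ⟨h, hh, h1, h0⟩ := exists_ccOn_bump hO (isCompact_singleton (x := γ))
    (Set.singleton_subset_iff.2 hγO)
  have := χ.continuousFamily.isFiniteMeasureOnCompacts (𝒢.r γ)
  have hsupp : ∀ η, h η ≠ 0 → η ∈ O := by
    intro η hη
    obtain ⟨-, K, hKO, -, hK0⟩ := hh
    by_contra hηO
    exact hη (Complex.ofReal_eq_zero.1 (hK0 η fun h => hηO (hKO h)))
  have hre : ContinuousOn h O := by
    exact Complex.continuous_re.comp_continuousOn hh.1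
  have hne : (∫ η, (h η : ℂ) ∂χ.meas (𝒢.r γ)) ≠ 0 := by
    rw [integral_complex_ofReal]
    refine Complex.ofReal_ne_zero.2 (ne_of_gt ?_)
    rw [integral_pos_iff_support_of_nonneg h0 (by simpa using (hh.integrable hO _).re)]
    refine (χ.full_support _ (O ∩ h ⁻¹' {0}ᶜ) (hre.isOpen_inter_preimage hO
      isOpen_compl_singleton) ⟨γ, ⟨hγO, by simp [h1 γ rfl]⟩, rfl⟩).trans_le ?_
    exact measure_mono fun η hη => hη.2
  filter_upwards [(χ.continuousFamily.continuous_integral (hh.mem_Cc hO)).continuousAt.eventually_ne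
    hne] with v hv
  by_contra hvN
  refine hv (integral_eq_zero_of_ae ?_)
  filter_upwards [χ.continuousFamily.ae_mem_fibre v] with η hη
  by_contra hη0
  refine hvN ?_
  have h2 : η ∈ 𝒢.r ⁻¹' N := interior_subset (hsupp η (by simpa using hη0)).1
  rw [← hη]
  exact h2

end HaarSystem

section Diagonal

variable {B₁ G₁ B₂ G₂ B₃ G₃ X Y : Type*}
  [TopologicalSpace B₁] [TopologicalSpace G₁] [TopologicalSpace B₂] [TopologicalSpace G₂]
  [TopologicalSpace B₃] [TopologicalSpace G₃] [TopologicalSpace X] [TopologicalSpace Y]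
  {𝒢₁ : LCGroupoid B₁ G₁} {𝒢₂ : LCGroupoid B₂ G₂} {𝒢₃ : LCGroupoid B₃ G₃}
  (S : Bispace 𝒢₁ 𝒢₂ X) (T : Bispace 𝒢₂ 𝒢₃ Y)

/-- The composable pairs `(z, γ)` of `Z ⋊ G₂`, as a subset of `Z × G₂`. -/
abbrev arrowSet : Set (FibreProd S T × G₂) := {q | S.sm q.1.1.1 = 𝒢₂.r q.2}

open Classical in
/-- The diagonal action `(x, y)γ = (xγ, γ⁻¹y)` on `Z`; it is the identity (a value without
meaning) on pairs that are not composable. -/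
noncomputable def diagAct (z : FibreProd S T) (γ : G₂) : FibreProd S T :=
  if h : S.sm z.1.1 = 𝒢₂.r γ then
    ⟨(S.ract z.1.1 γ, T.lact (𝒢₂.inv γ) z.1.2), by
      rw [S.sm_ract _ _ h, T.rm_lact _ _ (by rw [𝒢₂.s_inv, ← h, z.2]), 𝒢₂.r_inv]⟩
  else z

variable {S T}

theorem diagAct_val {z : FibreProd S T} {γ : G₂} (h : S.sm z.1.1 = 𝒢₂.r γ) :
    (diagAct S T z γ).1 = (S.ract z.1.1 γ, T.lact (𝒢₂.inv γ) z.1.2) := by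
  rw [diagAct, dif_pos h]

theorem sm_diagAct {z : FibreProd S T} {γ : G₂} (h : S.sm z.1.1 = 𝒢₂.r γ) :
    S.sm (diagAct S T z γ).1.1 = 𝒢₂.s γ := by
  rw [diagAct_val h, S.sm_ract _ _ h]

theorem diagAct_mul {z : FibreProd S T} {γ η : G₂} (h : S.sm z.1.1 = 𝒢₂.r γ)
    (hc : 𝒢₂.s γ = 𝒢₂.r η) :
    diagAct S T z (𝒢₂.mul γ η) = diagAct S T (diagAct S T z γ) η := by
  apply Subtype.ext
  rw [diagAct_val (by rw [𝒢₂.r_mul _ _ hc, h]), diagAct_val (by rw [sm_diagAct h, hc]),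
    diagAct_val h, 𝒢₂.inv_mul_rev hc, S.ract_mul _ _ _ h hc,
    T.mul_lact _ _ _ (by rw [𝒢₂.s_inv, 𝒢₂.r_inv, hc]) (by rw [𝒢₂.s_inv, ← h, z.2])]

theorem diagAct_diagAct_inv {z : FibreProd S T} {γ : G₂} (h : S.sm z.1.1 = 𝒢₂.r γ) :
    diagAct S T (diagAct S T z γ) (𝒢₂.inv γ) = z := by
  rw [← diagAct_mul h (𝒢₂.r_inv γ).symm, 𝒢₂.mul_inv, ← h]
  apply Subtype.ext
  rw [diagAct_val (𝒢₂.r_unit _).symm, S.ract_unit, 𝒢₂.inv_unit, z.2, T.unit_lact]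

theorem continuousOn_diagAct :
    ContinuousOn (fun q : FibreProd S T × G₂ => diagAct S T q.1 q.2) (arrowSet S T) := by
  have hi : IsInducing (Subtype.val : FibreProd S T → X × Y) := ⟨rfl⟩
  rw [hi.continuousOn_iff]
  refine ContinuousOn.congr (f := fun q : FibreProd S T × G₂ =>
    (S.ract q.1.1.1 q.2, T.lact (𝒢₂.inv q.2) q.1.1.2)) ?_ fun q hq => diagAct_val hq
  refine ContinuousOn.prodMk ?_ ?_
  · exact S.continuousOn_ract.comp (f := fun q : FibreProd S T × G₂ => (q.1.1.1, q.2))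
      (by fun_prop) fun q hq => hq
  · refine T.continuousOn_lact.comp
      (f := fun q : FibreProd S T × G₂ => (𝒢₂.inv q.2, q.1.1.2)) ?_ fun q hq => ?_
    · have := 𝒢₂.continuous_inv
      fun_prop
    · have hq' : S.sm q.1.1.1 = 𝒢₂.r q.2 := hq
      change 𝒢₂.s (𝒢₂.inv q.2) = T.rm q.1.1.2
      rw [𝒢₂.s_inv, ← hq', q.1.2]

theorem omegaMk_eq_iff {z w : FibreProd S T} :
    omegaMk S T z = omegaMk S T w ↔ ∃ γ, S.sm z.1.1 = 𝒢₂.r γ ∧ w = diagAct S T z γ := by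
  refine Quotient.eq.trans ⟨?_, ?_⟩
  · rintro ⟨γ, hγ, h⟩
    exact ⟨γ, hγ, Subtype.ext (h.trans (diagAct_val hγ).symm)⟩
  · rintro ⟨γ, hγ, rfl⟩
    exact ⟨γ, hγ, diagAct_val hγ⟩

theorem omegaMk_diagAct {z : FibreProd S T} {γ : G₂} (h : S.sm z.1.1 = 𝒢₂.r γ) :
    omegaMk S T (diagAct S T z γ) = omegaMk S T z :=
  (omegaMk_eq_iff.2 ⟨γ, h, rfl⟩).symm

theorem surjective_omegaMk : Function.Surjective (omegaMk S T) := Quotient.mk_surjective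

theorem continuous_omegaMk : Continuous (omegaMk S T) := continuous_quotient_mk'

theorem isOpenQuotientMap_omegaMk (hr : IsOpenMap 𝒢₂.r) : IsOpenQuotientMap (omegaMk S T) := by
  refine ⟨surjective_omegaMk, continuous_omegaMk, fun V hV => ?_⟩
  refine isOpen_coinduced.2 (isOpen_iff_mem_nhds.2 ?_)
  rintro w ⟨z, hz, hzw⟩
  obtain ⟨δ, hδ, rfl⟩ := omegaMk_eq_iff.1 (Eq.symm hzw : omegaMk S T w = omegaMk S T z)
  have h1 := continuousOn_diagAct (S := S) (T := T) (w, δ) hδ (hV.mem_nhds hz)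
  rw [Filter.mem_map, mem_nhdsWithin_iff_exists_mem_nhds_inter] at h1
  obtain ⟨N, hN, hNV⟩ := h1
  obtain ⟨A, hA, D, hD, hAD⟩ := mem_nhds_prod_iff.1 hN
  have h2 : 𝒢₂.r '' D ∈ 𝓝 (S.sm w.1.1) := by
    rw [show S.sm w.1.1 = 𝒢₂.r δ from hδ]
    exact hr.image_mem_nhds hD
  have h3 : Continuous fun w : FibreProd S T => S.sm w.1.1 := by
    have := S.continuous_sm
    fun_prop
  filter_upwards [hA, h3.continuousAt.preimage_mem_nhds h2] with w' hw' ⟨δ', hδ', hr'⟩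
  have h4 : (w', δ') ∈ N ∩ arrowSet S T := ⟨hAD ⟨hw', hδ'⟩, hr'.symm⟩
  have h5 : diagAct S T w' δ' ∈ V := hNV h4
  exact ⟨_, h5, omegaMk_diagAct hr'.symm⟩

theorem isClosed_range_fibreProd [T2Space B₂] :
    IsClosed {p : X × Y | S.sm p.1 = T.rm p.2} :=
  isClosed_eq (S.continuous_sm.comp continuous_fst) (T.continuous_rm.comp continuous_snd)

theorem locallyCompactSpace_fibreProd [T2Space B₂] [LocallyCompactSpace X]
    [LocallyCompactSpace Y] : LocallyCompactSpace (FibreProd S T) :=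
  (isClosed_range_fibreProd (S := S) (T := T)).isClosedEmbedding_subtypeVal.locallyCompactSpace

/-- Properness of the action on `X` gives compactness of the set of arrows that move a compact
subset of `Z` into a set lying over a compact subset of `X`. -/
theorem isProperMap_arrows [T2Space X]
    (hS : IsProperMap fun p : {p : X × G₂ // S.sm p.1 = 𝒢₂.r p.2} => (p.1.1, S.ract p.1.1 p.1.2)) :
    IsProperMap fun q : arrowSet S T => (q.1.1, S.ract q.1.1.1.1 q.1.2) := by
  rw [isProperMap_iff_ultrafilter] at hS ⊢
  have hc : Continuous fun q : arrowSet S T => (q.1.1, S.ract q.1.1.1.1 q.1.2) := by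
    refine Continuous.prodMk (by fun_prop) ?_
    exact S.continuousOn_ract.comp_continuous (f := fun q : arrowSet S T => (q.1.1.1.1, q.1.2))
      (by fun_prop) fun q => q.2
  refine ⟨hc, fun 𝒰 w hw => ?_⟩
  obtain ⟨z, x'⟩ := w
  let p : arrowSet S T → {p : X × G₂ // S.sm p.1 = 𝒢₂.r p.2} := fun q => ⟨(q.1.1.1.1, q.1.2), q.2⟩
  have hz : Filter.Tendsto (fun q : arrowSet S T => q.1.1) 𝒰 (𝓝 z) :=
    (continuous_fst.tendsto _).comp hw
  have hx : Filter.Tendsto (fun q : arrowSet S T => S.ract q.1.1.1.1 q.1.2) 𝒰 (𝓝 x') :=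
    (continuous_snd.tendsto _).comp hw
  obtain ⟨⟨⟨x, γ⟩, hxγ⟩, he, hle⟩ := @hS.2 (𝒰.map p) (z.1.1, x') (by
    rw [Ultrafilter.coe_map, Filter.tendsto_map'_iff]
    exact (((continuous_fst.comp continuous_subtype_val).tendsto z).comp hz).prodMk_nhds hx)
  obtain ⟨rfl, rfl⟩ := Prod.mk.inj he
  refine ⟨⟨(z, γ), hxγ⟩, rfl, ?_⟩
  have hγ : Filter.Tendsto (fun q : arrowSet S T => q.1.2) 𝒰 (𝓝 γ) := by
    have h1 : Filter.Tendsto (fun q : {p : X × G₂ // S.sm p.1 = 𝒢₂.r p.2} => q.1.2)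
        (𝒰.map p) (𝓝 γ) := Filter.Tendsto.mono_left
      ((continuous_snd.comp continuous_subtype_val).tendsto ⟨(z.1.1, γ), hxγ⟩) hle
    rw [Ultrafilter.coe_map, Filter.tendsto_map'_iff] at h1
    exact h1
  rw [nhds_subtype_eq_comap, ← Filter.map_le_iff_le_comap]
  exact hz.prodMk_nhds hγ

/-- The set of arrows from a compact subset of `Z` into the part of `Z` over a compact subset of
`X`. -/
theorem exists_isCompact_arrows [T2Space X]
    (hS : IsProperMap fun p : {p : X × G₂ // S.sm p.1 = 𝒢₂.r p.2} =>
      (p.1.1, S.ract p.1.1 p.1.2))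
    {L : Set (FibreProd S T)} (hL : IsCompact L) {K : Set X}
    (hK : IsCompact K) : ∃ M ⊆ arrowSet S T, IsCompact M ∧
      ∀ q ∈ arrowSet S T, q.1 ∈ L → S.ract q.1.1.1 q.2 ∈ K → q ∈ M := by
  refine ⟨_, ?_, ((isProperMap_arrows (T := T) hS).isCompact_preimage (hL.prod hK)).image
    continuous_subtype_val, fun q hq hqL hqK => ⟨⟨q, hq⟩, ⟨hqL, hqK⟩, rfl⟩⟩
  rintro _ ⟨q, -, rfl⟩
  exact q.2

theorem t2Space_omega_of_isProperMap [T2Space X] [T2Space Y]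
    (hS : IsProperMap fun p : {p : X × G₂ // S.sm p.1 = 𝒢₂.r p.2} =>
      (p.1.1, S.ract p.1.1 p.1.2))
    (hr : IsOpenMap 𝒢₂.r) : T2Space (Omega S T) := by
  rw [t2Space_iff_of_isOpenQuotientMap (isOpenQuotientMap_omegaMk hr)]
  have hc : Continuous fun q : arrowSet S T => (q.1.1, diagAct S T q.1.1 q.1.2) :=
    Continuous.prodMk (by fun_prop)
      (continuousOn_diagAct.comp_continuous continuous_subtype_val fun q => q.2)
  have h1 : IsProperMap fun q : arrowSet S T => (q.1.1, diagAct S T q.1.1 q.1.2) := by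
    refine isProperMap_of_comp_of_t2 (g := fun w : FibreProd S T × FibreProd S T => (w.1, w.2.1.1))
      hc (by fun_prop) ?_
    convert isProperMap_arrows (T := T) hS using 2 with q
    exact Prod.ext rfl (congrArg Prod.fst (diagAct_val q.2))
  convert h1.isClosedMap.isClosed_range using 1
  ext ⟨z, w⟩
  refine omegaMk_eq_iff.trans ⟨?_, ?_⟩
  · rintro ⟨γ, hγ, h⟩
    exact ⟨⟨(z, γ), hγ⟩, Prod.ext rfl h.symm⟩
  · rintro ⟨⟨⟨z', γ⟩, hγ⟩, h⟩
    obtain ⟨rfl, rfl⟩ := Prod.mk.inj h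
    exact ⟨γ, hγ, rfl⟩

/-- Inversion of arrows of `Z ⋊ G₂`, `(z, γ) ↦ (zγ, γ⁻¹)`. -/
noncomputable def arrowInv (S : Bispace 𝒢₁ 𝒢₂ X) (T : Bispace 𝒢₂ 𝒢₃ Y)
    (q : FibreProd S T × G₂) : FibreProd S T × G₂ :=
  (diagAct S T q.1 q.2, 𝒢₂.inv q.2)

theorem continuousOn_arrowInv (S : Bispace 𝒢₁ 𝒢₂ X) (T : Bispace 𝒢₂ 𝒢₃ Y) :
    ContinuousOn (arrowInv S T) (arrowSet S T) :=
  continuousOn_diagAct.prodMk (𝒢₂.continuous_inv.comp continuous_snd).continuousOn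

theorem mapsTo_arrowInv (S : Bispace 𝒢₁ 𝒢₂ X) (T : Bispace 𝒢₂ 𝒢₃ Y) :
    Set.MapsTo (arrowInv S T) (arrowSet S T) (arrowSet S T) := by
  intro q hq
  change S.sm (diagAct S T q.1 q.2).1.1 = 𝒢₂.r (𝒢₂.inv q.2)
  rw [sm_diagAct hq, 𝒢₂.r_inv]

theorem arrowInv_arrowInv {S : Bispace 𝒢₁ 𝒢₂ X} {T : Bispace 𝒢₂ 𝒢₃ Y}
    {q : FibreProd S T × G₂} (hq : q ∈ arrowSet S T) : arrowInv S T (arrowInv S T q) = q :=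
  Prod.ext (diagAct_diagAct_inv hq) (𝒢₂.inv_inv _)

theorem IsPiece.comp_arrowInv {S : Bispace 𝒢₁ 𝒢₂ X} {T : Bispace 𝒢₂ 𝒢₃ Y} {U : Set G₂}
    {F : FibreProd S T × G₂ → ℂ} (hF : IsPiece (arrowSet S T) U F) :
    IsPiece (arrowSet S T) (𝒢₂.inv ⁻¹' U) (F ∘ arrowInv S T) := by
  have := hF.t2Space
  obtain ⟨K, hKW, hK, hKU, h0⟩ := hF.exists_isCompact
  refine ⟨hF.isOpen.preimage 𝒢₂.continuous_inv, ?_,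
    hF.continuousOn.comp (continuousOn_arrowInv S T) (mapsTo_arrowInv S T),
    arrowInv S T '' K, ?_, hK.image_of_continuousOn ((continuousOn_arrowInv S T).mono hKW), ?_, ?_⟩
  · refine T2Space.of_injective_continuous
      (f := fun γ : 𝒢₂.inv ⁻¹' U => (⟨𝒢₂.inv γ, γ.2⟩ : U)) (fun a b hab => ?_) ?_
    · have h1 := congrArg (fun w : U => 𝒢₂.inv w) hab
      simp only [𝒢₂.inv_inv] at h1
      exact Subtype.ext h1
    · exact (𝒢₂.continuous_inv.comp continuous_subtype_val).subtype_mk _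
  · rintro _ ⟨q, hq, rfl⟩
    exact mapsTo_arrowInv S T (hKW hq)
  · rintro _ ⟨q, hq, rfl⟩
    change 𝒢₂.inv (𝒢₂.inv q.2) ∈ U
    rw [𝒢₂.inv_inv]
    exact hKU q hq
  · intro q hq hqK
    exact h0 _ (mapsTo_arrowInv S T hq) fun h => hqK ⟨_, h, arrowInv_arrowInv hq⟩

open Classical in
/-- The right action `(x, y)η = (x, yη)` of `G₃` on `Z`; it is the identity (a value without
meaning) where `s_Y(y) ≠ r(η)`. -/
noncomputable def rightAct (S : Bispace 𝒢₁ 𝒢₂ X) (T : Bispace 𝒢₂ 𝒢₃ Y) (η : G₃)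
    (z : FibreProd S T) : FibreProd S T :=
  if h : T.sm z.1.2 = 𝒢₃.r η then
    ⟨(z.1.1, T.ract z.1.2 η), by rw [T.rm_ract _ _ h]; exact z.2⟩
  else z

theorem rightAct_val {z : FibreProd S T} {η : G₃} (h : T.sm z.1.2 = 𝒢₃.r η) :
    (rightAct S T η z).1 = (z.1.1, T.ract z.1.2 η) := by
  rw [rightAct, dif_pos h]

theorem rightAct_inv_rightAct {z : FibreProd S T} {η : G₃} (h : T.sm z.1.2 = 𝒢₃.r η) :
    rightAct S T (𝒢₃.inv η) (rightAct S T η z) = z := by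
  have h1 := T.sm_ract _ _ h
  apply Subtype.ext
  rw [rightAct_val (by rw [rightAct_val h, h1, 𝒢₃.r_inv]), rightAct_val h,
    ← T.ract_mul _ _ _ h (𝒢₃.r_inv η).symm, 𝒢₃.mul_inv, ← h, T.ract_unit]

theorem sm_snd_diagAct {z : FibreProd S T} {γ : G₂} (h : S.sm z.1.1 = 𝒢₂.r γ) :
    T.sm (diagAct S T z γ).1.2 = T.sm z.1.2 := by
  rw [diagAct_val h, T.sm_lact _ _ (by rw [𝒢₂.s_inv, ← h, z.2])]

theorem rightAct_diagAct {z : FibreProd S T} {γ : G₂} {η : G₃} (h : S.sm z.1.1 = 𝒢₂.r γ)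
    (hη : T.sm z.1.2 = 𝒢₃.r η) :
    rightAct S T η (diagAct S T z γ) = diagAct S T (rightAct S T η z) γ := by
  have ha : S.sm (rightAct S T η z).1.1 = 𝒢₂.r γ := by rw [rightAct_val hη, h]
  apply Subtype.ext
  rw [rightAct_val (by rw [sm_snd_diagAct h, hη]), diagAct_val ha, rightAct_val hη, diagAct_val h,
    T.lact_ract _ _ _ (by rw [𝒢₂.s_inv, ← h, z.2]) hη]

theorem omegaAct_omegaMk {z : FibreProd S T} {η : G₃} (h : T.sm z.1.2 = 𝒢₃.r η) :
    omegaAct S T (omegaMk S T z) η = omegaMk S T (rightAct S T η z) := by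
  rw [rightAct, dif_pos h]
  exact dif_pos h

theorem continuousOn_rightAct (η : G₃) :
    ContinuousOn (rightAct S T η) {z | T.sm z.1.2 = 𝒢₃.r η} := by
  have hi : IsInducing (Subtype.val : FibreProd S T → X × Y) := ⟨rfl⟩
  rw [hi.continuousOn_iff]
  refine ContinuousOn.congr (f := fun z : FibreProd S T => (z.1.1, T.ract z.1.2 η)) ?_
    fun z hz => rightAct_val hz
  refine ContinuousOn.prodMk (by fun_prop) ?_
  exact T.continuousOn_ract.comp (f := fun z : FibreProd S T => (z.1.2, η)) (by fun_prop)
    fun z hz => hz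

theorem continuous_sm_snd (S : Bispace 𝒢₁ 𝒢₂ X) (T : Bispace 𝒢₂ 𝒢₃ Y) :
    Continuous fun z : FibreProd S T => T.sm z.1.2 :=
  T.continuous_sm.comp (continuous_snd.comp continuous_subtype_val)

theorem continuous_omegaMomentum (S : Bispace 𝒢₁ 𝒢₂ X) (T : Bispace 𝒢₂ 𝒢₃ Y) :
    Continuous (omegaMomentum S T) :=
  (continuous_sm_snd S T).quotient_lift _

theorem continuous_sm_fst (S : Bispace 𝒢₁ 𝒢₂ X) (T : Bispace 𝒢₂ 𝒢₃ Y) :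
    Continuous fun z : FibreProd S T => S.sm z.1.1 :=
  S.continuous_sm.comp (continuous_fst.comp continuous_subtype_val)

/-- The integral of `f` over the orbit of `z`, as a function on `Z`. -/
noncomputable def orbitSum [MeasurableSpace G₂] (χ₂ : HaarSystem 𝒢₂) (S : Bispace 𝒢₁ 𝒢₂ X)
    (T : Bispace 𝒢₂ 𝒢₃ Y) (f : FibreProd S T → ℂ) (z : FibreProd S T) : ℂ :=
  ∫ γ, f (diagAct S T z γ) ∂χ₂.meas (S.sm z.1.1)

theorem orbitIntegral_eq_orbitSum_out [MeasurableSpace G₂] (χ₂ : HaarSystem 𝒢₂)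
    (S : Bispace 𝒢₁ 𝒢₂ X) (T : Bispace 𝒢₂ 𝒢₃ Y) (f : FibreProd S T → ℂ) (ω : Omega S T) :
    orbitIntegral χ₂ S T f ω = orbitSum χ₂ S T f (Quotient.out ω) := by
  have h : ∀ z : FibreProd S T, ∫ γ, Function.extend Subtype.val f 0
      (S.ract z.1.1 γ, T.lact (𝒢₂.inv γ) z.1.2) ∂(χ₂.meas (T.rm z.1.2)) =
      orbitSum χ₂ S T f z := by
    intro z
    rw [orbitSum, ← z.2]
    refine integral_congr_ae ?_
    filter_upwards [χ₂.continuousFamily.ae_mem_fibre (S.sm z.1.1)] with γ hγ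
    rw [← diagAct_val hγ.symm, Subtype.val_injective.extend_apply]
  exact h _

theorem productIntegral_ofReal [MeasurableSpace X] [MeasurableSpace Y]
    (S : Bispace 𝒢₁ 𝒢₂ X) (T : Bispace 𝒢₂ 𝒢₃ Y)
    (α : B₂ → Measure X) (β : B₃ → Measure Y) (u : B₃) (f : FibreProd S T → ℝ) :
    productIntegral S T α β u (fun z => (f z : ℂ)) =
      ((∫ y, ∫ x, Function.extend Subtype.val f 0 (x, y) ∂(α (T.rm y)) ∂(β u) : ℝ) : ℂ) := by
  have h : ∀ p : X × Y, Function.extend Subtype.val (fun z : FibreProd S T => (f z : ℂ)) 0 p =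
      ((Function.extend Subtype.val f 0 p : ℝ) : ℂ) := by
    intro p
    by_cases hp : ∃ z : FibreProd S T, z.1 = p
    · obtain ⟨z, rfl⟩ := hp
      rw [Subtype.val_injective.extend_apply, Subtype.val_injective.extend_apply]
    · simp [Function.extend_apply' _ _ _ hp]
  simp_rw [productIntegral, h, integral_complex_ofReal]

theorem productIntegral_re_nonneg [MeasurableSpace X] [MeasurableSpace Y]
    (S : Bispace 𝒢₁ 𝒢₂ X) (T : Bispace 𝒢₂ 𝒢₃ Y)
    (α : B₂ → Measure X) (β : B₃ → Measure Y) (u : B₃) {f : FibreProd S T → ℝ} (hf : ∀ z, 0 ≤ f z) :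
    0 ≤ (productIntegral S T α β u (fun z => (f z : ℂ))).re := by
  rw [productIntegral_ofReal, Complex.ofReal_re]
  refine integral_nonneg fun y => integral_nonneg fun x => ?_
  change 0 ≤ Function.extend Subtype.val f 0 (x, y)
  by_cases hp : ∃ z : FibreProd S T, z.1 = (x, y)
  · obtain ⟨z, hz⟩ := hp
    rw [← hz, Subtype.val_injective.extend_apply]
    exact hf z
  · simp [Function.extend_apply' _ _ _ hp]

theorem orbitIntegral_smul [MeasurableSpace G₂] (χ₂ : HaarSystem 𝒢₂) (S : Bispace 𝒢₁ 𝒢₂ X)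
    (T : Bispace 𝒢₂ 𝒢₃ Y) (c : ℂ) (f : FibreProd S T → ℂ) :
    orbitIntegral χ₂ S T (c • f) = c • orbitIntegral χ₂ S T f := by
  ext ω
  simp only [orbitIntegral_eq_orbitSum_out, Pi.smul_apply, orbitSum, smul_eq_mul,
    integral_const_mul]

end Diagonal

/-! ### Integration over the orbits -/

section OrbitIntegral

variable {B₁ G₁ B₂ G₂ B₃ G₃ X Y : Type*}
  [TopologicalSpace B₁] [TopologicalSpace G₁] [MeasurableSpace G₁]
  [TopologicalSpace B₂] [TopologicalSpace G₂] [MeasurableSpace G₂]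
  [TopologicalSpace B₃] [TopologicalSpace G₃] [MeasurableSpace G₃]
  [TopologicalSpace X] [MeasurableSpace X] [TopologicalSpace Y] [MeasurableSpace Y]
  {𝒢₁ : LCGroupoid B₁ G₁} {χ₁ : HaarSystem 𝒢₁} {𝒢₂ : LCGroupoid B₂ G₂} {χ₂ : HaarSystem 𝒢₂}
  {𝒢₃ : LCGroupoid B₃ G₃} {χ₃ : HaarSystem 𝒢₃}

theorem TopCorrespondence.locallyCompactSpace_fibreProd (S : TopCorrespondence 𝒢₁ χ₁ 𝒢₂ χ₂ X)
    (T : TopCorrespondence 𝒢₂ χ₂ 𝒢₃ χ₃ Y) :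
    LocallyCompactSpace (FibreProd S.toBispace T.toBispace) := by
  have := 𝒢₂.t2_units
  have := S.isLocCompact.locallyCompactSpace
  have := T.isLocCompact.locallyCompactSpace
  exact _root_.locallyCompactSpace_fibreProd

variable (S : TopCorrespondence 𝒢₁ χ₁ 𝒢₂ χ₂ X) (T : TopCorrespondence 𝒢₂ χ₂ 𝒢₃ χ₃ Y)

theorem properlySupportedAlong_of_ract [T2Space X]
    {F : FibreProd S.toBispace T.toBispace × G₂ → ℂ}
    (hF : ContinuousOn F (arrowSet S.toBispace T.toBispace)) {K : Set X} (hK : IsCompact K)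
    (h0 : ∀ q ∈ arrowSet S.toBispace T.toBispace, S.ract q.1.1.1 q.2 ∉ K → F q = 0) :
    ProperlySupportedAlong (arrowSet S.toBispace T.toBispace) F := by
  refine ⟨hF, fun L hL => ?_⟩
  obtain ⟨M, hM, hMc, hmem⟩ := exists_isCompact_arrows S.proper_action (T := T.toBispace) hL hK
  exact ⟨M, hM, hMc, fun q hq hqL hqM => h0 q hq fun h => hqM (hmem q hq hqL h)⟩

theorem properlySupportedAlong_diagAct [T2Space X] [T2Space Y]
    {f : FibreProd S.toBispace T.toBispace → ℂ}
    (hf : f ∈ Cc (FibreProd S.toBispace T.toBispace)) :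
    ProperlySupportedAlong (arrowSet S.toBispace T.toBispace)
      fun q => f (diagAct S.toBispace T.toBispace q.1 q.2) := by
  obtain ⟨hfc, hfs⟩ := (mem_Cc_iff f).1 hf
  refine properlySupportedAlong_of_ract S T (hfc.comp_continuousOn continuousOn_diagAct)
    (hfs.isCompact.image (continuous_fst.comp continuous_subtype_val)) fun q hq hqK => ?_
  refine image_eq_zero_of_notMem_tsupport fun h => hqK ⟨_, h, ?_⟩
  exact congrArg Prod.fst (diagAct_val hq)

variable [BorelSpace G₂]

theorem isOpenQuotientMap_omega : IsOpenQuotientMap (omegaMk S.toBispace T.toBispace) :=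
  isOpenQuotientMap_omegaMk χ₂.isOpenMap_r

theorem locallyCompactSpace_Omega : LocallyCompactSpace (Omega S.toBispace T.toBispace) :=
  have := TopCorrespondence.locallyCompactSpace_fibreProd S T
  (isOpenQuotientMap_omega S T).locallyCompactSpace

theorem sigmaCompactSpace_Omega [SecondCountableTopology X] [SecondCountableTopology Y] :
    SigmaCompactSpace (Omega S.toBispace T.toBispace) := by
  have := locallyCompactSpace_Omega S T
  have : SecondCountableTopology (FibreProd S.toBispace T.toBispace) :=
    IsInducing.secondCountableTopology (f := Subtype.val) ⟨rfl⟩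
  have : SecondCountableTopology (Omega S.toBispace T.toBispace) :=
    (isOpenQuotientMap_omega S T).isQuotientMap.secondCountableTopology
      (isOpenQuotientMap_omega S T).isOpenMap
  infer_instance

/-- A compact subset of `Ω` is the image of a compact subset of `Z`. -/
theorem exists_isCompact_image_omegaMk {C : Set (Omega S.toBispace T.toBispace)}
    (hC : IsCompact C) :
    ∃ L : Set (FibreProd S.toBispace T.toBispace), IsCompact L ∧ C ⊆ omegaMk _ _ '' L := by
  have := TopCorrespondence.locallyCompactSpace_fibreProd S T
  have ho := isOpenQuotientMap_omega S T
  choose L hL hzL using fun z : FibreProd S.toBispace T.toBispace => exists_compact_mem_nhds z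
  obtain ⟨t, -, ht⟩ := hC.elim_nhds_subcover (fun ω => omegaMk _ _ '' L (Quotient.out ω))
    fun ω _ => by
      have h1 := ho.isOpenMap.image_mem_nhds (hzL (Quotient.out ω))
      rwa [show omegaMk S.toBispace T.toBispace (Quotient.out ω) = ω from Quotient.out_eq ω] at h1
  refine ⟨⋃ ω ∈ t, L (Quotient.out ω), t.isCompact_biUnion fun ω _ => hL _, ?_⟩
  rw [Set.image_iUnion₂]
  exact ht

variable [T2Space X] [T2Space Y]

theorem t2Space_Omega : T2Space (Omega S.toBispace T.toBispace) :=
  t2Space_omega_of_isProperMap S.proper_action χ₂.isOpenMap_r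

theorem integral_arrows_mem_Cc {U : Set G₂} {F : FibreProd S.toBispace T.toBispace × G₂ → ℂ}
    (hF : IsPiece (arrowSet S.toBispace T.toBispace) U F) :
    (fun z => ∫ γ, F (z, γ) ∂χ₂.meas (S.sm z.1.1)) ∈ Cc (FibreProd S.toBispace T.toBispace) := by
  have := 𝒢₂.t2_units
  have h1 := χ₂.continuousFamily.continuous_integral_isPiece
    (ρ := fun z : FibreProd S.toBispace T.toBispace => S.sm z.1.1)
    𝒢₂.isLocCompact (continuous_sm_fst S.toBispace T.toBispace) hF
  have h2 := χ₂.continuousFamily.hasCompactSupport_integral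
    (ρ := fun z : FibreProd S.toBispace T.toBispace => S.sm z.1.1) hF.ccAlong
  exact (mem_Cc_iff _).2 ⟨h1, h2⟩

section Hausdorff

variable [hT2 : T2Space (arrowSet S.toBispace T.toBispace)]

theorem continuous_integral_arrows {F : FibreProd S.toBispace T.toBispace × G₂ → ℂ}
    (hF : ProperlySupportedAlong (arrowSet S.toBispace T.toBispace) F) :
    Continuous fun z => ∫ γ, F (z, γ) ∂χ₂.meas (S.sm z.1.1) := by
  have := 𝒢₂.t2_units
  have := TopCorrespondence.locallyCompactSpace_fibreProd S T
  exact χ₂.continuousFamily.continuous_integral_properlySupported 𝒢₂.isLocCompact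
    (continuous_sm_fst S.toBispace T.toBispace) hF

theorem integrable_arrows {F : FibreProd S.toBispace T.toBispace × G₂ → ℂ}
    (hF : ProperlySupportedAlong (arrowSet S.toBispace T.toBispace) F)
    (z : FibreProd S.toBispace T.toBispace) :
    Integrable (fun γ => F (z, γ)) (χ₂.meas (S.sm z.1.1)) := by
  have := 𝒢₂.t2_units
  have := TopCorrespondence.locallyCompactSpace_fibreProd S T
  exact χ₂.continuousFamily.integrable_properlySupported 𝒢₂.isLocCompact
    (continuous_sm_fst S.toBispace T.toBispace) hF z

/-- Left invariance of the Haar system, for integrands that are defined on one fibre only. -/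
theorem integral_mul_left {F : FibreProd S.toBispace T.toBispace × G₂ → ℂ}
    (hF : ProperlySupportedAlong (arrowSet S.toBispace T.toBispace) F)
    {z : FibreProd S.toBispace T.toBispace} {γ : G₂} (hγ : S.sm z.1.1 = 𝒢₂.r γ) :
    ∫ η, F (z, 𝒢₂.mul γ η) ∂χ₂.meas (𝒢₂.s γ) = ∫ η, F (z, η) ∂χ₂.meas (S.sm z.1.1) := by
  have := 𝒢₂.t2_units
  have hT : T2Space (𝒢₂.r ⁻¹' {S.sm z.1.1}) := T2Space.of_injective_continuous
    (f := fun η : 𝒢₂.r ⁻¹' {S.sm z.1.1} =>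
      (⟨(z, η.1), Eq.symm η.2⟩ : arrowSet S.toBispace T.toBispace))
    (fun a b hab => Subtype.ext (congrArg (fun q => q.1.2) hab)) (by fun_prop)
  obtain ⟨K, hKW, hK, h0⟩ := hF.2 {z} isCompact_singleton
  have hcl : IsClosed {q : FibreProd S.toBispace T.toBispace × G₂ | q.1 = z} :=
    isClosed_singleton.preimage continuous_fst
  obtain ⟨g, hg, hgF⟩ := χ₂.continuousFamily.exists_Cc_extension 𝒢₂.isLocCompact hT
    (k := fun η => F (z, η)) ⟨hF.1.comp (by fun_prop) fun η hη => Eq.symm hη,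
      Prod.snd '' (K ∩ {q | q.1 = z}), by
        rintro _ ⟨q, ⟨hq, hqz⟩, rfl⟩
        have h1 : S.sm q.1.1.1 = 𝒢₂.r q.2 := hKW hq
        have h2 : q.1 = z := hqz
        rw [h2] at h1
        exact h1.symm, (hK.inter_right hcl).image continuous_snd,
      fun η hη hηK => h0 (z, η) (Eq.symm hη) rfl fun h => hηK ⟨_, ⟨h, rfl⟩, rfl⟩⟩
  have h1 := χ₂.left_invariant γ g hg
  rw [← hγ] at h1
  rw [integral_congr_ae (g := fun η => g (𝒢₂.mul γ η)), h1]
  · refine integral_congr_ae ?_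
    filter_upwards [χ₂.continuousFamily.ae_mem_fibre (S.sm z.1.1)] with η hη using hgF η hη
  · filter_upwards [χ₂.continuousFamily.ae_mem_fibre (𝒢₂.s γ)] with η hη
    exact (hgF _ (by rw [𝒢₂.r_mul _ _ hη.symm, hγ])).symm

theorem continuous_orbitSum {f : FibreProd S.toBispace T.toBispace → ℂ} (hf : f ∈ Cc _) :
    Continuous (orbitSum χ₂ S.toBispace T.toBispace f) :=
  continuous_integral_arrows S T (properlySupportedAlong_diagAct S T hf)

theorem orbitSum_diagAct {f : FibreProd S.toBispace T.toBispace → ℂ} (hf : f ∈ Cc _)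
    {z : FibreProd S.toBispace T.toBispace} {γ : G₂} (hγ : S.sm z.1.1 = 𝒢₂.r γ) :
    orbitSum χ₂ S.toBispace T.toBispace f (diagAct _ _ z γ) = orbitSum χ₂ _ _ f z := by
  rw [orbitSum, sm_diagAct hγ, orbitSum,
    ← integral_mul_left S T (properlySupportedAlong_diagAct S T hf) hγ]
  refine integral_congr_ae ?_
  filter_upwards [χ₂.continuousFamily.ae_mem_fibre (𝒢₂.s γ)] with η hη
  rw [diagAct_mul hγ hη.symm]

theorem orbitIntegral_omegaMk {f : FibreProd S.toBispace T.toBispace → ℂ} (hf : f ∈ Cc _)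
    (z : FibreProd S.toBispace T.toBispace) :
    orbitIntegral χ₂ _ _ f (omegaMk _ _ z) = orbitSum χ₂ S.toBispace T.toBispace f z := by
  rw [orbitIntegral_eq_orbitSum_out]
  obtain ⟨γ, hγ, h⟩ := omegaMk_eq_iff.1
    (Quotient.out_eq (omegaMk S.toBispace T.toBispace z) :
      omegaMk _ _ (Quotient.out (omegaMk _ _ z)) = omegaMk _ _ z)
  have h1 := orbitSum_diagAct S T hf hγ
  rw [← h] at h1
  exact h1.symm

theorem orbitIntegral_mem_Cc {f : FibreProd S.toBispace T.toBispace → ℂ} (hf : f ∈ Cc _) :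
    orbitIntegral χ₂ _ _ f ∈ Cc (Omega S.toBispace T.toBispace) := by
  have := t2Space_Omega S T
  obtain ⟨-, hfs⟩ := (mem_Cc_iff f).1 hf
  refine (mem_Cc_iff _).2 ⟨?_, ?_⟩
  · rw [(isOpenQuotientMap_omega S T).isQuotientMap.continuous_iff]
    exact (continuous_orbitSum S T hf).congr fun z => (orbitIntegral_omegaMk S T hf z).symm
  · refine HasCompactSupport.intro (hfs.isCompact.image continuous_omegaMk) fun ω hω => ?_
    obtain ⟨z, rfl⟩ := surjective_omegaMk ω
    rw [orbitIntegral_omegaMk S T hf]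
    refine integral_eq_zero_of_ae ?_
    filter_upwards [χ₂.continuousFamily.ae_mem_fibre (S.sm z.1.1)] with γ hγ
    refine image_eq_zero_of_notMem_tsupport fun h => hω ⟨_, h, omegaMk_diagAct hγ.symm⟩

theorem orbitSum_add {f g : FibreProd S.toBispace T.toBispace → ℂ} (hf : f ∈ Cc _)
    (hg : g ∈ Cc _) : orbitSum χ₂ S.toBispace T.toBispace (f + g) =
      orbitSum χ₂ _ _ f + orbitSum χ₂ _ _ g := by
  ext z
  exact integral_add (integrable_arrows S T (properlySupportedAlong_diagAct S T hf) z)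
    (integrable_arrows S T (properlySupportedAlong_diagAct S T hg) z)

theorem orbitIntegral_add {f g : FibreProd S.toBispace T.toBispace → ℂ} (hf : f ∈ Cc _)
    (hg : g ∈ Cc _) : orbitIntegral χ₂ S.toBispace T.toBispace (f + g) =
      orbitIntegral χ₂ _ _ f + orbitIntegral χ₂ _ _ g := by
  ext ω
  simp only [orbitIntegral_eq_orbitSum_out, Pi.add_apply, orbitSum_add S T hf hg]

/-- Integration over the orbits maps `C_c(Z)` onto `C_c(Ω)`, and a preimage of `φ` can be chosen
to be a nonnegative multiple of `φ ∘ π`. -/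
theorem exists_orbitIntegral_eq {φ : Omega S.toBispace T.toBispace → ℂ} (hφ : φ ∈ Cc _) :
    ∃ g : FibreProd S.toBispace T.toBispace → ℝ, (∀ z, 0 ≤ g z) ∧
      (fun z => (g z : ℂ) * φ (omegaMk _ _ z)) ∈ Cc _ ∧
      orbitIntegral χ₂ _ _ (fun z => (g z : ℂ) * φ (omegaMk _ _ z)) = φ := by
  have := t2Space_Omega S T
  have := TopCorrespondence.locallyCompactSpace_fibreProd S T
  obtain ⟨hφc, hφs⟩ := (mem_Cc_iff φ).1 hφ
  obtain ⟨L, hL, hφL⟩ := exists_isCompact_image_omegaMk S T hφs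
  obtain ⟨k, hk1, -, hks, hkI⟩ := exists_continuous_one_zero_of_isCompact hL isClosed_empty
    (Set.disjoint_empty _)
  let kc : FibreProd S.toBispace T.toBispace → ℂ := fun z => (k z : ℂ)
  have hk : kc ∈ Cc (FibreProd S.toBispace T.toBispace) :=
    (mem_Cc_iff _).2 ⟨by fun_prop, hks.comp_left (g := fun r : ℝ => (r : ℂ)) Complex.ofReal_zero⟩
  let I : FibreProd S.toBispace T.toBispace → ℝ := fun z =>
    ∫ γ, k (diagAct _ _ z γ) ∂χ₂.meas (S.sm z.1.1)
  have hI : ∀ z, orbitSum χ₂ S.toBispace T.toBispace kc z = (I z : ℂ) := fun z =>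
    integral_complex_ofReal
  have hIc : Continuous I := by
    refine (Complex.continuous_re.comp (continuous_orbitSum S T hk)).congr fun z => ?_
    simp [hI]
  have hI0 : ∀ z, 0 ≤ I z := fun z => integral_nonneg fun γ => (hkI _).1
  have hIpos : ∀ z, omegaMk _ _ z ∈ tsupport φ → 0 < I z := by
    intro z hz
    obtain ⟨w, hw, hwz⟩ := hφL hz
    obtain ⟨γ, hγ, rfl⟩ := omegaMk_eq_iff.1 hwz.symm
    refine χ₂.integral_pos ?_ ?_ (fun γ _ => (hkI _).1) hγ.symm (by simp [hk1 hw])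
    · refine k.continuous.comp_continuousOn (continuousOn_diagAct.comp
        (f := fun γ => (z, γ)) (by fun_prop) fun γ hγ => ?_)
      exact Eq.symm hγ
    · exact (integrable_arrows S T (properlySupportedAlong_diagAct S T hk) z).re
  have hmem : (fun z => ((k z / I z : ℝ) : ℂ) * φ (omegaMk _ _ z)) ∈
      Cc (FibreProd S.toBispace T.toBispace) := by
    refine (mem_Cc_iff _).2 ⟨?_, ?_⟩
    · rw [continuous_iff_continuousAt]
      intro z
      by_cases hz : omegaMk _ _ z ∈ tsupport φ
      · refine ContinuousAt.mul (Complex.continuous_ofReal.continuousAt.comp ?_)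
          (hφc.comp continuous_omegaMk).continuousAt
        exact k.continuous.continuousAt.div hIc.continuousAt (hIpos z hz).ne'
      · refine (continuousAt_const (y := (0 : ℂ))).congr ?_
        filter_upwards [continuous_omegaMk.continuousAt.preimage_mem_nhds
          ((isClosed_tsupport φ).isOpen_compl.mem_nhds hz)] with w hw
        rw [image_eq_zero_of_notMem_tsupport hw, mul_zero]
    · refine HasCompactSupport.intro hks.isCompact fun z hz => ?_
      rw [image_eq_zero_of_notMem_tsupport hz]
      simp
  refine ⟨fun z => k z / I z, fun z => div_nonneg (hkI z).1 (hI0 z), hmem, ?_⟩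
  ext ω
  obtain ⟨z, rfl⟩ := surjective_omegaMk ω
  rw [orbitIntegral_omegaMk S T hmem, orbitSum]
  by_cases hz : omegaMk _ _ z ∈ tsupport φ
  · rw [integral_congr_ae (g := fun γ => kc (diagAct _ _ z γ) * (φ (omegaMk _ _ z) / I z)),
      integral_mul_const]
    · have h1 := hI z
      rw [orbitSum] at h1
      rw [h1]
      have h2 : (I z : ℂ) ≠ 0 := by exact_mod_cast (hIpos z hz).ne'
      field_simp
    · filter_upwards [χ₂.continuousFamily.ae_mem_fibre (S.sm z.1.1)] with γ hγ
      have h1 : I (diagAct _ _ z γ) = I z := by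
        have := orbitSum_diagAct S T hk hγ.symm
        rw [hI, hI] at this
        exact_mod_cast this
      rw [omegaMk_diagAct hγ.symm, h1]
      simp only [kc]
      push_cast
      ring
  · rw [image_eq_zero_of_notMem_tsupport hz]
    refine integral_eq_zero_of_ae ?_
    filter_upwards [χ₂.continuousFamily.ae_mem_fibre (S.sm z.1.1)] with γ hγ
    rw [omegaMk_diagAct hγ.symm, image_eq_zero_of_notMem_tsupport hz]
    simp

end Hausdorff

end OrbitIntegral

/-! ### The product measures on the fibre product -/

section ProductIntegral

variable {B₁ G₁ B₂ G₂ B₃ G₃ X Y : Type*}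
  [TopologicalSpace B₁] [TopologicalSpace G₁] [MeasurableSpace G₁]
  [TopologicalSpace B₂] [TopologicalSpace G₂] [MeasurableSpace G₂]
  [TopologicalSpace B₃] [TopologicalSpace G₃] [MeasurableSpace G₃]
  [TopologicalSpace X] [MeasurableSpace X] [TopologicalSpace Y] [MeasurableSpace Y]
  {𝒢₁ : LCGroupoid B₁ G₁} {χ₁ : HaarSystem 𝒢₁} {𝒢₂ : LCGroupoid B₂ G₂} {χ₂ : HaarSystem 𝒢₂}
  {𝒢₃ : LCGroupoid B₃ G₃} {χ₃ : HaarSystem 𝒢₃}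
  (S : TopCorrespondence 𝒢₁ χ₁ 𝒢₂ χ₂ X) (T : TopCorrespondence 𝒢₂ χ₂ 𝒢₃ χ₃ Y)

theorem extend_fibreProd {f : FibreProd S.toBispace T.toBispace → ℂ} {x : X} {y : Y}
    (h : S.sm x = T.rm y) :
    Function.extend Subtype.val f 0 (x, y) = f ⟨(x, y), h⟩ :=
  Subtype.val_injective.extend_apply f 0 ⟨(x, y), h⟩

theorem continuousOn_extend_arrows {F : FibreProd S.toBispace T.toBispace × G₂ → ℂ}
    (hF : ContinuousOn F (arrowSet S.toBispace T.toBispace)) :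
    ContinuousOn (fun q : (X × Y) × G₂ => Function.extend Subtype.val (fun z => F (z, q.2)) 0 q.1)
      {q | S.sm q.1.1 = T.rm q.1.2 ∧ S.sm q.1.1 = 𝒢₂.r q.2} := by
  rw [continuousOn_iff_continuous_domRestrict]
  have h := hF.comp_continuous
    (f := fun q : {q : (X × Y) × G₂ | S.sm q.1.1 = T.rm q.1.2 ∧ S.sm q.1.1 = 𝒢₂.r q.2} =>
      ((⟨q.1.1, q.2.1⟩ : FibreProd S.toBispace T.toBispace), q.1.2)) (by fun_prop) fun q => q.2.2
  exact h.congr fun q => (extend_fibreProd S T (f := fun z => F (z, q.1.2)) q.2.1).symm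

theorem continuousOn_extend_fibreProd {f : FibreProd S.toBispace T.toBispace → ℂ}
    (hf : Continuous f) :
    ContinuousOn (Function.extend Subtype.val f 0) {p : X × Y | S.sm p.1 = T.rm p.2} :=
  continuousOn_extend (U := {p : X × Y | S.sm p.1 = T.rm p.2}) hf

theorem extend_add_apply (f g : FibreProd S.toBispace T.toBispace → ℂ) (p : X × Y) :
    Function.extend Subtype.val (f + g) 0 p =
      Function.extend Subtype.val f 0 p + Function.extend Subtype.val g 0 p := by
  by_cases h : S.sm p.1 = T.rm p.2
  · rw [extend_fibreProd S T h, extend_fibreProd S T h, extend_fibreProd S T h, Pi.add_apply]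
  · have : ¬ ∃ z : FibreProd S.toBispace T.toBispace, z.1 = p := by
      rintro ⟨z, rfl⟩
      exact h z.2
    simp [Function.extend_apply' _ _ _ this]

theorem productIntegral_smul (c : ℂ) (f : FibreProd S.toBispace T.toBispace → ℂ) (u : B₃) :
    productIntegral S.toBispace T.toBispace S.meas T.meas u (c • f) =
      c * productIntegral _ _ S.meas T.meas u f := by
  have h : ∀ p : X × Y, Function.extend Subtype.val (c • f) 0 p =
      c * Function.extend Subtype.val f 0 p := by
    intro p
    by_cases h : S.sm p.1 = T.rm p.2
    · rw [extend_fibreProd S T h, extend_fibreProd S T h]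
      rfl
    · have : ¬ ∃ z : FibreProd S.toBispace T.toBispace, z.1 = p := by
        rintro ⟨z, rfl⟩
        exact h z.2
      simp [Function.extend_apply' _ _ _ this]
  simp_rw [productIntegral, h, integral_const_mul]

/-- Invariance of the family on `X`, for integrands that are defined on one fibre only. -/
theorem integral_ract [T2Space X] {K : Set X} (hK : IsCompact K) (γ : G₂) {k : X → ℂ}
    (hk : ContinuousOn k (S.sm ⁻¹' {𝒢₂.s γ})) (h0 : ∀ x, S.sm x = 𝒢₂.s γ → x ∉ K → k x = 0) :
    ∫ x, k (S.ract x γ) ∂S.meas (𝒢₂.r γ) = ∫ x, k x ∂S.meas (𝒢₂.s γ) := by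
  have := 𝒢₂.t2_units
  have := S.isLocCompact.locallyCompactSpace
  obtain ⟨g, hg, hgk⟩ := exists_ccOn_extension isOpen_univ
    (isClosed_singleton.preimage S.continuous_sm) hK (Set.subset_univ _)
    (hk.mono Set.inter_subset_left) h0
  rw [integral_congr_ae (g := fun x => g (S.ract x γ)),
    S.invariant γ g (hg.mem_Cc isOpen_univ)]
  · refine integral_congr_ae ?_
    filter_upwards [S.continuousFamily.ae_mem_fibre (𝒢₂.s γ)] with x hx using hgk x hx
  · filter_upwards [S.continuousFamily.ae_mem_fibre (𝒢₂.r γ)] with x hx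
    exact (hgk _ (S.sm_ract _ _ hx)).symm

variable [BorelSpace X] [T2Space X] [T2Space Y]

theorem integrable_inner {f : FibreProd S.toBispace T.toBispace → ℂ} (hf : f ∈ Cc _) (y : Y) :
    Integrable (fun x => Function.extend Subtype.val f 0 (x, y)) (S.meas (T.rm y)) := by
  have := 𝒢₂.t2_units
  have := S.isLocCompact.locallyCompactSpace
  obtain ⟨hfc, hfs⟩ := (mem_Cc_iff f).1 hf
  refine S.continuousFamily.integrable isOpen_univ
    (hfs.isCompact.image (continuous_fst.comp continuous_subtype_val)) (Set.subset_univ _) ?_ ?_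
  · exact (continuousOn_extend_fibreProd S T hfc).comp (f := fun x => (x, y)) (by fun_prop)
      fun x hx => hx.1
  · intro x hx hxK
    rw [extend_fibreProd S T hx]
    exact image_eq_zero_of_notMem_tsupport fun h => hxK ⟨_, h, rfl⟩

theorem inner_mem_Cc {f : FibreProd S.toBispace T.toBispace → ℂ} (hf : f ∈ Cc _) :
    (fun y => ∫ x, Function.extend Subtype.val f 0 (x, y) ∂S.meas (T.rm y)) ∈ Cc Y := by
  have := 𝒢₂.t2_units
  have := S.isLocCompact.locallyCompactSpace
  obtain ⟨hfc, hfs⟩ := (mem_Cc_iff f).1 hf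
  refine (mem_Cc_iff _).2 ⟨?_, ?_⟩
  · refine S.continuousFamily.continuous_integral_of_isCompact T.continuous_rm isOpen_univ
      (hfs.isCompact.image (continuous_fst.comp continuous_subtype_val)) (Set.subset_univ _)
      (F := fun y x => Function.extend Subtype.val f 0 (x, y)) ?_ ?_
    · exact (continuousOn_extend_fibreProd S T hfc).comp (f := fun q : Y × X => (q.2, q.1))
        (by fun_prop) fun q hq => hq.1.symm
    · intro y x hx hxK
      rw [extend_fibreProd S T hx.symm]
      exact image_eq_zero_of_notMem_tsupport fun h => hxK ⟨_, h, rfl⟩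
  · refine HasCompactSupport.intro
      (hfs.isCompact.image (continuous_snd.comp continuous_subtype_val)) fun y hy => ?_
    refine integral_eq_zero_of_ae ?_
    filter_upwards [S.continuousFamily.ae_mem_fibre (T.rm y)] with x hx
    rw [extend_fibreProd S T hx]
    exact image_eq_zero_of_notMem_tsupport fun h => hy ⟨_, h, rfl⟩

theorem productIntegral_mem_Cc {f : FibreProd S.toBispace T.toBispace → ℂ} (hf : f ∈ Cc _) :
    (fun u => productIntegral S.toBispace T.toBispace S.meas T.meas u f) ∈ Cc B₃ :=
  T.continuousFamily.integral_mem _ (inner_mem_Cc S T hf)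

theorem productIntegral_add [BorelSpace Y] {f g : FibreProd S.toBispace T.toBispace → ℂ}
    (hf : f ∈ Cc _) (hg : g ∈ Cc _) (u : B₃) :
    productIntegral S.toBispace T.toBispace S.meas T.meas u (f + g) =
      productIntegral _ _ S.meas T.meas u f + productIntegral _ _ S.meas T.meas u g := by
  have := T.continuousFamily.isFiniteMeasureOnCompacts u
  rw [productIntegral, productIntegral, productIntegral,
    ← integral_add (integrable_of_mem_Cc (inner_mem_Cc S T hf) _)
      (integrable_of_mem_Cc (inner_mem_Cc S T hg) _)]
  congr 1 with y
  rw [← integral_add (integrable_inner S T hf y) (integrable_inner S T hg y)]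
  simp_rw [extend_add_apply]

theorem productIntegral_sum [BorelSpace Y] {ι : Type*} (t : Finset ι)
    {f : ι → FibreProd S.toBispace T.toBispace → ℂ} (hf : ∀ i, f i ∈ Cc _) (u : B₃) :
    productIntegral S.toBispace T.toBispace S.meas T.meas u (∑ i ∈ t, f i) =
      ∑ i ∈ t, productIntegral _ _ S.meas T.meas u (f i) := by
  classical
  induction t using Finset.induction_on with
  | empty => simpa using productIntegral_smul S T 0 0 u
  | insert i t hi ih =>
    rw [Finset.sum_insert hi, Finset.sum_insert hi,
      productIntegral_add S T (hf i) (Submodule.sum_mem _ fun j _ => hf j), ih]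

/-- Fubini's theorem for the inner two integrals in `∫_Y ∫_X ∫_{G₂}`. -/
theorem productIntegral_integral_arrows [BorelSpace G₂] {U : Set G₂}
    {F : FibreProd S.toBispace T.toBispace × G₂ → ℂ}
    (hF : IsPiece (arrowSet S.toBispace T.toBispace) U F) (u : B₃) :
    productIntegral S.toBispace T.toBispace S.meas T.meas u
      (fun z => ∫ γ, F (z, γ) ∂χ₂.meas (S.sm z.1.1)) =
    ∫ y, ∫ γ, ∫ x, Function.extend Subtype.val (fun z => F (z, γ)) 0 (x, y) ∂S.meas (T.rm y)
      ∂χ₂.meas (T.rm y) ∂T.meas u := by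
  have := 𝒢₂.t2_units
  have := hF.t2Space
  obtain ⟨K, hKW, hK, hKU, h0⟩ := hF.exists_isCompact
  rw [productIntegral]
  congr 1 with y
  have := S.continuousFamily.isFiniteMeasureOnCompacts (T.rm y)
  have := χ₂.continuousFamily.isFiniteMeasureOnCompacts (T.rm y)
  have hcl : IsClosed {q : FibreProd S.toBispace T.toBispace × G₂ | q.1.1.2 = y} :=
    isClosed_singleton.preimage (f := fun q : FibreProd S.toBispace T.toBispace × G₂ => q.1.1.2)
      (by fun_prop)
  rw [← integral_integral_swap_of_ccAlong (A := S.sm ⁻¹' {T.rm y}) (C := 𝒢₂.r ⁻¹' {T.rm y})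
    (J := fun q => Function.extend Subtype.val (fun z => F (z, q.2)) 0 (q.1, y))
    (K := (fun q : FibreProd S.toBispace T.toBispace × G₂ => (q.1.1.1, q.2)) ''
      (K ∩ {q | q.1.1.2 = y})) (isClosed_singleton.preimage S.continuous_sm)
    (isClosed_singleton.preimage 𝒢₂.continuous_r) hF.isOpen
    (S.continuousFamily.ae_mem_fibre _) (χ₂.continuousFamily.ae_mem_fibre _)]
  · refine integral_congr_ae ?_
    filter_upwards [S.continuousFamily.ae_mem_fibre (T.rm y)] with x hx
    simp only [extend_fibreProd S T hx]
    rw [hx]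
  · refine (continuousOn_extend_arrows S T hF.continuousOn).comp
      (f := fun q : X × G₂ => ((q.1, y), q.2)) (by fun_prop) fun q hq => ?_
    have h1 : S.sm q.1 = T.rm y := hq.1
    have h2 : 𝒢₂.r q.2 = T.rm y := hq.2
    exact ⟨h1, h1.trans h2.symm⟩
  · exact (hK.inter_right hcl).image (by fun_prop)
  · rintro _ ⟨q, ⟨hq, hqy⟩, rfl⟩
    have h1 : S.sm q.1.1.1 = 𝒢₂.r q.2 := hKW hq
    have h2 : q.1.1.2 = y := hqy
    have h3 : S.sm q.1.1.1 = T.rm y := h2 ▸ q.1.2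
    exact ⟨h3, h1.symm.trans h3⟩
  · rintro _ ⟨q, ⟨hq, -⟩, rfl⟩
    exact hKU q hq
  · rintro ⟨x, γ⟩ hq hqK
    have h1 : S.sm x = T.rm y := hq.1
    have h2 : 𝒢₂.r γ = T.rm y := hq.2
    simp only [extend_fibreProd S T h1]
    exact h0 _ (h1.trans h2.symm) fun h => hqK ⟨_, ⟨h, rfl⟩, rfl⟩

end ProductIntegral

/-! ### Symmetry of the measure on the arrows -/

section Symmetry

variable {B₁ G₁ B₂ G₂ B₃ G₃ X Y : Type*}
  [TopologicalSpace B₁] [TopologicalSpace G₁] [MeasurableSpace G₁]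
  [TopologicalSpace B₂] [TopologicalSpace G₂] [MeasurableSpace G₂]
  [TopologicalSpace B₃] [TopologicalSpace G₃] [MeasurableSpace G₃]
  [TopologicalSpace X] [MeasurableSpace X] [TopologicalSpace Y] [MeasurableSpace Y]
  {𝒢₁ : LCGroupoid B₁ G₁} {χ₁ : HaarSystem 𝒢₁} {𝒢₂ : LCGroupoid B₂ G₂} {χ₂ : HaarSystem 𝒢₂}
  {𝒢₃ : LCGroupoid B₃ G₃} {χ₃ : HaarSystem 𝒢₃}

/-- The integrand on `Z ⋊ G₂` that inversion and the adjoining function turn `F` into. -/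
noncomputable def twist (S : Bispace 𝒢₁ 𝒢₂ X) (T : Bispace 𝒢₂ 𝒢₃ Y) (Δ₂ : G₂ → Y → ℝ)
    (F : FibreProd S T × G₂ → ℂ) (q : FibreProd S T × G₂) : ℂ :=
  Δ₂ q.2 (T.lact (𝒢₂.inv q.2) q.1.1.2) * F (arrowInv S T q)

variable (S : TopCorrespondence 𝒢₁ χ₁ 𝒢₂ χ₂ X) (T : TopCorrespondence 𝒢₂ χ₂ 𝒢₃ χ₃ Y)

theorem IsAdjoiningFunction.isPiece_twist {Δ₂ : G₂ → Y → ℝ}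
    (hΔ : IsAdjoiningFunction χ₂ T.toBispace T.meas Δ₂) {U : Set G₂}
    {F : FibreProd S.toBispace T.toBispace × G₂ → ℂ}
    (hF : IsPiece (arrowSet S.toBispace T.toBispace) U F) :
    IsPiece (arrowSet S.toBispace T.toBispace) (𝒢₂.inv ⁻¹' U) (twist _ _ Δ₂ F) := by
  have hΔc : ContinuousOn (fun q : FibreProd S.toBispace T.toBispace × G₂ =>
      (Δ₂ q.2 (T.lact (𝒢₂.inv q.2) q.1.1.2) : ℂ)) (arrowSet S.toBispace T.toBispace) := by
    refine Complex.continuous_ofReal.comp_continuousOn ?_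
    refine ContinuousOn.congr (f := fun q : FibreProd S.toBispace T.toBispace × G₂ =>
      Δ₂ q.2 (diagAct S.toBispace T.toBispace q.1 q.2).1.2) ?_ fun q hq => ?_
    · refine hΔ.continuousOn.comp (f := fun q : FibreProd S.toBispace T.toBispace × G₂ =>
        (q.2, (diagAct S.toBispace T.toBispace q.1 q.2).1.2)) ?_ fun q hq => ?_
      · exact continuousOn_snd.prodMk
          ((continuous_snd.comp continuous_subtype_val).comp_continuousOn continuousOn_diagAct)
      · change 𝒢₂.s q.2 = T.rm (diagAct S.toBispace T.toBispace q.1 q.2).1.2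
        rw [← (diagAct S.toBispace T.toBispace q.1 q.2).2, sm_diagAct hq]
    · dsimp only
      rw [diagAct_val hq]
  exact hF.comp_arrowInv.mul_left hΔc

variable [BorelSpace X] [T2Space X] [T2Space Y]

/-- Integrating a piece over `X` gives a function on `G₂ ×_{B₂} Y` to which the defining property of
an adjoining function applies. -/
theorem integral_piece_mem_Cc {U : Set G₂} {F : FibreProd S.toBispace T.toBispace × G₂ → ℂ}
    (hF : IsPiece (arrowSet S.toBispace T.toBispace) U F) :
    (fun p : {p : G₂ × Y // 𝒢₂.s p.1 = T.rm p.2} =>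
      ∫ x, Function.extend Subtype.val (fun z => F (z, 𝒢₂.inv p.1.1)) 0 (x, p.1.2)
        ∂S.meas (T.rm p.1.2)) ∈ Cc _ := by
  have := 𝒢₂.t2_units
  have := S.isLocCompact.locallyCompactSpace
  have hUT := hF.t2Space
  obtain ⟨K, hKW, hK, hKU, h0⟩ := hF.exists_isCompact
  let V : Set {p : G₂ × Y // 𝒢₂.s p.1 = T.rm p.2} := {p | 𝒢₂.inv p.1.1 ∈ U}
  have hinv : Continuous fun p : {p : G₂ × Y // 𝒢₂.s p.1 = T.rm p.2} => 𝒢₂.inv p.1.1 :=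
    𝒢₂.continuous_inv.comp (continuous_fst.comp continuous_subtype_val)
  have hVT : T2Space V := by
    refine T2Space.of_injective_continuous
      (f := fun p : V => ((⟨𝒢₂.inv p.1.1.1, p.2⟩ : U), p.1.1.2)) (fun a b hab => ?_) ?_
    · obtain ⟨h1, h2⟩ := Prod.mk.inj hab
      have h3 := congrArg (fun w : U => 𝒢₂.inv w) h1
      simp only [𝒢₂.inv_inv] at h3
      exact Subtype.ext (Subtype.ext (Prod.ext h3 h2))
    · exact ((hinv.comp continuous_subtype_val).subtype_mk _).prodMk (by fun_prop)
  let e : arrowSet S.toBispace T.toBispace → {p : G₂ × Y // 𝒢₂.s p.1 = T.rm p.2} := fun q =>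
    ⟨(𝒢₂.inv q.1.2, q.1.1.1.2), by
      rw [𝒢₂.s_inv, ← q.1.1.2]
      exact Eq.symm q.2⟩
  have he : Continuous e := by
    refine Continuous.subtype_mk (Continuous.prodMk ?_ (by fun_prop)) _
    exact 𝒢₂.continuous_inv.comp (by fun_prop)
  have hzero : ∀ (p : {p : G₂ × Y // 𝒢₂.s p.1 = T.rm p.2}) (x : X) (hx : S.sm x = T.rm p.1.2),
      ((⟨(x, p.1.2), hx⟩ : FibreProd S.toBispace T.toBispace), 𝒢₂.inv p.1.1) ∉ K →
      Function.extend Subtype.val (fun z => F (z, 𝒢₂.inv p.1.1)) 0 (x, p.1.2) = 0 := by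
    intro p x hx hxK
    rw [extend_fibreProd S T hx]
    refine h0 _ ?_ hxK
    change S.sm x = 𝒢₂.r (𝒢₂.inv p.1.1)
    rw [𝒢₂.r_inv, p.2, hx]
  refine CcOn.mem_Cc (U := V) ⟨Continuous.continuousOn ?_, e '' (Subtype.val ⁻¹' K), ?_,
    (isCompact_preimage_val hK hKW).image he, ?_⟩ (hF.isOpen.preimage hinv)
  · refine S.continuousFamily.continuous_integral_of_isCompact
      (ρ := fun p : {p : G₂ × Y // 𝒢₂.s p.1 = T.rm p.2} => T.rm p.1.2)
      (T.continuous_rm.comp (by fun_prop)) isOpen_univ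
      (hK.image (f := fun q => q.1.1.1) (by fun_prop)) (Set.subset_univ _)
      (F := fun p x => Function.extend Subtype.val (fun z => F (z, 𝒢₂.inv p.1.1)) 0 (x, p.1.2))
      ?_ fun p x hx hxK => hzero p x hx.symm fun h => hxK ⟨_, h, rfl⟩
    refine (continuousOn_extend_arrows S T hF.continuousOn).comp
      (f := fun q : {p : G₂ × Y // 𝒢₂.s p.1 = T.rm p.2} × X =>
        ((q.2, q.1.1.2), 𝒢₂.inv q.1.1.1)) ?_ fun q hq => ?_
    · exact (Continuous.prodMk (by fun_prop) (hinv.comp continuous_fst)).continuousOn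
    · have h1 : T.rm q.1.1.2 = S.sm q.2 := hq.1
      refine ⟨h1.symm, ?_⟩
      change S.sm q.2 = 𝒢₂.r (𝒢₂.inv q.1.1.1)
      rw [𝒢₂.r_inv, q.1.2, h1]
  · rintro _ ⟨q, hq, rfl⟩
    change 𝒢₂.inv (𝒢₂.inv q.1.2) ∈ U
    rw [𝒢₂.inv_inv]
    exact hKU _ hq
  · intro p hp
    refine integral_eq_zero_of_ae ?_
    filter_upwards [S.continuousFamily.ae_mem_fibre (T.rm p.1.2)] with x hx
    refine hzero p x hx fun h => hp ⟨⟨_, hKW h⟩, h, ?_⟩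
    exact Subtype.ext (Prod.ext (𝒢₂.inv_inv _) rfl)

/-- The adjoining function of `Y` is the Radon–Nikodym cocycle of inversion on `Z ⋊ G₂`. -/
theorem productIntegral_twist_of_isPiece [BorelSpace G₂] {Δ₂ : G₂ → Y → ℝ}
    (hΔ : IsAdjoiningFunction χ₂ T.toBispace T.meas Δ₂) {U : Set G₂}
    {F : FibreProd S.toBispace T.toBispace × G₂ → ℂ}
    (hF : IsPiece (arrowSet S.toBispace T.toBispace) U F) (u : B₃) :
    productIntegral S.toBispace T.toBispace S.meas T.meas u
      (fun z => ∫ γ, F (z, γ) ∂χ₂.meas (S.sm z.1.1)) =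
    productIntegral S.toBispace T.toBispace S.meas T.meas u
      (fun z => ∫ γ, twist _ _ Δ₂ F (z, γ) ∂χ₂.meas (S.sm z.1.1)) := by
  rw [productIntegral_integral_arrows S T hF,
    productIntegral_integral_arrows S T (hΔ.isPiece_twist S T hF)]
  have hadj := hΔ.integral_eq u _ (integral_piece_mem_Cc S T hF)
  obtain ⟨K, hKW, hK, hKU, h0⟩ := hF.exists_isCompact
  refine Eq.trans ?_ (hadj.trans ?_)
  · refine integral_congr_ae (Filter.Eventually.of_forall fun y => integral_congr_ae ?_)
    filter_upwards [χ₂.continuousFamily.ae_mem_fibre (T.rm y)] with γ hγ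
    have h1 : 𝒢₂.s (𝒢₂.inv γ) = T.rm y := by rw [𝒢₂.s_inv, hγ]
    have h4 := Subtype.val_injective.extend_apply
      (fun p : {p : G₂ × Y // 𝒢₂.s p.1 = T.rm p.2} =>
        ∫ x, Function.extend Subtype.val (fun z => F (z, 𝒢₂.inv p.1.1)) 0 (x, p.1.2)
          ∂S.meas (T.rm p.1.2)) 0 ⟨(𝒢₂.inv γ, y), h1⟩
    dsimp only at h4 ⊢
    rw [h4, 𝒢₂.inv_inv]
  · refine integral_congr_ae (Filter.Eventually.of_forall fun y => integral_congr_ae ?_)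
    filter_upwards [χ₂.continuousFamily.ae_mem_fibre (T.rm y)] with γ hγ
    have h2 : 𝒢₂.s (𝒢₂.inv γ) = T.rm y := by rw [𝒢₂.s_inv, hγ]
    have h3 : T.rm (T.lact (𝒢₂.inv γ) y) = 𝒢₂.s γ := by rw [T.rm_lact _ _ h2, 𝒢₂.r_inv]
    have h4 := Subtype.val_injective.extend_apply
      (fun p : {p : G₂ × Y // 𝒢₂.s p.1 = T.rm p.2} =>
        ∫ x, Function.extend Subtype.val (fun z => F (z, 𝒢₂.inv p.1.1)) 0 (x, p.1.2)
          ∂S.meas (T.rm p.1.2)) 0 ⟨(γ, T.lact (𝒢₂.inv γ) y), h3.symm⟩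
    dsimp only at h4 ⊢
    rw [h4, h3, ← integral_ract S (hK.image (f := fun q => q.1.1.1) (by fun_prop)) γ
      (k := fun x => Function.extend Subtype.val (fun z => F (z, 𝒢₂.inv γ)) 0
        (x, T.lact (𝒢₂.inv γ) y)), hγ, mul_comm, ← integral_const_mul]
    · refine integral_congr_ae ?_
      filter_upwards [S.continuousFamily.ae_mem_fibre (T.rm y)] with x hx
      have h5 : S.sm x = 𝒢₂.r γ := hx.trans hγ.symm
      simp only [extend_fibreProd S T hx]
      rw [← diagAct_val (S := S.toBispace) (T := T.toBispace) (z := ⟨(x, y), hx⟩) h5,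
        Subtype.val_injective.extend_apply]
      rfl
    · refine (continuousOn_extend_arrows S T hF.continuousOn).comp
        (f := fun x : X => ((x, T.lact (𝒢₂.inv γ) y), 𝒢₂.inv γ)) (by fun_prop) fun x hx => ?_
      have h5 : S.sm x = 𝒢₂.s γ := hx
      refine ⟨h5.trans h3.symm, ?_⟩
      change S.sm x = 𝒢₂.r (𝒢₂.inv γ)
      rw [𝒢₂.r_inv, h5]
    · intro x hx hxK
      rw [extend_fibreProd S T (hx.trans h3.symm)]
      refine h0 _ ?_ fun h => hxK ⟨_, h, rfl⟩
      change S.sm x = 𝒢₂.r (𝒢₂.inv γ)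
      rw [𝒢₂.r_inv, hx]

variable [BorelSpace Y] [BorelSpace G₂] [hT2 : T2Space (arrowSet S.toBispace T.toBispace)]

theorem productIntegral_twist {Δ₂ : G₂ → Y → ℝ}
    (hΔ : IsAdjoiningFunction χ₂ T.toBispace T.meas Δ₂)
    {F : FibreProd S.toBispace T.toBispace × G₂ → ℂ}
    (hF : CcAlong (arrowSet S.toBispace T.toBispace) F) (u : B₃) :
    productIntegral S.toBispace T.toBispace S.meas T.meas u
      (fun z => ∫ γ, F (z, γ) ∂χ₂.meas (S.sm z.1.1)) =
    productIntegral S.toBispace T.toBispace S.meas T.meas u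
      (fun z => ∫ γ, twist _ _ Δ₂ F (z, γ) ∂χ₂.meas (S.sm z.1.1)) := by
  have := 𝒢₂.t2_units
  have := TopCorrespondence.locallyCompactSpace_fibreProd S T
  have hsm := continuous_sm_fst S.toBispace T.toBispace
  obtain ⟨n, U, G, hG, hFG⟩ := hF.exists_sum_isPiece 𝒢₂.isLocCompact
    (χ₂.continuousFamily.isClosed_fibreProduct hsm)
  have key : ∀ (H : FibreProd S.toBispace T.toBispace × G₂ → ℂ) (V : Fin n → Set G₂)
      (J : Fin n → FibreProd S.toBispace T.toBispace × G₂ → ℂ),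
      (∀ i, IsPiece (arrowSet S.toBispace T.toBispace) (V i) (J i)) →
      (∀ q ∈ arrowSet S.toBispace T.toBispace, H q = ∑ i, J i q) →
      productIntegral S.toBispace T.toBispace S.meas T.meas u
        (fun z => ∫ γ, H (z, γ) ∂χ₂.meas (S.sm z.1.1)) =
      ∑ i, productIntegral S.toBispace T.toBispace S.meas T.meas u
        (fun z => ∫ γ, J i (z, γ) ∂χ₂.meas (S.sm z.1.1)) := by
    intro H V J hJ hHJ
    rw [← productIntegral_sum S T _ fun i => integral_arrows_mem_Cc S T (hJ i)]
    congr 1 with z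
    rw [Finset.sum_apply, ← integral_finsetSum _ fun i _ =>
      χ₂.continuousFamily.integrable_isPiece (ρ := fun z => S.sm z.1.1) 𝒢₂.isLocCompact (hJ i) z]
    refine integral_congr_ae ?_
    filter_upwards [χ₂.continuousFamily.ae_mem_fibre (S.sm z.1.1)] with γ hγ using
      hHJ (z, γ) hγ.symm
  rw [key F U G hG hFG, key _ _ _ (fun i => hΔ.isPiece_twist S T (hG i)) fun q hq => ?_]
  · exact Finset.sum_congr rfl fun i _ => productIntegral_twist_of_isPiece S T hΔ (hG i) u
  · simp only [twist]
    rw [hFG _ (mapsTo_arrowInv _ _ hq), Finset.mul_sum]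

/-- The measure `b m_u` is symmetric: the function `b` compensates the adjoining function. -/
theorem productIntegral_symm {Δ₂ : G₂ → Y → ℝ}
    (hΔ : IsAdjoiningFunction χ₂ T.toBispace T.meas Δ₂)
    {b : FibreProd S.toBispace T.toBispace → ℝ}
    (hb : IsDecomposition S.toBispace T.toBispace Δ₂ b)
    {f g : FibreProd S.toBispace T.toBispace → ℂ} (hf : f ∈ Cc _) (hg : g ∈ Cc _) (u : B₃) :
    productIntegral S.toBispace T.toBispace S.meas T.meas u
      (fun z => (b z : ℂ) * (f z * orbitSum χ₂ _ _ g z)) =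
    productIntegral S.toBispace T.toBispace S.meas T.meas u
      (fun z => (b z : ℂ) * (g z * orbitSum χ₂ _ _ f z)) := by
  obtain ⟨hfc, hfs⟩ := (mem_Cc_iff f).1 hf
  have hF : CcAlong (arrowSet S.toBispace T.toBispace) fun q =>
      (b q.1 : ℂ) * f q.1 * g (diagAct _ _ q.1 q.2) :=
    (properlySupportedAlong_diagAct S T hg).ccAlong_mul (φ := fun z => (b z : ℂ) * f z)
      ((Complex.continuous_ofReal.comp hb.continuous).mul hfc) hfs.mul_left
  have h1 := productIntegral_twist S T hΔ hF u
  refine Eq.trans ?_ (h1.trans ?_)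
  · congr 1 with z
    rw [← mul_assoc, orbitSum, ← integral_const_mul]
  · congr 1 with z
    rw [← mul_assoc, orbitSum, ← integral_const_mul]
    refine integral_congr_ae ?_
    filter_upwards [χ₂.continuousFamily.ae_mem_fibre (S.sm z.1.1)] with γ hγ
    have h2 := hb.decomposes (diagAct _ _ z γ) z (𝒢₂.inv γ)
      (by rw [sm_diagAct hγ.symm, 𝒢₂.r_inv]) (by
        rw [← diagAct_val (by rw [sm_diagAct hγ.symm, 𝒢₂.r_inv]), diagAct_diagAct_inv hγ.symm])
    rw [𝒢₂.inv_inv, diagAct_val hγ.symm] at h2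
    simp only [twist, arrowInv, diagAct_diagAct_inv hγ.symm]
    dsimp only at h2
    rw [← h2]
    have h3 := (hb.pos (diagAct _ _ z γ)).ne'
    have h4 : (b (diagAct _ _ z γ) : ℂ) ≠ 0 := by exact_mod_cast h3
    push_cast
    field_simp

end Symmetry

/-! ### Disintegration along the quotient map -/

section Disintegration

variable {B₁ G₁ B₂ G₂ B₃ G₃ X Y : Type*}
  [TopologicalSpace B₁] [TopologicalSpace G₁] [MeasurableSpace G₁]
  [TopologicalSpace B₂] [TopologicalSpace G₂] [MeasurableSpace G₂]
  [TopologicalSpace B₃] [TopologicalSpace G₃] [MeasurableSpace G₃]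
  [TopologicalSpace X] [MeasurableSpace X] [TopologicalSpace Y] [MeasurableSpace Y]
  {𝒢₁ : LCGroupoid B₁ G₁} {χ₁ : HaarSystem 𝒢₁} {𝒢₂ : LCGroupoid B₂ G₂} {χ₂ : HaarSystem 𝒢₂}
  {𝒢₃ : LCGroupoid B₃ G₃} {χ₃ : HaarSystem 𝒢₃}

variable [BorelSpace G₂] [T2Space X] [T2Space Y]
  (S : TopCorrespondence 𝒢₁ χ₁ 𝒢₂ χ₂ X) (T : TopCorrespondence 𝒢₂ χ₂ 𝒢₃ χ₃ Y)
  [hT2 : T2Space (arrowSet S.toBispace T.toBispace)] {Δ₂ : G₂ → Y → ℝ}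
  {b : FibreProd S.toBispace T.toBispace → ℝ}

theorem Disintegrates.unique {u : B₃} {ν ν' : Measure (Omega S.toBispace T.toBispace)}
    (hν : IsRadon ν) (hν' : IsRadon ν')
    (h : Disintegrates χ₂ S.toBispace T.toBispace S.meas T.meas b u ν)
    (h' : Disintegrates χ₂ S.toBispace T.toBispace S.meas T.meas b u ν') : ν = ν' := by
  have := t2Space_Omega S T
  have := locallyCompactSpace_Omega S T
  have := hν.regular
  have := hν'.regular
  refine Measure.ext_of_integral_eq_on_compactlySupported fun φ => ?_
  obtain ⟨g, -, hg, hgφ⟩ := exists_orbitIntegral_eq S T (ofReal_mem_Cc φ)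
  have h1 := (h _ hg).symm.trans (h' _ hg)
  rw [hgφ, integral_complex_ofReal, integral_complex_ofReal] at h1
  exact_mod_cast h1

variable [BorelSpace X] [BorelSpace Y]

/-- Symmetry makes `b m_u` factor through integration over the orbits. -/
theorem productIntegral_eq_zero
    (hΔ : IsAdjoiningFunction χ₂ T.toBispace T.meas Δ₂)
    (hb : IsDecomposition S.toBispace T.toBispace Δ₂ b)
    {f : FibreProd S.toBispace T.toBispace → ℂ} (hf : f ∈ Cc _)
    (h0 : orbitIntegral χ₂ S.toBispace T.toBispace f = 0) (u : B₃) :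
    productIntegral S.toBispace T.toBispace S.meas T.meas u (fun z => (b z : ℂ) * f z) = 0 := by
  have := t2Space_Omega S T
  have := locallyCompactSpace_Omega S T
  obtain ⟨-, hfs⟩ := (mem_Cc_iff f).1 hf
  obtain ⟨k, hk1, -, hks, -⟩ := exists_continuous_one_zero_of_isCompact
    (hfs.isCompact.image (continuous_omegaMk (S := S.toBispace) (T := T.toBispace)))
    isClosed_empty (Set.disjoint_empty _)
  obtain ⟨g, -, hg, hgk⟩ := exists_orbitIntegral_eq S T (φ := fun ω => (k ω : ℂ))
    ((mem_Cc_iff _).2 ⟨by fun_prop,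
      hks.comp_left (g := fun r : ℝ => (r : ℂ)) Complex.ofReal_zero⟩)
  have h1 := productIntegral_symm S T hΔ hb hf hg u
  have h2 : ∀ z, orbitSum χ₂ S.toBispace T.toBispace f z = 0 := fun z => by
    rw [← orbitIntegral_omegaMk S T hf, h0]
    rfl
  have h3 : ∀ z, f z * orbitSum χ₂ S.toBispace T.toBispace
      (fun z => (g z : ℂ) * (k (omegaMk _ _ z) : ℂ)) z = f z := by
    intro z
    by_cases hz : z ∈ tsupport f
    · rw [← orbitIntegral_omegaMk S T hg, hgk]
      dsimp only
      rw [hk1 ⟨z, hz, rfl⟩]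
      simp
    · rw [image_eq_zero_of_notMem_tsupport hz, zero_mul]
  simp only [h2, h3, mul_zero] at h1
  rw [h1]
  have h4 := productIntegral_smul S T 0 0 u
  rw [zero_smul, zero_mul] at h4
  exact h4

theorem productIntegral_congr_orbitIntegral
    (hΔ : IsAdjoiningFunction χ₂ T.toBispace T.meas Δ₂)
    (hb : IsDecomposition S.toBispace T.toBispace Δ₂ b)
    {f g : FibreProd S.toBispace T.toBispace → ℂ}
    (hf : f ∈ Cc _) (hg : g ∈ Cc _)
    (h : orbitIntegral χ₂ S.toBispace T.toBispace f = orbitIntegral χ₂ _ _ g) (u : B₃) :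
    productIntegral S.toBispace T.toBispace S.meas T.meas u (fun z => (b z : ℂ) * f z) =
      productIntegral S.toBispace T.toBispace S.meas T.meas u (fun z => (b z : ℂ) * g z) := by
  have hg' := Submodule.smul_mem _ (-1 : ℂ) hg
  have h1 := productIntegral_eq_zero S T hΔ hb (Submodule.add_mem _ hf hg') (by
    rw [orbitIntegral_add S T hf hg', orbitIntegral_smul, h]
    simp) u
  have h2 : (fun z => (b z : ℂ) * (f + (-1 : ℂ) • g) z) =
      (fun z => (b z : ℂ) * f z) + (-1 : ℂ) • fun z => (b z : ℂ) * g z := by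
    ext z
    simp [mul_add]
  rw [h2, productIntegral_add S T (mul_mem_Cc hb.continuous hf)
    (Submodule.smul_mem _ _ (mul_mem_Cc hb.continuous hg)), productIntegral_smul] at h1
  linear_combination h1

/-- The measure `μ_u` on `Ω` exists: `b m_u` descends to a positive functional on `C_c(Ω)`, which
the Riesz–Markov–Kakutani theorem represents. -/
theorem exists_disintegrates [SecondCountableTopology X] [SecondCountableTopology Y]
    (hΔ : IsAdjoiningFunction χ₂ T.toBispace T.meas Δ₂)
    (hb : IsDecomposition S.toBispace T.toBispace Δ₂ b) (u : B₃) :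
    ∃ ν : Measure (Omega S.toBispace T.toBispace), IsRadon ν ∧
      Disintegrates χ₂ S.toBispace T.toBispace S.meas T.meas b u ν := by
  have := t2Space_Omega S T
  have := locallyCompactSpace_Omega S T
  have := sigmaCompactSpace_Omega S T
  let Ω := Omega S.toBispace T.toBispace
  -- `m` is the functional `b m_u` on `Z`
  let m : (FibreProd S.toBispace T.toBispace → ℂ) → ℂ := fun f =>
    productIntegral S.toBispace T.toBispace S.meas T.meas u (fun z => (b z : ℂ) * f z)
  have madd : ∀ f ∈ Cc (FibreProd S.toBispace T.toBispace),
      ∀ g ∈ Cc (FibreProd S.toBispace T.toBispace), m (f + g) = m f + m g := by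
    intro f hf g hg
    simp only [m]
    rw [← productIntegral_add S T (mul_mem_Cc hb.continuous hf) (mul_mem_Cc hb.continuous hg)]
    congr 1 with z
    simp [mul_add]
  have msmul : ∀ (c : ℂ) f, m (c • f) = c * m f := by
    intro c f
    simp only [m]
    rw [← productIntegral_smul S T]
    congr 1 with z
    simp [mul_left_comm]
  choose g hg0 hg hgφ using fun φ : CompactlySupportedContinuousMap Ω ℝ =>
    exists_orbitIntegral_eq S T (ofReal_mem_Cc φ)
  let f : CompactlySupportedContinuousMap Ω ℝ → FibreProd S.toBispace T.toBispace → ℂ :=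
    fun φ z => (g φ z : ℂ) * (φ (omegaMk _ _ z) : ℂ)
  have hf : ∀ φ, f φ ∈ Cc _ := hg
  have hfφ : ∀ φ, orbitIntegral χ₂ _ _ (f φ) = fun ω => (φ ω : ℂ) := hgφ
  have hm : ∀ φ, ∀ k ∈ Cc _, orbitIntegral χ₂ _ _ k = (fun ω => (φ ω : ℂ)) → m k = m (f φ) :=
    fun φ k hk hkφ => productIntegral_congr_orbitIntegral S T hΔ hb hk (hf φ)
      (hkφ.trans (hfφ φ).symm) u
  let Λ : CompactlySupportedContinuousMap Ω ℝ →ₚ[ℝ] ℝ := PositiveLinearMap.mk₀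
    { toFun := fun φ => (m (f φ)).re
      map_add' := fun φ ψ => by
        rw [← hm (φ + ψ) (f φ + f ψ) (Submodule.add_mem _ (hf φ) (hf ψ)) (by
          rw [orbitIntegral_add S T (hf φ) (hf ψ), hfφ, hfφ]
          ext ω
          simp), madd _ (hf φ) _ (hf ψ), Complex.add_re]
      map_smul' := fun c φ => by
        rw [← hm (c • φ) ((c : ℂ) • f φ) (Submodule.smul_mem _ _ (hf φ)) (by
          rw [orbitIntegral_smul, hfφ]
          ext ω
          simp), msmul, Complex.re_ofReal_mul]
        rfl }
    (fun φ hφ => by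
      have h1 := productIntegral_re_nonneg S.toBispace T.toBispace S.meas T.meas u
        (f := fun z => b z * (g φ z * φ (omegaMk _ _ z)))
        fun z => mul_nonneg (hb.pos z).le (mul_nonneg (hg0 φ z) (hφ _))
      simpa [m, f] using h1)
  let ν : Measure Ω := RealRMK.rieszMeasure Λ
  have hΛ : ∀ φ : CompactlySupportedContinuousMap Ω ℝ, ∫ ω, φ ω ∂ν = (m (f φ)).re := fun φ =>
    RealRMK.integral_rieszMeasure Λ φ
  have hreg : ν.Regular := RealRMK.regular_rieszMeasure Λ
  refine ⟨ν, ⟨hreg, inferInstance⟩, ?_⟩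
  have hreal : ∀ p : FibreProd S.toBispace T.toBispace → ℝ, (fun z => (p z : ℂ)) ∈ Cc _ →
      m (fun z => (p z : ℂ)) =
        ∫ ω, orbitIntegral χ₂ _ _ (fun z => (p z : ℂ)) ω ∂ν := by
    intro p hp
    obtain ⟨h1, h2⟩ := (mem_Cc_iff _).1 (orbitIntegral_mem_Cc S T hp)
    have h3 : ∀ ω, orbitIntegral χ₂ S.toBispace T.toBispace (fun z => (p z : ℂ)) ω =
        ((orbitIntegral χ₂ S.toBispace T.toBispace (fun z => (p z : ℂ)) ω).re : ℂ) := by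
      intro ω
      rw [orbitIntegral_eq_orbitSum_out, orbitSum, integral_complex_ofReal, Complex.ofReal_re]
    let φ : CompactlySupportedContinuousMap Ω ℝ :=
      ⟨⟨fun ω => (orbitIntegral χ₂ _ _ (fun z => (p z : ℂ)) ω).re, by fun_prop⟩,
        h2.comp_left (g := Complex.re) Complex.zero_re⟩
    have h4 : (m fun z => (p z : ℂ)).im = 0 := by
      have h5 := productIntegral_ofReal S.toBispace T.toBispace S.meas T.meas u
        (fun z => b z * p z)
      simp only [m]
      push_cast at h5
      rw [h5, Complex.ofReal_im]
    have h6 := hm φ _ hp (funext h3)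
    rw [integral_congr_ae (Filter.Eventually.of_forall h3), integral_complex_ofReal]
    have h7 := hΛ φ
    refine Complex.ext ?_ (by rw [h4, Complex.ofReal_im])
    rw [Complex.ofReal_re, h6]
    exact h7.symm
  intro k hk
  obtain ⟨p, q, hp, hq, rfl⟩ := exists_re_im_of_mem_Cc hk
  have hq' := Submodule.smul_mem _ Complex.I hq
  have h1 := madd _ hp _ hq'
  rw [msmul, hreal p hp, hreal q hq] at h1
  refine h1.trans ?_
  rw [orbitIntegral_add S T hp hq', orbitIntegral_smul, ← integral_const_mul,
    ← integral_add (integrable_of_mem_Cc (orbitIntegral_mem_Cc S T hp) _)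
      ((integrable_of_mem_Cc (orbitIntegral_mem_Cc S T hq) _).const_mul _)]
  rfl

end Disintegration

/-! ### The quotient measures form an invariant continuous family -/

section QuotientFamily

variable {B₁ G₁ B₂ G₂ B₃ G₃ X Y : Type*}
  [TopologicalSpace B₁] [TopologicalSpace G₁] [MeasurableSpace G₁]
  [TopologicalSpace B₂] [TopologicalSpace G₂] [MeasurableSpace G₂]
  [TopologicalSpace B₃] [TopologicalSpace G₃] [MeasurableSpace G₃]
  [TopologicalSpace X] [MeasurableSpace X] [TopologicalSpace Y] [MeasurableSpace Y]
  {𝒢₁ : LCGroupoid B₁ G₁} {χ₁ : HaarSystem 𝒢₁} {𝒢₂ : LCGroupoid B₂ G₂} {χ₂ : HaarSystem 𝒢₂}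
  {𝒢₃ : LCGroupoid B₃ G₃} {χ₃ : HaarSystem 𝒢₃}
  [BorelSpace G₂] [BorelSpace X] [T2Space X] [T2Space Y]
  (S : TopCorrespondence 𝒢₁ χ₁ 𝒢₂ χ₂ X) (T : TopCorrespondence 𝒢₂ χ₂ 𝒢₃ χ₃ Y)
  [hT2 : T2Space (arrowSet S.toBispace T.toBispace)] {Δ₂ : G₂ → Y → ℝ}
  {b : FibreProd S.toBispace T.toBispace → ℝ} {μ : B₃ → Measure (Omega S.toBispace T.toBispace)}

/-- Continuity in `u` is that of the product integrals, applied to a function on `Z` whose orbit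
integral is the given function on `Ω`. -/
theorem isContinuousFamily_of_disintegrates
    (hb : IsDecomposition S.toBispace T.toBispace Δ₂ b)
    (hμ : ∀ u, IsRadon (μ u) ∧ Disintegrates χ₂ S.toBispace T.toBispace S.meas T.meas b u (μ u)) :
    IsContinuousFamily (omegaMomentum S.toBispace T.toBispace) μ := by
  have := t2Space_Omega S T
  have := locallyCompactSpace_Omega S T
  have := 𝒢₃.t2_units
  have hmom := continuous_omegaMomentum S.toBispace T.toBispace
  refine ⟨hmom, fun u => (hμ u).1, fun u => ?_, fun f hf => ?_⟩
  · have := (hμ u).1.regular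
    have hO : IsOpen (omegaMomentum S.toBispace T.toBispace ⁻¹' {u})ᶜ :=
      (isClosed_singleton.preimage hmom).isOpen_compl
    rw [hO.measure_eq_iSup_isCompact]
    simp only [ENNReal.iSup_eq_zero]
    intro K hKO hK
    obtain ⟨φ, hφ1, hφ0, hφs, hφI⟩ := exists_continuous_one_zero_of_isCompact hK
      hO.isClosed_compl (Set.disjoint_compl_right_iff_subset.2 hKO)
    have hφ : (fun ω => (φ ω : ℂ)) ∈ Cc (Omega S.toBispace T.toBispace) :=
      ofReal_mem_Cc ⟨φ, hφs⟩
    obtain ⟨g, -, hg, hgφ⟩ := exists_orbitIntegral_eq S T hφ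
    have h1 := (hμ u).2 _ hg
    have h2 : productIntegral S.toBispace T.toBispace S.meas T.meas u
        (fun z => (b z : ℂ) * ((g z : ℂ) * (φ (omegaMk _ _ z) : ℂ))) = 0 := by
      refine integral_eq_zero_of_ae ?_
      filter_upwards [T.continuousFamily.ae_mem_fibre u] with y hy
      refine integral_eq_zero_of_ae ?_
      filter_upwards [S.continuousFamily.ae_mem_fibre (T.rm y)] with x hx
      have h3 : φ (omegaMk S.toBispace T.toBispace ⟨(x, y), hx⟩) = 0 :=
        hφ0 (not_not.2 (show omegaMomentum S.toBispace T.toBispace (omegaMk _ _ ⟨(x, y), hx⟩) = u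
          from hy))
      rw [extend_fibreProd S T hx, h3]
      simp
    rw [h2, hgφ, integral_complex_ofReal] at h1
    have h3 : ∫ ω, φ ω ∂μ u = 0 := by exact_mod_cast h1.symm
    have hint : Integrable φ (μ u) := φ.continuous.integrable_of_hasCompactSupport hφs
    rw [integral_eq_zero_iff_of_nonneg (fun ω => (hφI ω).1) hint] at h3
    refine measure_mono_null (fun ω hω => ?_) (ae_iff.1 h3)
    change ¬ φ ω = 0
    rw [hφ1 hω]
    exact one_ne_zero
  · obtain ⟨g, -, hg, hgf⟩ := exists_orbitIntegral_eq S T hf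
    convert productIntegral_mem_Cc S T (mul_mem_Cc hb.continuous hg) using 2 with u
    rw [(hμ u).2 _ hg, hgf]

/-- Invariance under `G₃` comes from that of `β` and `b`, by lifting a function on `Ω` to one on `Z`
of which it is the orbit integral. -/
theorem isRightInvariant_of_disintegrates [BorelSpace Y]
    (hb : IsDecomposition S.toBispace T.toBispace Δ₂ b)
    (hμ : ∀ u, IsRadon (μ u) ∧ Disintegrates χ₂ S.toBispace T.toBispace S.meas T.meas b u (μ u)) :
    IsRightInvariant 𝒢₃ (omegaAct S.toBispace T.toBispace) μ := by
  intro η f hf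
  have := TopCorrespondence.locallyCompactSpace_fibreProd S T
  have := 𝒢₃.t2_units
  have hsm := continuous_sm_snd S.toBispace T.toBispace
  obtain ⟨g, -, hk, hkf⟩ := exists_orbitIntegral_eq S T hf
  set k : FibreProd S.toBispace T.toBispace → ℂ := fun z => (g z : ℂ) * f (omegaMk _ _ z)
  obtain ⟨hkc, hks⟩ := (mem_Cc_iff k).1 hk
  have hC : ∀ v, IsClosed {z : FibreProd S.toBispace T.toBispace | T.sm z.1.2 = v} := fun v =>
    isClosed_singleton.preimage hsm
  -- `k'` is the translate of `k` by `η`, which makes sense over `r(η)` only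
  obtain ⟨k', hk'c, hk's, hk'⟩ := exists_extension_hasCompactSupport (hC (𝒢₃.r η))
    (K := rightAct _ _ (𝒢₃.inv η) '' (tsupport k ∩ {z | T.sm z.1.2 = 𝒢₃.s η}))
    (k := k ∘ rightAct _ _ η) (by
      refine (hks.isCompact.inter_right (hC _)).image_of_continuousOn
        ((continuousOn_rightAct _).mono fun z hz => ?_)
      change T.sm z.1.2 = 𝒢₃.r (𝒢₃.inv η)
      rw [𝒢₃.r_inv]
      exact hz.2) (hkc.comp_continuousOn (continuousOn_rightAct η)) (by
      intro z hz hzK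
      change k (rightAct _ _ η z) = 0
      refine image_eq_zero_of_notMem_tsupport fun h => hzK ⟨_, ⟨h, ?_⟩, rightAct_inv_rightAct hz⟩
      change T.sm (rightAct _ _ η z).1.2 = 𝒢₃.s η
      rw [rightAct_val hz, T.sm_ract _ _ hz])
  have hk'm : k' ∈ Cc _ := (mem_Cc_iff _).2 ⟨hk'c, hk's⟩
  have h1 : ∫ ω, f (omegaAct _ _ ω η) ∂μ (𝒢₃.r η) =
      ∫ ω, orbitIntegral χ₂ _ _ k' ω ∂μ (𝒢₃.r η) := by
    refine integral_congr_ae ?_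
    filter_upwards [(isContinuousFamily_of_disintegrates S T hb hμ).ae_mem_fibre (𝒢₃.r η)]
      with ω hω
    obtain ⟨z, rfl⟩ := surjective_omegaMk ω
    have hz : T.sm z.1.2 = 𝒢₃.r η := hω
    rw [omegaAct_omegaMk hz, ← hkf, orbitIntegral_omegaMk S T hk, orbitIntegral_omegaMk S T hk'm,
      orbitSum, orbitSum, rightAct_val hz]
    refine integral_congr_ae ?_
    filter_upwards [χ₂.continuousFamily.ae_mem_fibre (S.sm z.1.1)] with γ hγ
    rw [← rightAct_diagAct hγ.symm hz]
    exact (hk' _ ((sm_snd_diagAct hγ.symm).trans hz)).symm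
  rw [h1, ← (hμ _).2 _ hk'm]
  have h2 := T.invariant η _ (inner_mem_Cc S T (mul_mem_Cc hb.continuous hk))
  have h3 := (hμ (𝒢₃.s η)).2 _ hk
  rw [hkf] at h3
  refine Eq.trans ?_ (h2.trans h3)
  refine integral_congr_ae ?_
  filter_upwards [T.continuousFamily.ae_mem_fibre (𝒢₃.r η)] with y hy
  rw [T.rm_ract _ _ hy]
  refine integral_congr_ae ?_
  filter_upwards [S.continuousFamily.ae_mem_fibre (T.rm y)] with x hx
  have h4 : S.sm x = T.rm (T.ract y η) := by rw [T.rm_ract _ _ hy, hx]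
  have h5 := rightAct_val (S := S.toBispace) (T := T.toBispace) (z := ⟨(x, y), hx⟩) hy
  have h6 : rightAct _ _ η ⟨(x, y), hx⟩ =
      (⟨(x, T.ract y η), h4⟩ : FibreProd S.toBispace T.toBispace) := Subtype.ext h5
  rw [extend_fibreProd S T hx, extend_fibreProd S T h4, hk' _ hy, ← h6,
    hb.invariant ⟨(x, y), hx⟩ _ η hy h5]
  rfl

end QuotientFamily

/-! ### Invariant cocycles are coboundaries -/

/-- Weights that make a series of continuous functions converge normally near every point. -/
theorem exists_weights {Z : Type*} [TopologicalSpace Z] [WeaklyLocallyCompactSpace Z]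
    [SigmaCompactSpace Z] {t : ℕ → Z → ℝ} (ht : ∀ n, Continuous (t n)) :
    ∃ w : ℕ → ℝ, (∀ n, 0 < w n) ∧ ∀ z, ∃ V ∈ 𝓝 z, ∃ u : ℕ → ℝ, Summable u ∧
      ∀ n, ∀ x ∈ V, w n * |t n x| ≤ u n := by
  -- `w n` is `2⁻ⁿ` divided by a bound for `t n` on the `n`-th set of a compact exhaustion
  let K := CompactExhaustion.choice Z
  choose C hC using fun n m => (K.isCompact m).exists_bound_of_continuousOn (ht n).continuousOn
  have hC1 : ∀ n, 0 < 1 + |C n n| := fun n => by positivity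
  have hw : ∀ n, 0 < (1 / 2 : ℝ) ^ n / (1 + |C n n|) := fun n => div_pos (by positivity) (hC1 n)
  refine ⟨fun n => (1 / 2 : ℝ) ^ n / (1 + |C n n|), hw, fun z => ?_⟩
  obtain ⟨m, hm⟩ := K.exists_mem_nhds z
  refine ⟨K m, hm, fun n => if n < m then (1 / 2 : ℝ) ^ n / (1 + |C n n|) * C n m
    else (1 / 2 : ℝ) ^ n, ?_, fun n x hx => ?_⟩
  · rw [← summable_nat_add_iff m]
    refine ((summable_nat_add_iff m).2 summable_geometric_two).congr fun n => ?_
    rw [if_neg (by omega)]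
  · dsimp only
    by_cases h : n < m
    · rw [if_pos h]
      exact mul_le_mul_of_nonneg_left (hC n m x hx) (hw n).le
    · rw [if_neg h, div_mul_eq_mul_div, div_le_iff₀ (hC1 n)]
      refine mul_le_mul_of_nonneg_left ?_ (by positivity)
      have h1 := hC n n x (K.subset (not_lt.1 h) hx)
      rw [Real.norm_eq_abs] at h1
      linarith [le_abs_self (C n n)]

section Cocycle

variable {B₁ G₁ B₂ G₂ B₃ G₃ X Y : Type*}
  [TopologicalSpace B₁] [TopologicalSpace G₁] [MeasurableSpace G₁]
  [TopologicalSpace B₂] [TopologicalSpace G₂] [MeasurableSpace G₂]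
  [TopologicalSpace B₃] [TopologicalSpace G₃] [MeasurableSpace G₃]
  [TopologicalSpace X] [MeasurableSpace X] [TopologicalSpace Y] [MeasurableSpace Y]
  {𝒢₁ : LCGroupoid B₁ G₁} {χ₁ : HaarSystem 𝒢₁} {𝒢₂ : LCGroupoid B₂ G₂} {χ₂ : HaarSystem 𝒢₂}
  {𝒢₃ : LCGroupoid B₃ G₃} {χ₃ : HaarSystem 𝒢₃}
  [BorelSpace G₂] [T2Space X] [T2Space Y]
  (S : TopCorrespondence 𝒢₁ χ₁ 𝒢₂ χ₂ X) (T : TopCorrespondence 𝒢₂ χ₂ 𝒢₃ χ₃ Y)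
  [hT2 : T2Space (arrowSet S.toBispace T.toBispace)]

theorem integral_mul_left_real {F : FibreProd S.toBispace T.toBispace × G₂ → ℝ}
    (hF : ProperlySupportedAlong (arrowSet S.toBispace T.toBispace) fun q => (F q : ℂ))
    {z : FibreProd S.toBispace T.toBispace} {γ : G₂} (hγ : S.sm z.1.1 = 𝒢₂.r γ) :
    ∫ η, F (z, 𝒢₂.mul γ η) ∂χ₂.meas (𝒢₂.s γ) = ∫ η, F (z, η) ∂χ₂.meas (S.sm z.1.1) := by
  have h := integral_mul_left S T hF hγ
  rw [integral_complex_ofReal, integral_complex_ofReal] at h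
  exact_mod_cast h

theorem continuous_integral_arrows_real {F : FibreProd S.toBispace T.toBispace × G₂ → ℝ}
    (hF : ProperlySupportedAlong (arrowSet S.toBispace T.toBispace) fun q => (F q : ℂ)) :
    Continuous fun z => ∫ γ, F (z, γ) ∂χ₂.meas (S.sm z.1.1) := by
  refine (Complex.continuous_re.comp (continuous_integral_arrows S T hF)).congr fun z => ?_
  rw [Function.comp_apply, integral_complex_ofReal, Complex.ofReal_re]

/-- A function `h` on `Z` trivializes the cocycle `log Δ₂`. It is the average of the cocycle over
the orbit with respect to a weight `e = ∑ wₙ eₙ` on `X`, normalized by the integral of `e`. The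
weight lives on `X`, which makes `h` invariant under `G₃`. -/
theorem exists_isDecomposition [SecondCountableTopology X] [SecondCountableTopology Y]
    {Δ₂ : G₂ → Y → ℝ} (hΔ : IsAdjoiningFunction χ₂ T.toBispace T.meas Δ₂)
    (hcoc : IsInvariantCocycle T.toBispace Δ₂) :
    ∃ b, IsDecomposition S.toBispace T.toBispace Δ₂ b := by
  have := 𝒢₂.t2_units
  have := S.isLocCompact.locallyCompactSpace
  have := TopCorrespondence.locallyCompactSpace_fibreProd S T
  have : SecondCountableTopology (FibreProd S.toBispace T.toBispace) :=
    IsInducing.secondCountableTopology (f := Subtype.val) ⟨rfl⟩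
  choose e he1 _ hes heI using fun n : ℕ => exists_continuous_one_zero_of_isCompact
    (isCompact_compactCovering X n) isClosed_empty (Set.disjoint_empty _)
  let c : G₂ → Y → ℝ := fun γ y => Real.log (Δ₂ (𝒢₂.inv γ) y)
  have hrm : ∀ (z : FibreProd S.toBispace T.toBispace) (γ : G₂), S.sm z.1.1 = 𝒢₂.r γ →
      𝒢₂.s (𝒢₂.inv γ) = T.rm z.1.2 := fun z γ hγ => by rw [𝒢₂.s_inv, ← hγ, z.2]
  have hc : ∀ (z : FibreProd S.toBispace T.toBispace) (γ η : G₂), S.sm z.1.1 = 𝒢₂.r γ →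
      𝒢₂.s γ = 𝒢₂.r η →
      c (𝒢₂.mul γ η) z.1.2 = c η (T.lact (𝒢₂.inv γ) z.1.2) + c γ z.1.2 := by
    intro z γ η hγ hγη
    have h1 : 𝒢₂.s (𝒢₂.inv η) = 𝒢₂.r (𝒢₂.inv γ) := by rw [𝒢₂.s_inv, 𝒢₂.r_inv, hγη]
    simp only [c]
    rw [𝒢₂.inv_mul_rev hγη, hcoc.mul _ _ _ h1 (hrm z γ hγ), Real.log_mul]
    · exact (hΔ.pos _ _ (by rw [T.rm_lact _ _ (hrm z γ hγ), h1])).ne'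
    · exact (hΔ.pos _ _ (hrm z γ hγ)).ne'
  -- the integrals of `FE n` and `FN n` over an orbit are those of the bump function `e n` and of
  -- its product with the cocycle
  let FE : ℕ → FibreProd S.toBispace T.toBispace × G₂ → ℝ := fun n q => e n (S.ract q.1.1.1 q.2)
  let FN : ℕ → FibreProd S.toBispace T.toBispace × G₂ → ℝ := fun n q =>
    e n (S.ract q.1.1.1 q.2) * c q.2 q.1.1.2
  have hract : ContinuousOn (fun q : FibreProd S.toBispace T.toBispace × G₂ =>
      S.ract q.1.1.1 q.2) (arrowSet S.toBispace T.toBispace) :=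
    S.continuousOn_ract.comp
      (f := fun q : FibreProd S.toBispace T.toBispace × G₂ => (q.1.1.1, q.2))
      (by fun_prop) fun q hq => hq
  have hcc : ContinuousOn (fun q : FibreProd S.toBispace T.toBispace × G₂ => c q.2 q.1.1.2)
      (arrowSet S.toBispace T.toBispace) := by
    refine ContinuousOn.log ?_ fun q hq => (hΔ.pos _ _ (hrm q.1 q.2 hq)).ne'
    refine hΔ.continuousOn.comp
      (f := fun q : FibreProd S.toBispace T.toBispace × G₂ => (𝒢₂.inv q.2, q.1.1.2)) ?_
      fun q hq => hrm q.1 q.2 hq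
    exact ((𝒢₂.continuous_inv.comp continuous_snd).prodMk (by fun_prop)).continuousOn
  have hFE : ∀ n, ProperlySupportedAlong (arrowSet S.toBispace T.toBispace)
      fun q => (FE n q : ℂ) := fun n =>
    properlySupportedAlong_of_ract S T (Complex.continuous_ofReal.comp_continuousOn
      ((e n).continuous.comp_continuousOn hract)) (hes n).isCompact fun q _ hqK => by
        simp [FE, image_eq_zero_of_notMem_tsupport hqK]
  have hFN : ∀ n, ProperlySupportedAlong (arrowSet S.toBispace T.toBispace)
      fun q => (FN n q : ℂ) := fun n =>
    properlySupportedAlong_of_ract S T (Complex.continuous_ofReal.comp_continuousOn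
      (((e n).continuous.comp_continuousOn hract).mul hcc)) (hes n).isCompact fun q _ hqK => by
        simp [FN, image_eq_zero_of_notMem_tsupport hqK]
  let E : ℕ → FibreProd S.toBispace T.toBispace → ℝ := fun n z =>
    ∫ γ, FE n (z, γ) ∂χ₂.meas (S.sm z.1.1)
  let N : ℕ → FibreProd S.toBispace T.toBispace → ℝ := fun n z =>
    ∫ γ, FN n (z, γ) ∂χ₂.meas (S.sm z.1.1)
  have hE : ∀ n, Continuous (E n) := fun n => continuous_integral_arrows_real S T (hFE n)
  have hN : ∀ n, Continuous (N n) := fun n => continuous_integral_arrows_real S T (hFN n)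
  have hiE : ∀ n z, Integrable (fun γ => FE n (z, γ)) (χ₂.meas (S.sm z.1.1)) := fun n z =>
    (integrable_arrows S T (hFE n) z).re
  have hiN : ∀ n z, Integrable (fun γ => FN n (z, γ)) (χ₂.meas (S.sm z.1.1)) := fun n z =>
    (integrable_arrows S T (hFN n) z).re
  have hE0 : ∀ n z, 0 ≤ E n z := fun n z => integral_nonneg fun γ => (heI n _).1
  have hEpos : ∀ n z, z.1.1 ∈ compactCovering X n → 0 < E n z := by
    intro n z hz
    refine χ₂.integral_pos (γ := 𝒢₂.unit (S.sm z.1.1)) ?_ (hiE n z) (fun γ _ => (heI n _).1)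
      (𝒢₂.r_unit _) ?_
    · refine ((e n).continuous.comp_continuousOn hract).comp (f := fun γ => (z, γ)) (by fun_prop)
        fun γ hγ => ?_
      exact Eq.symm hγ
    · simp only [FE]
      rw [S.ract_unit, he1 n hz]
      exact one_ne_zero
  have hEinv : ∀ n z γ, S.sm z.1.1 = 𝒢₂.r γ → E n (diagAct _ _ z γ) = E n z := by
    intro n z γ hγ
    simp only [E]
    rw [← integral_mul_left_real S T (hFE n) hγ, sm_diagAct hγ]
    refine integral_congr_ae ?_
    filter_upwards [χ₂.continuousFamily.ae_mem_fibre (𝒢₂.s γ)] with η hη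
    simp only [FE]
    rw [diagAct_val hγ, S.ract_mul _ _ _ hγ hη.symm]
  have hNtr : ∀ n z γ, S.sm z.1.1 = 𝒢₂.r γ →
      N n (diagAct _ _ z γ) = N n z - c γ z.1.2 * E n z := by
    intro n z γ hγ
    rw [← hEinv n z γ hγ, eq_sub_iff_add_eq]
    simp only [N, E]
    rw [← integral_const_mul, ← integral_add (hiN n _) ((hiE n _).const_mul _),
      ← integral_mul_left_real S T (hFN n) hγ, sm_diagAct hγ]
    refine integral_congr_ae ?_
    filter_upwards [χ₂.continuousFamily.ae_mem_fibre (𝒢₂.s γ)] with η hη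
    simp only [FN, FE]
    rw [diagAct_val hγ, S.ract_mul _ _ _ hγ hη.symm, hc z γ η hγ hη.symm]
    ring
  obtain ⟨w, hw, hwb⟩ := exists_weights fun n => (hE n).abs.add (hN n).abs
  have hsum : ∀ A : ℕ → FibreProd S.toBispace T.toBispace → ℝ, (∀ n, Continuous (A n)) →
      (∀ n z, |A n z| ≤ |E n z| + |N n z|) →
      (∀ z, Summable fun n => w n * A n z) ∧ Continuous fun z => ∑' n, w n * A n z := by
    intro A hA hle
    have hb : ∀ z, ∃ V ∈ 𝓝 z, ∃ u : ℕ → ℝ, Summable u ∧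
        ∀ n, ∀ x ∈ V, ‖w n * A n x‖ ≤ u n := by
      intro z
      obtain ⟨V, hV, u, hu, huV⟩ := hwb z
      refine ⟨V, hV, u, hu, fun n x hx => le_trans ?_ (huV n x hx)⟩
      rw [Real.norm_eq_abs, abs_mul, abs_of_pos (hw n)]
      refine mul_le_mul_of_nonneg_left ((hle n x).trans (le_abs_self _)) (hw n).le
    refine ⟨fun z => ?_, continuous_iff_continuousAt.2 fun z => ?_⟩
    · obtain ⟨V, hV, u, hu, huV⟩ := hb z
      exact Summable.of_norm_bounded hu fun n => huV n z (mem_of_mem_nhds hV)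
    · obtain ⟨V, hV, u, hu, huV⟩ := hb z
      exact (continuousOn_tsum (fun n => ((hA n).const_mul (w n)).continuousOn) hu
        huV).continuousAt hV
  obtain ⟨hEs, hEc⟩ := hsum E hE fun n z => le_add_of_nonneg_right (abs_nonneg _)
  obtain ⟨hNs, hNc⟩ := hsum N hN fun n z => le_add_of_nonneg_left (abs_nonneg _)
  set Et : FibreProd S.toBispace T.toBispace → ℝ := fun z => ∑' n, w n * E n z with hEt
  set Nt : FibreProd S.toBispace T.toBispace → ℝ := fun z => ∑' n, w n * N n z with hNt
  have hEtpos : ∀ z, 0 < Et z := by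
    intro z
    obtain ⟨n, hn⟩ := exists_mem_compactCovering z.1.1
    exact (hEs z).tsum_pos (fun n => mul_nonneg (hw n).le (hE0 n z)) n
      (mul_pos (hw n) (hEpos n z hn))
  have hEtinv : ∀ z γ, S.sm z.1.1 = 𝒢₂.r γ → Et (diagAct _ _ z γ) = Et z := by
    intro z γ hγ
    simp only [hEt, hEinv _ z γ hγ]
  have hNttr : ∀ z γ, S.sm z.1.1 = 𝒢₂.r γ →
      Nt (diagAct _ _ z γ) = Nt z - c γ z.1.2 * Et z := by
    intro z γ hγ
    simp only [hEt, hNt, hNtr _ z γ hγ]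
    rw [← tsum_mul_left, ← (hNs z).tsum_sub ((hEs z).mul_left _)]
    congr 1 with n
    ring
  refine ⟨fun z => Real.exp (-(Nt z / Et z)), ⟨?_, fun z => Real.exp_pos _, ?_, ?_⟩⟩
  · exact Real.continuous_exp.comp (hNc.div hEc fun z => (hEtpos z).ne').neg
  · intro z z' η hη hz'
    have hsm : S.sm z'.1.1 = S.sm z.1.1 := by rw [hz']
    have h1 : ∀ n, E n z' = E n z := by
      intro n
      simp only [E, FE]
      rw [hz']
    have h2 : ∀ n, N n z' = N n z := by
      intro n
      simp only [N, FN]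
      rw [hsm]
      refine integral_congr_ae ?_
      filter_upwards [χ₂.continuousFamily.ae_mem_fibre (S.sm z.1.1)] with γ hγ
      simp only [c]
      rw [hz', hcoc.invariant _ _ _ (hrm z γ hγ.symm) hη]
    simp only [hEt, hNt, h1, h2]
  · intro z z' γ hγ hz'
    obtain rfl : z' = diagAct _ _ z γ := Subtype.ext (hz'.trans (diagAct_val hγ).symm)
    have h1 := (hEtpos z).ne'
    rw [← Real.exp_neg, ← Real.exp_add, hEtinv z γ hγ, hNttr z γ hγ,
      show -((Nt z - c γ z.1.2 * Et z) / Et z) + -(-(Nt z / Et z)) = c γ z.1.2 by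
        field_simp
        ring]
    exact Real.exp_log (hΔ.pos _ _ (hrm z γ hγ))

end Cocycle

theorem mainTheorem7
    {B₁ G₁ B₂ G₂ B₃ G₃ X Y : Type*}
    [TopologicalSpace B₁] [TopologicalSpace G₁] [MeasurableSpace G₁] [BorelSpace G₁]
    [TopologicalSpace B₂] [TopologicalSpace G₂] [MeasurableSpace G₂] [BorelSpace G₂]
    [TopologicalSpace B₃] [TopologicalSpace G₃] [MeasurableSpace G₃] [BorelSpace G₃]
    [TopologicalSpace X] [MeasurableSpace X] [BorelSpace X]
    [T2Space X] [SecondCountableTopology X]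
    [TopologicalSpace Y] [MeasurableSpace Y] [BorelSpace Y]
    [T2Space Y] [SecondCountableTopology Y]
    (𝒢₁ : LCGroupoid B₁ G₁) (χ₁ : HaarSystem 𝒢₁)
    (𝒢₂ : LCGroupoid B₂ G₂) (χ₂ : HaarSystem 𝒢₂)
    (𝒢₃ : LCGroupoid B₃ G₃) (χ₃ : HaarSystem 𝒢₃)
    (S : TopCorrespondence 𝒢₁ χ₁ 𝒢₂ χ₂ X) (T : TopCorrespondence 𝒢₂ χ₂ 𝒢₃ χ₃ Y)
    (hT2 : T2Space (TransArrows S.toBispace T.toBispace))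
    (Δ₂ : G₂ → Y → ℝ) (hΔ₂ : IsAdjoiningFunction χ₂ T.toBispace T.meas Δ₂) :
    (IsInvariantCocycle T.toBispace Δ₂ →
      ∃ b, IsDecomposition S.toBispace T.toBispace Δ₂ b) ∧
    ∀ b, IsDecomposition S.toBispace T.toBispace Δ₂ b →
      (∀ u, ∃! ν : Measure (Omega S.toBispace T.toBispace), IsRadon ν ∧
        Disintegrates χ₂ S.toBispace T.toBispace S.meas T.meas b u ν) ∧
      ∀ μ : B₃ → Measure (Omega S.toBispace T.toBispace),
        (∀ u, IsRadon (μ u) ∧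
          Disintegrates χ₂ S.toBispace T.toBispace S.meas T.meas b u (μ u)) →
        IsContinuousFamily (omegaMomentum S.toBispace T.toBispace) μ ∧
          IsRightInvariant 𝒢₃ (omegaAct S.toBispace T.toBispace) μ := by
  have : T2Space (arrowSet S.toBispace T.toBispace) := hT2
  refine ⟨exists_isDecomposition S T hΔ₂, fun b hb => ⟨fun u => ?_, fun μ hμ =>
    ⟨isContinuousFamily_of_disintegrates S T hb hμ, isRightInvariant_of_disintegrates S T hb hμ⟩⟩⟩
  obtain ⟨ν, hν, hd⟩ := exists_disintegrates S T hΔ₂ hb u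
  exact ⟨ν, ⟨hν, hd⟩, fun ν' h => Disintegrates.unique S T h.1 hν h.2 hd⟩
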